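/- **Definitions.** A partitioned permutation of $n$ elements is a pair $(\mathcal V,\pi)$, where $\pi\in S_n$ and $\mathcal V$ is a partition of $\{1,\dots,n\}$ each of whose blocks is a union of cycles of $\pi$. Let $\mathcal{PS}(n)$ be the set of these and $\mathcal{PS}=\bigcup_n\mathcal{PS}(n)$. Write $1_n$ for the one-block partition, $0_\pi$ for the partition into the cycles of $\pi$, $\#\mathcal V$ for the number of blocks, $\#\pi$ for the number of cycles, and $$|\mathcal V|=n-\#\mathcal V,\qquad |\pi|=n-\#\pi,\qquad |(\mathcal V,\pi)|=2|\mathcal V|-|\pi|.$$ The product $(\mathcal V,\pi)\cdot(\mathcal W,\sigma)$ is $(\mathcal V\vee\mathcal W,\pi\sigma)$ if $|(\mathcal V,\pi)|+|(\mathcal W,\sigma)|=|(\mathcal V\vee\mathcal W,\pi\sigma)|$, and $0$ otherwise. The convolution of $f,g:\mathcal{PS}\to\mathbb C$ is $$(f*g)(\mathcal U,\gamma)=\sum_{(\mathcal V,\pi)\cdot(\mathcal W,\sigma)=(\mathcal U,\gamma)}f(\mathcal V,\pi)\,g(\mathcal W,\sigma).$$ A function $f:\mathcal{PS}\to\mathbb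 C$ is multiplicative if $f(1_n,\pi)$ depends only on the conjugacy class of $\pi$ and $f(\mathcal V,\pi)=\prod_{V\in\mathcal V}f(1_V,\pi|_V)$. The function $\zeta$ is given by $\zeta(\mathcal V,\pi)=1$ if $\mathcal V=0_\pi$ and $\zeta(\mathcal V,\pi)=0$ otherwise. Put $\gamma_n=(1,2,\dots,n)$ and $\gamma_{m,n}=(1,\dots,m)(m+1,\dots,m+n)$. **Theorem.** Let $f$ and $h$ be multiplicative functions on $\mathcal{PS}$ with $h=f*\zeta$. For $m,n\ge1$ put $\kappa_n=f(1_n,\gamma_n)$, $\kappa_{m,n}=f(1_{m+n},\gamma_{m,n})$, $\alpha_n=h(1_n,\gamma_n)$, $\alpha_{m,n}=h(1_{m+n},\gamma_{m,n})$, and $$C(x)=1+\sum_{n\ge1}\kappa_nx^n,\quad C(x,y)=\sum_{m,n\ge1}\kappa_{m,n}x^my^n,\quad M(x)=1+\sum_{n\ge1}\alpha_nx^n,\quad M(x,y)=\sum_{m,n\ge1}\alpha_{m,n}x^my^n.$$ Then, as formal power series over $\mathbb C$, $$C(xM(x))=M(x),$$ and $$M(x,y)=H\bigl(xM(x),yM(y)\bigr)\cdot\frac{\frac{d}{dx}(xM(x))}{M(x)}\cdot\frac{\frac{d}{dy}(yM(y))}{M(y)},\qquad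 H(x,y)=C(x,y)-xy\frac{\partial^2}{\partial x\,\partial y}\log\Bigl(\frac{xC(y)-yC(x)}{x-y}\Bigr),$$ where the quotient $\frac{xC(y)-yC(x)}{x-y}$ is a formal power series with constant term $1$, so that its formal logarithm is defined. Equivalently, in the field of fractions of $\mathbb C[[x,y]]$, $$M(x,y)=C\bigl(xM(x),yM(y)\bigr)\cdot\frac{\frac{d}{dx}(xM(x))}{M(x)}\cdot\frac{\frac{d}{dy}(yM(y))}{M(y)}+xy\left(\frac{\frac{d}{dx}(xM(x))\cdot\frac{d}{dy}(yM(y))}{(xM(x)-yM(y))^2}-\frac1{(x-y)^2}\right).$$ -/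

import Mathlib

noncomputable section

namespace SecondOrderRTransform

open scoped Classical

/-! ### Partitioned permutations

A partition of `{1, …, n}` is represented by the equivalence relation `Setoid (Fin n)` whose
classes are its blocks; refinement is `≤`, the join of partitions is `⊔`, and the one-block
partition `1_n` is `⊤`. -/

/-- The partition `0_π` whose blocks are the cycles of `π` (fixed points included). -/
def cyclePartition {n : ℕ} (π : Equiv.Perm (Fin n)) : Setoid (Fin n) :=
  Equiv.Perm.SameCycle.setoid π

/-- The length `|V| = n - #V`, where `#V` is the number of blocks. -/
def partitionLength {n : ℕ} (V : Setoid (Fin n)) : ℤ :=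
  (n : ℤ) - (Nat.card (Quotient V) : ℤ)

/-- The length `|π| = n - #π`, where `#π` is the number of cycles (fixed points included). -/
def permLength {n : ℕ} (π : Equiv.Perm (Fin n)) : ℤ :=
  partitionLength (cyclePartition π)

/-- A partitioned permutation `(V, π)` of `n` elements: each block of `V` is a union of
cycles of `π`. -/
@[ext] structure PartitionedPerm (n : ℕ) where
  /-- the partition `V` -/
  part : Setoid (Fin n)
  /-- the permutation `π` -/
  perm : Equiv.Perm (Fin n)
  /-- `π ≤ V` -/
  cycle_le : cyclePartition perm ≤ part

instance (n : ℕ) : Finite (PartitionedPerm n) := by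
  have hS : Finite (Setoid (Fin n)) :=
    Finite.of_injective (fun s : Setoid (Fin n) => fun x y => s x y)
      (fun s t h => Setoid.ext fun x y => iff_of_eq (congrFun (congrFun h x) y))
  exact Finite.of_injective (fun p : PartitionedPerm n => (p.part, p.perm))
    (fun p q h => PartitionedPerm.ext (congrArg Prod.fst h) (congrArg Prod.snd h))

instance (n : ℕ) : Fintype (PartitionedPerm n) := Fintype.ofFinite _

theorem rel_perm_self {n : ℕ} {V : Setoid (Fin n)} {π : Equiv.Perm (Fin n)}
    (h : cyclePartition π ≤ V) (x : Fin n) : V (π x) x :=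
  V.symm' (h (show Equiv.Perm.SameCycle π x (π x) from ⟨1, by simp⟩))

theorem cyclePartition_le {n : ℕ} {V : Setoid (Fin n)} {π : Equiv.Perm (Fin n)}
    (h : ∀ x, V (π x) x) : cyclePartition π ≤ V := by
  have hpow : ∀ (k : ℕ) (x : Fin n), V ((π ^ k) x) x := by
    intro k
    induction k with
    | zero => intro x; exact V.refl' x
    | succ k ih =>
      intro x
      rw [pow_succ', Equiv.Perm.mul_apply]
      exact V.trans' (h _) (ih x)
  intro x y hxy
  obtain ⟨k, hk⟩ := (show Equiv.Perm.SameCycle π x y from hxy).exists_nat_pow_eq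
  rw [← hk]
  exact V.symm' (hpow k x)

namespace PartitionedPerm

variable {n : ℕ}

/-- The length `|(V, π)| = 2 |V| - |π|`. -/
def length (p : PartitionedPerm n) : ℤ :=
  2 * partitionLength p.part - permLength p.perm

/-- The partitioned permutation `(V ∨ W, π σ)`. -/
def join (p q : PartitionedPerm n) : PartitionedPerm n where
  part := p.part ⊔ q.part
  perm := p.perm * q.perm
  cycle_le := cyclePartition_le fun x =>
    (p.part ⊔ q.part).trans'
      ((le_sup_left : p.part ≤ p.part ⊔ q.part) (rel_perm_self p.cycle_le (q.perm x)))
      ((le_sup_right : q.part ≤ p.part ⊔ q.part) (rel_perm_self q.cycle_le x))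

/-- The product of partitioned permutations: `(V ∨ W, π σ)` if the lengths add up, and `0`
otherwise. -/
def product (p q : PartitionedPerm n) : WithZero (PartitionedPerm n) :=
  if p.length + q.length = (p.join q).length then (p.join q : WithZero (PartitionedPerm n)) else 0

/-- The partitioned permutation `(1_n, π)`. -/
def top (π : Equiv.Perm (Fin n)) : PartitionedPerm n where
  part := ⊤
  perm := π
  cycle_le := le_top

/-- The elements of the block `c` of `(V, π)`. -/
abbrev Block (p : PartitionedPerm n) (c : Quotient p.part) : Type :=
  {x : Fin n // Quotient.mk p.part x = c}

/-- The restriction `π|_V` of the permutation to the block `c`. -/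
def restrict (p : PartitionedPerm n) (c : Quotient p.part) : Equiv.Perm (p.Block c) :=
  p.perm.subtypePerm fun x => by
    rw [Quotient.sound (rel_perm_self p.cycle_le x)]

end PartitionedPerm

/-! ### Functions on partitioned permutations -/

/-- Complex functions on the set of all partitioned permutations, `⋃ₙ PS(n)`. -/
abbrev PSFunction : Type := (n : ℕ) → PartitionedPerm n → ℂ

/-- The value `f(1_B, π)` for a permutation `π` of a finite set `B`, obtained by numbering the
elements of `B`. If `f(1_n, π)` depends only on the conjugacy class of `π`, the numbering is
irrelevant. -/
def PSFunction.onSet (f : PSFunction) {B : Type} [Finite B] (π : Equiv.Perm B) : ℂ :=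
  f (Nat.card B) (PartitionedPerm.top ((Finite.equivFin B).permCongr π))

/-- Multiplicative functions: `f(1_n, π)` depends only on the conjugacy class of `π`, and
`f(V, π)` is the product over the blocks `B` of `V` of the values `f(1_B, π|_B)`. -/
structure PSFunction.IsMultiplicative (f : PSFunction) : Prop where
  conj : ∀ (n : ℕ) (π σ : Equiv.Perm (Fin n)), IsConj π σ →
    f n (PartitionedPerm.top π) = f n (PartitionedPerm.top σ)
  prod : ∀ (n : ℕ) (p : PartitionedPerm n),
    f n p = ∏ c : Quotient p.part, f.onSet (p.restrict c)

/-- The convolution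
`(f * g)(U, γ) = ∑ f(V, π) g(W, σ)`, over all `(V, π) · (W, σ) = (U, γ)`. -/
def convolution (f g : PSFunction) : PSFunction := fun n u =>
  ∑ vw : PartitionedPerm n × PartitionedPerm n,
    if vw.1.product vw.2 = (u : WithZero (PartitionedPerm n)) then f n vw.1 * g n vw.2 else 0

/-- The Zeta-function: `1` at `(V, π)` if `V = 0_π`, and `0` otherwise. -/
def zeta : PSFunction := fun _ p => if p.part = cyclePartition p.perm then 1 else 0

/-- `γ_n = (1, 2, …, n)`. -/
def gammaOne (n : ℕ) : Equiv.Perm (Fin n) := finRotate n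

/-- `γ_{m,n} = (1, …, m)(m+1, …, m+n)`. -/
def gammaTwo (m n : ℕ) : Equiv.Perm (Fin (m + n)) :=
  finSumFinEquiv.permCongr (Equiv.Perm.sumCongr (finRotate m) (finRotate n))

/-- The first order values `f(1_n, γ_n)`. -/
def firstOrder (f : PSFunction) (n : ℕ) : ℂ := f n (PartitionedPerm.top (gammaOne n))

/-- The second order values `f(1_{m+n}, γ_{m,n})`. -/
def secondOrder (f : PSFunction) (m n : ℕ) : ℂ :=
  f (m + n) (PartitionedPerm.top (gammaTwo m n))

/-! ### Formal power series -/

/-- Formal power series in the two variables `x = X 0` and `y = X 1`. -/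
abbrev Series₂ : Type := MvPowerSeries (Fin 2) ℂ

/-- `1 + ∑_{n ≥ 1} a_n xⁿ`. -/
def series₁ (a : ℕ → ℂ) : PowerSeries ℂ := PowerSeries.mk fun n => if n = 0 then 1 else a n

/-- `∑_{m, n ≥ 1} a_{m,n} xᵐ yⁿ`. -/
def series₂ (a : ℕ → ℕ → ℂ) : Series₂ :=
  fun d => if 1 ≤ d 0 ∧ 1 ≤ d 1 then a (d 0) (d 1) else 0

instance : IsDomain Series₂ := NoZeroDivisors.to_isDomain _

/-- The series `F(x)` (for `i = 0`) or `F(y)` (for `i = 1`), as a series in two variables. -/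
def inVar (i : Fin 2) (F : PowerSeries ℂ) : Series₂ :=
  F.subst (MvPowerSeries.X i : Series₂)

/-- `x M(x)`. -/
def xM (M : PowerSeries ℂ) : PowerSeries ℂ := PowerSeries.X * M

/-- `F(x M(x), y M(y))`. -/
def substXM (M : PowerSeries ℂ) (F : Series₂) : Series₂ :=
  MvPowerSeries.subst (fun i : Fin 2 => inVar i (xM M)) F

/-- `(d/dx (x M(x)) / M(x)) · (d/dy (y M(y)) / M(y))`. -/
def derivFactor (M : PowerSeries ℂ) : Series₂ :=
  inVar 0 (PowerSeries.derivative ℂ (xM M)) * (inVar 0 M)⁻¹ *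
    (inVar 1 (PowerSeries.derivative ℂ (xM M)) * (inVar 1 M)⁻¹)

/-- The logarithm `∑_{r ≥ 1} (-1)^{r+1} (K - 1)^r / r` of a series `K` with constant
coefficient `1`. -/
def logSeries₂ (K : Series₂) : Series₂ := (PowerSeries.log ℂ).subst (K - 1)

/-- `C(x, y) - x y ∂²/∂x∂y log K(x, y)`. -/
def secondOrderH (C₂ K : Series₂) : Series₂ :=
  C₂ - MvPowerSeries.X 0 * MvPowerSeries.X 1 *
    MvPowerSeries.pderiv ℂ 0 (MvPowerSeries.pderiv ℂ 1 (logSeries₂ K))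

/-- The field of fractions of `ℂ⟦x, y⟧`. -/
def FracSeries₂ : Type := FractionRing Series₂

instance : Field FracSeries₂ := inferInstanceAs (Field (FractionRing Series₂))

instance : Algebra Series₂ FracSeries₂ := inferInstanceAs (Algebra Series₂ (FractionRing Series₂))

instance : IsFractionRing Series₂ FracSeries₂ :=
  inferInstanceAs (IsFractionRing Series₂ (FractionRing Series₂))

/-- The inclusion of `ℂ⟦x, y⟧` in its field of fractions. -/
def toFrac : Series₂ →+* FracSeries₂ := algebraMap Series₂ FracSeries₂

/-- `x y ( (d/dx (x M(x)) · d/dy (y M(y))) / (x M(x) - y M(y))² - 1 / (x - y)² )`,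
in the field of fractions of `ℂ⟦x, y⟧`. -/
def correctionTerm (M : PowerSeries ℂ) : FracSeries₂ :=
  toFrac (MvPowerSeries.X 0 * MvPowerSeries.X 1) *
    (toFrac (inVar 0 (PowerSeries.derivative ℂ (xM M)) *
          inVar 1 (PowerSeries.derivative ℂ (xM M))) /
        toFrac (inVar 0 (xM M) - inVar 1 (xM M)) ^ 2
      - 1 / toFrac (MvPowerSeries.X 0 - MvPowerSeries.X 1) ^ 2)

end SecondOrderRTransform

end

/-!
The convolution with the Zeta-function at `(1, γ)` is a sum over the partitioned permutations
`(V, π)` for which `(V, π) · (0_σ, σ) = (1, γ)` with `σ = π⁻¹ γ`. In the cases below, the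
condition on the lengths amounts to the planarity of `π` with respect to `γ`: every component of
the surface glued from the two permutations is a sphere. The basic tool is the genus inequality
`defect_nonneg`, proved by removing one point at a time. It shows that, for `γ = γ_n`, only
`V = 0_π` and noncrossing partitions occur. For `γ = γ_{m,n}`, either `V = 0_π` and `π` is an
annular noncrossing permutation, or `π` is a pair of noncrossing partitions and `V` joins one
block of each (`factors_join_iff`).

Removing a marked point, the root, gives recursions for the sums over noncrossing partitions
(`discSum_succ`) and over annular noncrossing permutations (`annularSum_succ`). The block of the
root has its own weights `φ`, given by the coefficients of a series `Φ`, since the recursions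
shift these weights. In terms of generating series, the recursion for the noncrossing partitions
has the solution `Φ(x M(x))` (`discSeries_eq_subst`); the choice `Φ = C - 1` gives
`C(x M(x)) = M(x)`, and `Φ = zᵃ` shows that the partitions whose root is in a block of size `a`
are counted by `(x M(x))ᵃ`. The pairs of noncrossing partitions with two joined blocks therefore
produce the term with `C(x M(x), y M(y))` (`series₂_secondOrder_convolution_zeta`).

The recursion for the annular sums is linear and also has an explicit solution
(`annularSeries_solution`), which for `Φ = C - 1` simplifies to
`x y (X' Y' / (X - Y)² - 1 / (x - y)²)` with `X = x M(x)` and `Y = y M(y)`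
(`mul_annularSeries_self`). Both solutions are verified by `eq_zero_of_eq_mul`: the difference of
the two sides reproduces itself under the recursion, and is therefore divisible by all powers of
a series without constant term. Finally, the chain rule for the substitution of `(X, Y)` in
`log ((x C(y) - y C(x)) / (x - y))` identifies this term with the logarithmic term of `H`
(`substXM_log_mul_derivFactor`).
-/

namespace SecondOrderRTransform

open Equiv

section Partitions
open scoped Classical

variable {T X Y : Type*}

/-! ### Cycles, orbits and blocks -/

/-- The partition into the cycles of a permutation of an arbitrary set. -/
noncomputable def cyc (π : Perm T) : Setoid T := Perm.SameCycle.setoid π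

/-- The number of blocks of a partition. -/
noncomputable def nb (s : Setoid T) : ℕ := Nat.card (Quotient s)

theorem cyc_apply_self (π : Perm T) (x : T) : cyc π (π x) x :=
  (cyc π).symm' (show π.SameCycle x (π x) from ⟨1, by simp⟩)

theorem cyc_le [Finite T] {V : Setoid T} {π : Perm T} (h : ∀ x, V (π x) x) : cyc π ≤ V := by
  have hpow : ∀ (k : ℕ) (x : T), V ((π ^ k) x) x := by
    intro k
    induction k with
    | zero => intro x; exact V.refl' x
    | succ k ih =>
      intro x
      rw [pow_succ', Perm.mul_apply]
      exact V.trans' (h _) (ih x)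
  intro x y hxy
  obtain ⟨k, hk⟩ := (show π.SameCycle x y from hxy).exists_nat_pow_eq
  rw [← hk]
  exact V.symm' (hpow k x)

theorem cyc_le_iff [Finite T] {V : Setoid T} {π : Perm T} : cyc π ≤ V ↔ ∀ x, V (π x) x :=
  ⟨fun h x => h (cyc_apply_self π x), cyc_le⟩

/-- The partition into the orbits of the group generated by two permutations. -/
noncomputable def orb (π γ : Perm T) : Setoid T := cyc π ⊔ cyc γ

theorem orb_left (π γ : Perm T) (x : T) : orb π γ (π x) x :=
  (le_sup_left : cyc π ≤ orb π γ) (cyc_apply_self π x)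

theorem orb_right (π γ : Perm T) (x : T) : orb π γ (γ x) x :=
  (le_sup_right : cyc γ ≤ orb π γ) (cyc_apply_self γ x)

theorem orb_le_iff [Finite T] {V : Setoid T} {π γ : Perm T} :
    orb π γ ≤ V ↔ (∀ x, V (π x) x) ∧ ∀ x, V (γ x) x := by
  rw [orb, sup_le_iff, cyc_le_iff, cyc_le_iff]

/-! ### Transport of partitions along bijections -/

theorem comap_equiv_sup (e : X ≃ T) (s t : Setoid T) :
    (s ⊔ t).comap e = s.comap e ⊔ t.comap e := by
  apply le_antisymm
  · have h : s ⊔ t ≤ (s.comap e ⊔ t.comap e).comap e.symm := by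
      refine sup_le ?_ ?_
      · intro x y h
        exact (le_sup_left : s.comap e ≤ _)
          (show s (e (e.symm x)) (e (e.symm y)) by simpa using h)
      · intro x y h
        exact (le_sup_right : t.comap e ≤ _)
          (show t (e (e.symm x)) (e (e.symm y)) by simpa using h)
    intro x y hxy
    have := h (show (s ⊔ t) (e x) (e y) from hxy)
    simpa [Setoid.comap_rel] using this
  · exact sup_le (fun x y h => (le_sup_left : s ≤ s ⊔ t) h)
      (fun x y h => (le_sup_right : t ≤ s ⊔ t) h)

theorem comap_comap_symm (e : X ≃ T) (s : Setoid T) : (s.comap e).comap e.symm = s := by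
  ext x y; simp [Setoid.comap_rel]

theorem comap_top (f : X → T) : (⊤ : Setoid T).comap f = ⊤ := by
  ext x y; exact ⟨fun _ => trivial, fun _ => trivial⟩

/-- The blocks of a partition and of its transport along a bijection. -/
noncomputable def quotientComapEquiv (e : X ≃ T) (s : Setoid T) :
    Quotient (s.comap e) ≃ Quotient s :=
  Quotient.congr e fun _ _ => Iff.rfl

theorem nb_comap_equiv (e : X ≃ T) (s : Setoid T) : nb (s.comap e) = nb s :=
  Nat.card_congr (quotientComapEquiv e s)

theorem cyc_permCongr [Finite X] [Finite T] (e : X ≃ T) (π : Perm X) :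
    cyc (e.permCongr π) = (cyc π).comap e.symm := by
  apply le_antisymm
  · refine cyc_le fun x => ?_
    show cyc π _ _
    simpa using cyc_apply_self π (e.symm x)
  · have : cyc π ≤ (cyc (e.permCongr π)).comap e := by
      refine cyc_le fun x => ?_
      show cyc _ _ _
      simpa using cyc_apply_self (e.permCongr π) (e x)
    intro x y hxy
    simpa [Setoid.comap_rel] using this (show cyc π (e.symm x) (e.symm y) from hxy)

theorem orb_permCongr [Finite X] [Finite T] (e : X ≃ T) (π γ : Perm X) :
    orb (e.permCongr π) (e.permCongr γ) = (orb π γ).comap e.symm := by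
  rw [orb, cyc_permCongr, cyc_permCongr, ← comap_equiv_sup, orb]

/-! ### Products over the blocks of a partition -/

/-- The size of a block. -/
noncomputable def size (s : Setoid T) (c : Quotient s) : ℕ := Nat.card {x // Quotient.mk s x = c}

theorem size_mk (s : Setoid T) (x : T) : size s (Quotient.mk s x) = Nat.card {y // s y x} :=
  Nat.card_congr (Equiv.subtypeEquivRight fun _ => Quotient.eq)

theorem size_comap_equiv (e : X ≃ T) (s : Setoid T) (c : Quotient (s.comap e)) :
    size s (quotientComapEquiv e s c) = size (s.comap e) c := by
  induction c using Quotient.inductionOn with | _ x =>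
  show size s (Quotient.mk s (e x)) = _
  rw [size_mk, size_mk]
  exact (Nat.card_congr (Equiv.subtypeEquiv e fun _ => Iff.rfl)).symm

/-- The product of `κ (size of c)` over the blocks `c` of a partition. -/
noncomputable def blockProd [Fintype T] (κ : ℕ → ℂ) (s : Setoid T) : ℂ :=
  ∏ c : Quotient s, κ (size s c)

/-- The product over the blocks of a partition in which the block of the root `t` has the
weight `φ` of its size, and every other block the weight `κ` of its size. -/
noncomputable def rootedProd [Fintype T] (κ φ : ℕ → ℂ) (t : T) (s : Setoid T) : ℂ :=
  ∏ c : Quotient s, (if c = Quotient.mk s t then φ else κ) (size s c)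

theorem rootedProd_self [Fintype T] (κ : ℕ → ℂ) (t : T) (s : Setoid T) :
    rootedProd κ κ t s = blockProd κ s := by
  simp [rootedProd, blockProd]

theorem rootedProd_comap_equiv [Fintype X] [Fintype T] (κ φ : ℕ → ℂ) (e : X ≃ T) (t : X)
    (s : Setoid T) : rootedProd κ φ t (s.comap e) = rootedProd κ φ (e t) s := by
  refine Fintype.prod_equiv (quotientComapEquiv e s) _ _ fun c => ?_
  rw [size_comap_equiv]
  have : quotientComapEquiv e s c = Quotient.mk s (e t) ↔ c = Quotient.mk _ t := by
    rw [← (quotientComapEquiv e s).injective.eq_iff]; rfl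
  simp only [this]

/-! ### Partitions of a disjoint union -/

/-- The partition of a disjoint union whose blocks are those of the two parts. -/
def sumSetoid (s : Setoid X) (t : Setoid Y) : Setoid (X ⊕ Y) where
  r := Sum.LiftRel s t
  iseqv := by
    refine ⟨?_, ?_, ?_⟩
    · rintro (x | y)
      · exact .inl (s.refl' x)
      · exact .inr (t.refl' y)
    · rintro _ _ (h | h)
      · exact .inl (s.symm' h)
      · exact .inr (t.symm' h)
    · rintro _ _ _ (h | h) (h' | h')
      · exact .inl (s.trans' h h')
      · exact .inr (t.trans' h h')

@[simp] theorem sumSetoid_inl_inl (s : Setoid X) (t : Setoid Y) (x x' : X) :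
    sumSetoid s t (.inl x) (.inl x') ↔ s x x' := Sum.liftRel_inl_inl

@[simp] theorem sumSetoid_inr_inr (s : Setoid X) (t : Setoid Y) (y y' : Y) :
    sumSetoid s t (.inr y) (.inr y') ↔ t y y' := Sum.liftRel_inr_inr

@[simp] theorem sumSetoid_inl_inr (s : Setoid X) (t : Setoid Y) (x : X) (y : Y) :
    ¬ sumSetoid s t (.inl x) (.inr y) := Sum.not_liftRel_inl_inr

@[simp] theorem sumSetoid_inr_inl (s : Setoid X) (t : Setoid Y) (x : X) (y : Y) :
    ¬ sumSetoid s t (.inr y) (.inl x) := Sum.not_liftRel_inr_inl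

theorem sumSetoid_le_iff {s : Setoid X} {t : Setoid Y} {V : Setoid (X ⊕ Y)} :
    sumSetoid s t ≤ V ↔ s ≤ V.comap Sum.inl ∧ t ≤ V.comap Sum.inr := by
  constructor
  · exact fun h => ⟨fun x y hxy => h (Sum.LiftRel.inl hxy), fun x y hxy => h (Sum.LiftRel.inr hxy)⟩
  · rintro ⟨h1, h2⟩ _ _ (h | h)
    · exact h1 h
    · exact h2 h

theorem sumSetoid_inj {s s' : Setoid X} {t t' : Setoid Y} :
    sumSetoid s t = sumSetoid s' t' ↔ s = s' ∧ t = t' := by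
  constructor
  · intro h
    constructor
    · ext x y; rw [← sumSetoid_inl_inl s t, h, sumSetoid_inl_inl]
    · ext x y; rw [← sumSetoid_inr_inr s t, h, sumSetoid_inr_inr]
  · rintro ⟨rfl, rfl⟩; rfl

theorem sumSetoid_mono {s s' : Setoid X} {t t' : Setoid Y} (h : s ≤ s') (h' : t ≤ t') :
    sumSetoid s t ≤ sumSetoid s' t' := by
  rintro _ _ (hh | hh)
  · exact .inl (h hh)
  · exact .inr (h' hh)

theorem sumSetoid_sup (s s' : Setoid X) (t t' : Setoid Y) :
    sumSetoid s t ⊔ sumSetoid s' t' = sumSetoid (s ⊔ s') (t ⊔ t') := by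
  apply le_antisymm
  · exact sup_le (sumSetoid_mono le_sup_left le_sup_left)
      (sumSetoid_mono le_sup_right le_sup_right)
  · rw [sumSetoid_le_iff]
    exact ⟨sup_le (sumSetoid_le_iff.1 le_sup_left).1 (sumSetoid_le_iff.1 le_sup_right).1,
      sup_le (sumSetoid_le_iff.1 le_sup_left).2 (sumSetoid_le_iff.1 le_sup_right).2⟩

theorem cyc_sumCongr [Finite X] [Finite Y] (α : Perm X) (β : Perm Y) :
    cyc (Perm.sumCongr α β) = sumSetoid (cyc α) (cyc β) := by
  apply le_antisymm
  · refine cyc_le ?_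
    rintro (x | y)
    · simpa using cyc_apply_self α x
    · simpa using cyc_apply_self β y
  · rw [sumSetoid_le_iff]
    exact ⟨cyc_le fun x => cyc_apply_self (Perm.sumCongr α β) (.inl x),
      cyc_le fun x => cyc_apply_self (Perm.sumCongr α β) (.inr x)⟩

theorem orb_sumCongr [Finite X] [Finite Y] (α α' : Perm X) (β β' : Perm Y) :
    orb (Perm.sumCongr α β) (Perm.sumCongr α' β') = sumSetoid (orb α α') (orb β β') := by
  rw [orb, cyc_sumCongr, cyc_sumCongr, sumSetoid_sup]; rfl

/-- The blocks of a disjoint union of partitions. -/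
def quotientSumEquiv (s : Setoid X) (t : Setoid Y) :
    Quotient s ⊕ Quotient t ≃ Quotient (sumSetoid s t) where
  toFun := Sum.elim (Quotient.map Sum.inl fun _ _ h => Sum.LiftRel.inl h)
    (Quotient.map Sum.inr fun _ _ h => Sum.LiftRel.inr h)
  invFun := Quotient.lift
    (Sum.elim (fun x => Sum.inl (Quotient.mk s x)) (fun y => Sum.inr (Quotient.mk t y))) (by
      rintro _ _ (h | h)
      · exact congrArg Sum.inl (Quotient.sound h)
      · exact congrArg Sum.inr (Quotient.sound h))
  left_inv := by
    rintro (c | c) <;> induction c using Quotient.inductionOn <;> rfl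
  right_inv := by
    intro c
    induction c using Quotient.inductionOn with | _ x =>
    rcases x with x | x <;> rfl

theorem nb_sumSetoid [Finite X] [Finite Y] (s : Setoid X) (t : Setoid Y) :
    nb (sumSetoid s t) = nb s + nb t := by
  rw [nb, ← Nat.card_congr (quotientSumEquiv s t), Nat.card_sum]; rfl

theorem size_sum_inl (s : Setoid X) (t : Setoid Y) (c : Quotient s) :
    size (sumSetoid s t) (quotientSumEquiv s t (.inl c)) = size s c := by
  induction c using Quotient.inductionOn with | _ x =>
  show size _ (Quotient.mk _ (Sum.inl x)) = _
  rw [size_mk, size_mk]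
  refine (Nat.card_congr (Equiv.ofBijective
    (fun y => ⟨.inl y.1, Sum.LiftRel.inl y.2⟩) ⟨?_, ?_⟩)).symm
  · intro y y' h
    exact Subtype.ext (Sum.inl_injective (congrArg Subtype.val h))
  · rintro ⟨y | y, hy⟩
    · exact ⟨⟨y, (sumSetoid_inl_inl s t _ _).1 hy⟩, rfl⟩
    · exact absurd hy (sumSetoid_inr_inl s t _ _)

theorem size_sum_inr (s : Setoid X) (t : Setoid Y) (c : Quotient t) :
    size (sumSetoid s t) (quotientSumEquiv s t (.inr c)) = size t c := by
  induction c using Quotient.inductionOn with | _ x =>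
  show size _ (Quotient.mk _ (Sum.inr x)) = _
  rw [size_mk, size_mk]
  refine (Nat.card_congr (Equiv.ofBijective
    (fun y => ⟨.inr y.1, Sum.LiftRel.inr y.2⟩) ⟨?_, ?_⟩)).symm
  · intro y y' h
    exact Subtype.ext (Sum.inr_injective (congrArg Subtype.val h))
  · rintro ⟨y | y, hy⟩
    · exact absurd hy (sumSetoid_inl_inr s t _ _)
    · exact ⟨⟨y, (sumSetoid_inr_inr s t _ _).1 hy⟩, rfl⟩

theorem rootedProd_sum [Fintype X] [Fintype Y] (κ φ : ℕ → ℂ) (x : X) (s : Setoid X)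
    (t : Setoid Y) :
    rootedProd κ φ (.inl x) (sumSetoid s t) = rootedProd κ φ x s * blockProd κ t := by
  have h1 : ∀ c : Quotient s, quotientSumEquiv s t (.inl c) = Quotient.mk _ (.inl x) ↔
      c = Quotient.mk s x := fun c => by
    rw [show Quotient.mk (sumSetoid s t) (.inl x) =
      quotientSumEquiv s t (.inl (Quotient.mk s x)) from rfl,
      (quotientSumEquiv s t).injective.eq_iff, Sum.inl.injEq]
  have h2 : ∀ c : Quotient t, quotientSumEquiv s t (.inr c) ≠ Quotient.mk _ (.inl x) := fun c => by
    rw [show Quotient.mk (sumSetoid s t) (.inl x) =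
      quotientSumEquiv s t (.inl (Quotient.mk s x)) from rfl,
      (quotientSumEquiv s t).injective.ne_iff]
    exact Sum.inr_ne_inl
  rw [rootedProd, ← (quotientSumEquiv s t).prod_comp, Fintype.prod_sum_type]
  simp only [h1, h2, size_sum_inl, size_sum_inr, if_false]
  rfl

/-! ### Removing a point -/

section Option

variable (s : Setoid (Option T))

/-- The blocks of a partition of `Option T` in which `none` is a singleton. -/
noncomputable def quotientOptionEquiv (h : ∀ x, ¬ s none (some x)) :
    Option (Quotient (s.comap some)) ≃ Quotient s :=
  Equiv.ofBijective
    (fun o => o.elim (Quotient.mk s none) (Quotient.map some fun _ _ h => h)) (by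
      constructor
      · rintro (_ | c) (_ | d) hcd
        · rfl
        · induction d using Quotient.inductionOn with | _ y =>
          exact absurd (Quotient.exact hcd) (h y)
        · induction c using Quotient.inductionOn with | _ y =>
          exact absurd (Quotient.exact hcd.symm) (h y)
        · induction d using Quotient.inductionOn with | _ y =>
          induction c using Quotient.inductionOn with | _ x =>
          exact congrArg some (Quotient.sound
            (show s (some x) (some y) from Quotient.exact (s := s) hcd))
      · intro c
        induction c using Quotient.inductionOn with | _ x =>
        rcases x with _ | x
        · exact ⟨none, rfl⟩
        · exact ⟨some (Quotient.mk _ x), rfl⟩)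

/-- The blocks of a partition of `Option T` in which `none` is not a singleton. -/
noncomputable def quotientOptionEquiv' {b : T} (h : s none (some b)) :
    Quotient (s.comap some) ≃ Quotient s :=
  Equiv.ofBijective (Quotient.map some fun _ _ h => h) (by
      constructor
      · intro c d hcd
        induction d using Quotient.inductionOn with | _ y =>
        induction c using Quotient.inductionOn with | _ x =>
        exact Quotient.sound
            (show s (some x) (some y) from Quotient.exact (s := s) hcd)
      · intro c
        induction c using Quotient.inductionOn with | _ x =>
        rcases x with _ | x
        · exact ⟨Quotient.mk _ b, Quotient.sound (s.symm' h)⟩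
        · exact ⟨Quotient.mk _ x, rfl⟩)

theorem nb_option_isolated [Finite T] (h : ∀ x, ¬ s none (some x)) :
    nb s = nb (s.comap some) + 1 := by
  rw [nb, ← Nat.card_congr (quotientOptionEquiv s h), Finite.card_option]; rfl

theorem nb_option_attached {b : T} (h : s none (some b)) :
    nb s = nb (s.comap some) :=
  (Nat.card_congr (quotientOptionEquiv' s h)).symm

theorem rootedProd_option_isolated [Fintype T] (κ φ : ℕ → ℂ) (h : ∀ x, ¬ s none (some x)) :
    rootedProd κ φ none s = φ 1 * blockProd κ (s.comap some) := by
  have h0 : size s (Quotient.mk s none) = 1 := by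
    rw [size_mk, Nat.card_eq_one_iff_exists]
    refine ⟨⟨none, s.refl' none⟩, ?_⟩
    rintro ⟨_ | y, hy⟩
    · rfl
    · exact absurd (s.symm' hy) (h y)
  have h1 : ∀ c, quotientOptionEquiv s h (some c) ≠ Quotient.mk s none := fun c => by
    rw [show Quotient.mk s none = quotientOptionEquiv s h none from rfl,
      (quotientOptionEquiv s h).injective.ne_iff]
    exact Option.some_ne_none c
  have h2 : ∀ c, size s (quotientOptionEquiv s h (some c)) = size (s.comap some) c := fun c => by
    induction c using Quotient.inductionOn with | _ x =>
    show size s (Quotient.mk s (some x)) = _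
    rw [size_mk, size_mk]
    refine (Nat.card_congr (Equiv.ofBijective (fun y => ⟨some y.1, y.2⟩) ⟨?_, ?_⟩)).symm
    · intro y y' h
      exact Subtype.ext (Option.some_injective _ (congrArg Subtype.val h))
    · rintro ⟨_ | y, hy⟩
      · exact absurd hy (h x)
      · exact ⟨⟨y, hy⟩, rfl⟩
  rw [rootedProd, ← (quotientOptionEquiv s h).prod_comp, Fintype.prod_option]
  simp only [h1, h2, if_false]
  rw [show quotientOptionEquiv s h none = Quotient.mk s none from rfl, h0, if_pos rfl]
  rfl

/-- Removing the root from its block: `b` becomes the root, and the weight is shifted by one to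
keep counting the removed point. -/
theorem rootedProd_option_attached [Fintype T] (κ φ : ℕ → ℂ) {b : T} (h : s none (some b)) :
    rootedProd κ φ none s = rootedProd κ (fun k => φ (k + 1)) b (s.comap some) := by
  have hb : ∀ c, quotientOptionEquiv' s h c = Quotient.mk s none ↔ c = Quotient.mk _ b :=
    fun c => by
      rw [show Quotient.mk s none = quotientOptionEquiv' s h (Quotient.mk _ b) from
        Quotient.sound h, (quotientOptionEquiv' s h).injective.eq_iff]
  rw [rootedProd, ← (quotientOptionEquiv' s h).prod_comp, rootedProd]
  refine Fintype.prod_congr _ _ fun c => ?_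
  simp only [hb]
  split_ifs with hc
  · subst hc
    show φ (size s (Quotient.mk s (some b))) = _
    congr 1
    rw [size_mk, size_mk, ← Finite.card_option]
    refine (Nat.card_congr (Equiv.ofBijective
      (fun o => o.elim ⟨none, h⟩ fun y => ⟨some y.1, y.2⟩) ⟨?_, ?_⟩)).symm
    · rintro (_ | y) (_ | z) hyz
      · rfl
      · exact absurd (congrArg Subtype.val hyz) (by simp)
      · exact absurd (congrArg Subtype.val hyz) (by simp)
      · exact congrArg some (Subtype.ext (Option.some_injective _ (congrArg Subtype.val hyz)))
    · rintro ⟨_ | y, hy⟩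
      · exact ⟨none, rfl⟩
      · exact ⟨some ⟨y, hy⟩, rfl⟩
  · congr 1
    induction c using Quotient.inductionOn with | _ x =>
    show size s (Quotient.mk s (some x)) = _
    rw [size_mk, size_mk]
    refine (Nat.card_congr (Equiv.ofBijective (fun y => ⟨some y.1, y.2⟩) ⟨?_, ?_⟩)).symm
    · intro y y' h
      exact Subtype.ext (Option.some_injective _ (congrArg Subtype.val h))
    · rintro ⟨_ | y, hy⟩
      · refine absurd (Quotient.sound ?_) hc
        exact s.symm' (s.trans' (s.symm' h) hy)
      · exact ⟨⟨y, hy⟩, rfl⟩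

end Option

end Partitions

section Euler
open scoped Classical

variable {T X Y : Type*}

/-! ### Merging two blocks -/

/-- The partition obtained from `s` by merging the blocks of `x` and `y`. -/
noncomputable def merge (s : Setoid T) (x y : T) : Setoid T :=
  Setoid.ker fun u => if s u y then Quotient.mk s x else Quotient.mk s u

theorem le_merge (s : Setoid T) (x y : T) : s ≤ merge s x y := by
  intro u v huv
  show (if s u y then _ else _) = (if s v y then _ else _)
  have : s u y ↔ s v y := ⟨s.trans' (s.symm' huv), s.trans' huv⟩
  simp only [this]
  split_ifs
  · rfl
  · exact Quotient.sound huv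

theorem merge_rel (s : Setoid T) (x y : T) : merge s x y x y := by
  show (if s x y then _ else _) = (if s y y then _ else _)
  rw [if_pos (s.refl' y)]
  split_ifs <;> rfl

theorem merge_le_iff {s V : Setoid T} {x y : T} : merge s x y ≤ V ↔ s ≤ V ∧ V x y := by
  refine ⟨fun h => ⟨(le_merge s x y).trans h, h (merge_rel s x y)⟩, ?_⟩
  rintro ⟨h, hxy⟩ u v huv
  change (if s u y then Quotient.mk s x else Quotient.mk s u) =
    (if s v y then Quotient.mk s x else Quotient.mk s v) at huv
  split_ifs at huv with h1 h2 h2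
  · exact V.trans' (h h1) (V.symm' (h h2))
  · exact V.trans' (V.trans' (h h1) (V.symm' hxy)) (h (Quotient.exact huv))
  · exact V.trans' (h (Quotient.exact huv)) (V.trans' hxy (V.symm' (h h2)))
  · exact h (Quotient.exact huv)

theorem merge_of_rel {s : Setoid T} {x y : T} (h : s x y) : merge s x y = s :=
  le_antisymm (merge_le_iff.2 ⟨le_rfl, h⟩) (le_merge s x y)

theorem nb_merge [Finite T] {s : Setoid T} {x y : T} (h : ¬ s x y) :
    nb s = nb (merge s x y) + 1 := by
  have hr : Set.range (fun u => if s u y then Quotient.mk s x else Quotient.mk s u) =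
      {Quotient.mk s y}ᶜ := by
    ext c
    constructor
    · rintro ⟨u, rfl⟩
      simp only [Set.mem_compl_iff, Set.mem_singleton_iff]
      split_ifs with hu
      · exact fun hc => h (Quotient.exact hc)
      · exact fun hc => hu (Quotient.exact hc)
    · induction c using Quotient.inductionOn with | _ u =>
      intro hu
      refine ⟨u, if_neg fun hc => hu (Quotient.sound hc)⟩
  have : Nat.card ({Quotient.mk s y}ᶜ : Set (Quotient s)) = nb (merge s x y) := by
    rw [← hr]; exact (Nat.card_congr (Setoid.quotientKerEquivRange _)).symm
  rw [← this, nb, Nat.card_coe_set_eq, Set.ncard_compl, Set.ncard_singleton,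
    Nat.sub_add_cancel]
  exact Finite.card_pos_iff.2 ⟨Quotient.mk s y⟩

/-! ### Multiplication by a transposition -/

/-- Multiplication by `(x y)` changes the cycles of `x` and `y` only. -/
theorem merge_cyc_swap_mul [Finite T] [DecidableEq T] (τ : Perm T) (x y : T) :
    merge (cyc (swap x y * τ)) x y = merge (cyc τ) x y := by
  have key : ∀ ρ : Perm T, merge (cyc (swap x y * ρ)) x y ≤ merge (cyc ρ) x y := by
    intro ρ
    refine merge_le_iff.2 ⟨cyc_le fun u => ?_, merge_rel _ _ _⟩
    have h1 : merge (cyc ρ) x y (ρ u) u := le_merge _ _ _ (cyc_apply_self ρ u)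
    refine (merge (cyc ρ) x y).trans' ?_ h1
    rw [Perm.mul_apply]
    rcases eq_or_ne (ρ u) x with hx | hx
    · rw [hx, swap_apply_left]; exact (merge _ _ _).symm' (merge_rel _ _ _)
    rcases eq_or_ne (ρ u) y with hy | hy
    · rw [hy, swap_apply_right]; exact merge_rel _ _ _
    rw [swap_apply_of_ne_of_ne hx hy]
  refine le_antisymm (key τ) ?_
  conv_lhs => rw [← one_mul τ, ← swap_mul_self x y, mul_assoc]
  exact key _

/-- Multiplication by `(x y)` joins the cycles of `x` and `y` if they are different. -/
theorem cyc_swap_mul_of_not [Finite T] [DecidableEq T] {τ : Perm T} {x y : T} (h : ¬ cyc τ x y) :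
    cyc (swap x y * τ) x y := by
  -- the product agrees with `τ` along the cycle of `x`, until it would return to `x`
  have hper : ∃ k, 0 < k ∧ (τ ^ k) x = x :=
    ⟨orderOf τ, orderOf_pos τ, by rw [pow_orderOf_eq_one]; rfl⟩
  obtain ⟨hk0, hk⟩ := Nat.find_spec hper
  set k := Nat.find hper
  have hne : ∀ i, (τ ^ i) x ≠ y := fun i hi => h ⟨i, by simpa using hi⟩
  have hlt : ∀ i, i < k → ((swap x y * τ) ^ i) x = (τ ^ i) x := by
    intro i
    induction i with
    | zero => intro _; rfl
    | succ i ih =>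
      intro hi
      rw [pow_succ', Perm.mul_apply, ih (by omega), Perm.mul_apply, ← Perm.mul_apply τ, ← pow_succ']
      refine swap_apply_of_ne_of_ne (fun hx => ?_) (hne _)
      exact Nat.find_min hper hi ⟨by omega, hx⟩
  obtain ⟨j, hj⟩ : ∃ j, k = j + 1 := ⟨k - 1, by omega⟩
  refine ⟨k, ?_⟩
  rw [zpow_natCast, hj, pow_succ', Perm.mul_apply, hlt j (by omega), Perm.mul_apply,
    ← Perm.mul_apply τ, ← pow_succ', ← hj, hk, swap_apply_left]

/-- Multiplication by `(x y)` splits a cycle that contains both points. -/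
theorem not_cyc_swap_mul [Finite T] [DecidableEq T] {τ : Perm T} {x y : T} (hxy : x ≠ y)
    (h : cyc τ x y) :
    ¬ cyc (swap x y * τ) x y := by
  -- the arc from `x` to the point before `y` is closed under the product
  have hex : ∃ k, (τ ^ k) x = y := (show τ.SameCycle x y from h).exists_nat_pow_eq
  have hk := Nat.find_spec hex
  set k := Nat.find hex
  have hmin : ∀ i < k, (τ ^ i) x ≠ y := fun i hi => Nat.find_min hex hi
  have hret : ∀ i, 0 < i → i < k → (τ ^ i) x ≠ x := by
    intro i hi hik hx
    refine hmin (k - i) (by omega) ?_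
    rw [← hk]
    conv_lhs => rw [← hx]
    rw [← Perm.mul_apply, ← pow_add, Nat.sub_add_cancel hik.le]
  have hcl : ∀ n : ℕ, ∃ i < k, ((swap x y * τ) ^ n) x = (τ ^ i) x := by
    intro n
    have hk0 : 0 < k := Nat.pos_of_ne_zero fun h0 => hxy (by rw [h0] at hk; exact hk)
    induction n with
    | zero => exact ⟨0, hk0, rfl⟩
    | succ n ih =>
      obtain ⟨i, hi, hin⟩ := ih
      rw [pow_succ', Perm.mul_apply, hin, Perm.mul_apply, ← Perm.mul_apply τ, ← pow_succ']
      rcases Nat.lt_or_ge (i + 1) k with h1 | h1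
      · exact ⟨i + 1, h1, swap_apply_of_ne_of_ne (hret _ (by omega) h1) (hmin _ h1)⟩
      · refine ⟨0, hk0, ?_⟩
        rw [show i + 1 = k by omega, hk, swap_apply_right]; rfl
  intro hc
  obtain ⟨n, hn⟩ := (show (swap x y * τ).SameCycle x y from hc).exists_nat_pow_eq
  obtain ⟨i, hi, hin⟩ := hcl n
  exact hmin i hi (hin ▸ hn)

theorem nb_cyc_swap_mul_of_not [Finite T] [DecidableEq T] {τ : Perm T} {x y : T} (h : ¬ cyc τ x y) :
    nb (cyc τ) = nb (cyc (swap x y * τ)) + 1 := by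
  rw [nb_merge h, ← merge_cyc_swap_mul, merge_of_rel (cyc_swap_mul_of_not h)]

theorem nb_cyc_swap_mul_of_rel [Finite T] [DecidableEq T] {τ : Perm T} {x y : T} (hxy : x ≠ y)
    (h : cyc τ x y) :
    nb (cyc (swap x y * τ)) = nb (cyc τ) + 1 := by
  rw [nb_merge (not_cyc_swap_mul hxy h), merge_cyc_swap_mul, merge_of_rel h]

/-! ### Removing a point from a permutation -/

/-- `removeNone` deletes `none` from its cycle, and changes no other cycle. -/
theorem comap_cyc_option [Finite T] (ρ : Perm (Option T)) :
    (cyc ρ).comap some = cyc (removeNone ρ) := by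
  apply le_antisymm
  · intro x y hxy
    have key : cyc ρ ≤ (cyc (removeNone ρ)).comap fun o => o.getD ((ρ none).getD x) := by
      refine cyc_le ?_
      rintro (_ | z)
      · show cyc _ ((ρ none).getD _) ((none : Option T).getD _)
        rcases h : ρ none with _ | w <;> exact (cyc _).refl' _
      · show cyc _ ((ρ (some z)).getD _) z
        rcases h : ρ (some z) with _ | w
        · have := removeNone_none ρ h
          rw [← this]
          exact cyc_apply_self _ z
        · have := removeNone_some ρ ⟨w, h⟩
          rw [h, Option.some_inj] at this
          exact this ▸ cyc_apply_self _ z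
    exact key hxy
  · refine cyc_le fun x => ?_
    show cyc ρ _ _
    rcases h : ρ (some x) with _ | w
    · rw [removeNone_none ρ h]
      exact (cyc ρ).trans' (cyc_apply_self ρ none) (h ▸ cyc_apply_self ρ (some x))
    · rw [removeNone_some ρ ⟨w, h⟩]
      exact cyc_apply_self ρ _

theorem cyc_option_rel [Finite T] (ρ : Perm (Option T)) (x y : T) :
    cyc ρ (some x) (some y) ↔ cyc (removeNone ρ) x y := by
  rw [← comap_cyc_option]; rfl

theorem apply_none_ne_some [Finite T] {V : Setoid (Option T)} (ρ : Perm (Option T))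
    (h : ρ none = none) (hV : V ≤ cyc ρ) (x : T) : ¬ V none (some x) := by
  intro hx
  obtain ⟨k, hk⟩ := (show ρ.SameCycle none (some x) from hV hx).exists_nat_pow_eq
  rw [Perm.pow_apply_eq_self_of_apply_eq_self h] at hk
  exact absurd hk (by simp)

theorem nb_cyc_option [Finite T] (ρ : Perm (Option T)) :
    nb (cyc ρ) = nb (cyc (removeNone ρ)) + if ρ none = none then 1 else 0 := by
  rw [← comap_cyc_option]
  split_ifs with h
  · exact nb_option_isolated _ (apply_none_ne_some ρ h le_rfl)
  · obtain ⟨b, hb⟩ := Option.ne_none_iff_exists'.1 h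
    exact nb_option_attached _ (b := b) ((cyc ρ).symm' (hb ▸ cyc_apply_self ρ none))

/-- Deletion of `none` commutes with multiplication by a permutation that fixes `none`. -/
theorem removeNone_optionCongr_mul (α : Perm T) (τ : Perm (Option T)) :
    removeNone (optionCongr α * τ) = α * removeNone τ := by
  ext x
  apply Option.some_injective
  rcases h : τ (some x) with _ | w
  · rw [removeNone_none _ (by simp [h]), Perm.mul_apply, Perm.mul_apply, optionCongr_apply,
      ← removeNone_none τ h]
    rfl
  · rw [removeNone_some _ ⟨α w, by simp [h]⟩, Perm.mul_apply, Perm.mul_apply, optionCongr_apply,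
      ← removeNone_some τ ⟨w, h⟩]
    rfl

theorem removeNone_swap_mul_optionCongr [DecidableEq T] (a : Option T) (α : Perm T) :
    removeNone (swap none a * optionCongr α) = α :=
  congrArg Prod.snd (Perm.decomposeOption.right_inv (a, α))

/-- If `π = (none a) α` and `γ = (none a) τ`, then the transposition drops out of `π⁻¹ γ`. -/
theorem inv_mul_of_swap [DecidableEq T] (a : Option T) (α : Perm T) (τ : Perm (Option T)) :
    (swap none a * optionCongr α)⁻¹ * (swap none a * τ) = optionCongr α⁻¹ * τ := by
  rw [mul_inv_rev, mul_assoc, inv_mul_cancel_left]; rfl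

theorem nb_cyc_optionCongr_mul [Finite T] (α : Perm T) (τ : Perm (Option T)) :
    nb (cyc (optionCongr α * τ)) =
      nb (cyc (α * removeNone τ)) + if τ none = none then 1 else 0 := by
  rw [nb_cyc_option, removeNone_optionCongr_mul]
  simp

/-- Orbits after removing a fixed point of the first permutation. -/
theorem comap_orb_none [Finite T] (α : Perm T) (γ : Perm (Option T)) :
    (orb (optionCongr α) γ).comap some = orb α (removeNone γ) := by
  apply le_antisymm
  · intro x y hxy
    have key : orb (optionCongr α) γ ≤
        (orb α (removeNone γ)).comap fun o => o.getD ((γ none).getD x) := by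
      refine orb_le_iff.2 ⟨?_, ?_⟩
      · rintro (_ | z)
        · exact Setoid.refl' _ _
        · exact orb_left α _ z
      · rintro (_ | z)
        · show orb α _ ((γ none).getD _) ((none : Option T).getD _)
          rcases h : γ none with _ | w <;> exact (orb _ _).refl' _
        · show orb α _ ((γ (some z)).getD _) z
          rcases h : γ (some z) with _ | w
          · rw [← removeNone_none γ h]
            exact orb_right α _ z
          · have := removeNone_some γ ⟨w, h⟩
            rw [h, Option.some_inj] at this
            exact this ▸ orb_right α _ z
    exact key hxy
  · refine sup_le (cyc_le fun x => orb_left (optionCongr α) γ (some x)) ?_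
    rw [← comap_cyc_option]
    exact fun x y h => (le_sup_right : cyc γ ≤ orb (optionCongr α) γ) h

/-- Orbits of `π = (none b) α` and `γ = (none b) τ` after removing `none`: the only trace of `none`
is that `b` stays in one orbit with the image of `none` under `τ`. -/
theorem comap_orb_some [Finite T] [DecidableEq T] (b : T) (α : Perm T) (τ : Perm (Option T)) :
    (orb (swap none (some b) * optionCongr α) (swap none (some b) * τ)).comap some =
      merge (orb α (removeNone τ)) b ((τ none).getD b) := by
  set V := orb (swap none (some b) * optionCongr α) (swap none (some b) * τ)
  have hnb : V none (some b) := by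
    have := orb_left (swap none (some b) * optionCongr α) (swap none (some b) * τ) none
    exact V.symm' (by simpa using this)
  -- the transposition `(none b)` can be ignored, as it preserves the blocks of `V`
  have hswap : ∀ o, V (swap none (some b) o) o := by
    intro o
    rcases eq_or_ne o none with rfl | h1
    · rw [swap_apply_left]; exact V.symm' hnb
    rcases eq_or_ne o (some b) with rfl | h2
    · rw [swap_apply_right]; exact hnb
    rw [swap_apply_of_ne_of_ne h1 h2]
  have hα : ∀ o, V (optionCongr α o) o := fun o =>
    V.trans' (V.symm' (hswap _)) (orb_left _ _ o)
  have hτ : cyc τ ≤ V := cyc_le fun o => V.trans' (V.symm' (hswap _)) (orb_right _ _ o)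
  apply le_antisymm
  · set W := merge (orb α (removeNone τ)) b ((τ none).getD b)
    have hW : orb α (removeNone τ) ≤ W := le_merge _ _ _
    have hsw : ∀ o, W.comap (fun o => o.getD b) (swap none (some b) o) o := by
      intro o
      rcases eq_or_ne o none with rfl | h1
      · rw [swap_apply_left]; exact W.refl' _
      rcases eq_or_ne o (some b) with rfl | h2
      · rw [swap_apply_right]; exact W.refl' _
      rw [swap_apply_of_ne_of_ne h1 h2]
    have key : V ≤ W.comap fun o => o.getD b := by
      refine orb_le_iff.2 ⟨fun o => (W.comap _).trans' (hsw _) ?_,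
        fun o => (W.comap _).trans' (hsw _) ?_⟩
      · rcases o with _ | z
        · exact W.refl' _
        · exact hW (orb_left α _ z)
      · rcases o with _ | z
        · exact W.symm' (merge_rel _ _ _)
        · show W ((τ (some z)).getD b) z
          rcases h : τ (some z) with _ | w
          · have h2 := merge_rel (orb α (removeNone τ)) b ((τ none).getD b)
            refine W.trans' h2 ?_
            rw [← removeNone_none τ h]
            exact hW (orb_right α _ z)
          · have := removeNone_some τ ⟨w, h⟩
            rw [h, Option.some_inj] at this
            exact this ▸ hW (orb_right α _ z)
    exact fun x y hxy => key hxy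
  · refine merge_le_iff.2 ⟨sup_le (cyc_le fun x => hα (some x)) ?_, ?_⟩
    · rw [← comap_cyc_option]
      exact fun x y h => hτ h
    · show V (some b) (some _)
      rcases h : τ none with _ | w
      · exact V.refl' _
      · refine V.trans' (V.symm' hnb) (V.symm' ?_)
        exact hτ (h ▸ cyc_apply_self τ none)

theorem orb_some_rel [DecidableEq T] (b : T) (α : Perm T) (γ : Perm (Option T)) :
    orb (swap none (some b) * optionCongr α) γ none (some b) := by
  have := orb_left (swap none (some b) * optionCongr α) γ none
  exact Setoid.symm' _ (by simpa using this)

theorem eq_top_iff_comap_some {s : Setoid (Option T)} {b : T} (h : s none (some b)) :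
    s = ⊤ ↔ s.comap some = ⊤ := by
  constructor
  · rintro rfl; exact comap_top _
  · intro hs
    have hb : ∀ o, s o (some b) := by
      rintro (_ | x)
      · exact h
      · exact (show s.comap some x b by rw [hs]; trivial)
    exact top_le_iff.1 fun x y _ => s.trans' (hb x) (s.symm' (hb y))

/-! ### The genus inequality -/

/-- The permutation `π` is planar with respect to `γ`: the surface glued from the cycles of `π`,
`π⁻¹ γ` and `γ` is a union of spheres, one for each orbit of the group generated by `π` and `γ`. -/
def IsPlanar (γ π : Perm T) : Prop :=
  nb (cyc π) + nb (cyc (π⁻¹ * γ)) + nb (cyc γ) = Nat.card T + 2 * nb (orb π γ)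

/-- The defect `(number of points + 2 (number of orbits)) - (numbers of cycles)`, which is twice
the genus of the surface glued from `π` and `γ`. -/
noncomputable def defect (γ π : Perm T) : ℤ :=
  Nat.card T + 2 * nb (orb π γ) - (nb (cyc π) + nb (cyc (π⁻¹ * γ)) + nb (cyc γ))

theorem isPlanar_iff_defect (γ π : Perm T) : IsPlanar γ π ↔ defect γ π = 0 := by
  rw [IsPlanar, defect]; omega

theorem orb_option_isolated [Finite T] (α : Perm T) {γ : Perm (Option T)} (h : γ none = none)
    (x : T) : ¬ orb (optionCongr α) γ none (some x) := by
  intro hx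
  have : orb (optionCongr α) γ ≤ Setoid.ker Option.isNone := by
    refine orb_le_iff.2 ⟨?_, ?_⟩
    · rintro (_ | z) <;> rfl
    · rintro (_ | z)
      · show (γ none).isNone = true; rw [h]; rfl
      · show (γ (some z)).isNone = false
        rcases hz : γ (some z) with _ | w
        · exact absurd (γ.injective (hz.trans h.symm)) (by simp)
        · rfl
  exact absurd (this hx) (by simp)

/-- The genus does not change when a fixed point of `π` is removed. -/
theorem defect_optionCongr [Finite T] (α : Perm T) (γ : Perm (Option T)) :
    defect γ (optionCongr α) = defect (removeNone γ) α := by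
  have h1 : nb (cyc (optionCongr α)) = nb (cyc α) + 1 := by
    rw [nb_cyc_option, removeNone_optionCongr]; simp
  have h2 := nb_cyc_optionCongr_mul α⁻¹ γ
  have h3 := nb_cyc_option γ
  have h4 : nb (orb (optionCongr α) γ) =
      nb (orb α (removeNone γ)) + if γ none = none then 1 else 0 := by
    rw [← comap_orb_none]
    split_ifs with h
    · exact nb_option_isolated _ (orb_option_isolated α h)
    · obtain ⟨b, hb⟩ := Option.ne_none_iff_exists'.1 h
      exact nb_option_attached _ (b := b) (Setoid.symm' _ (hb ▸ orb_right _ γ none))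
  have h5 : ((optionCongr α)⁻¹ : Perm (Option T)) = optionCongr α⁻¹ := rfl
  rw [defect, defect, h5, h1, h2, h3, h4, Finite.card_option]
  split_ifs <;> push_cast <;> ring

theorem removeNone_rel_of_not [Finite T] [DecidableEq T] {b : T} {τ : Perm (Option T)}
    (h : ¬ cyc (swap none (some b) * τ) none (some b)) :
    cyc (removeNone τ) b ((τ none).getD b) := by
  rw [← cyc_option_rel]
  have h1 : cyc τ none (some b) := by
    have := cyc_swap_mul_of_not h
    rwa [← mul_assoc, swap_mul_self, one_mul] at this
  rcases h2 : τ none with _ | w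
  · exact (cyc τ).refl' _
  · exact (cyc τ).symm' ((cyc τ).trans' (h2 ▸ cyc_apply_self τ none) h1)

/-- If `π` maps `none` to `b` in another cycle of `γ = (none b) τ`, then removing `none` and joining
the two cycles of `γ` does not change the genus. -/
theorem defect_swap_mul_of_not [Finite T] [DecidableEq T] {b : T} {τ : Perm (Option T)} (α : Perm T)
    (h : ¬ cyc (swap none (some b) * τ) none (some b)) :
    defect (swap none (some b) * τ) (swap none (some b) * optionCongr α) =
      defect (removeNone τ) α := by
  have h0 : τ none ≠ none := fun h0 => h <| Setoid.symm' _ (by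
    have := cyc_apply_self (swap none (some b) * τ) none
    rwa [Perm.mul_apply, h0, swap_apply_left] at this)
  have h1 : nb (cyc (swap none (some b) * optionCongr α)) = nb (cyc α) := by
    rw [nb_cyc_option, removeNone_swap_mul_optionCongr]; simp
  have h2 := nb_cyc_optionCongr_mul α⁻¹ τ
  have h3 := nb_cyc_option τ
  rw [if_neg h0] at h2 h3
  have h4 := nb_cyc_swap_mul_of_not h
  rw [← mul_assoc, swap_mul_self, one_mul] at h4
  have h5 : nb (orb (swap none (some b) * optionCongr α) (swap none (some b) * τ)) =
      nb (orb α (removeNone τ)) := by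
    rw [nb_option_attached _ (orb_some_rel b α _), comap_orb_some,
      merge_of_rel (s := orb α (removeNone τ))
        ((le_sup_right : cyc (removeNone τ) ≤ orb α _) (removeNone_rel_of_not h))]
  rw [defect, defect, inv_mul_of_swap, h1, h2, h4, h3, h5, Finite.card_option]
  push_cast; ring

/-- If `π` maps `none` to `b` in the same cycle of `γ = (none b) τ`, then removing `none` splits
this cycle of `γ` at `b`. The genus drops by one if both parts are non-empty and remain in one
orbit. -/
theorem defect_swap_mul_of_rel [Finite T] [DecidableEq T] {b : T} {τ : Perm (Option T)} (α : Perm T)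
    (h : cyc (swap none (some b) * τ) none (some b)) :
    defect (swap none (some b) * τ) (swap none (some b) * optionCongr α) =
      defect (removeNone τ) α +
        if τ none ≠ none ∧ orb α (removeNone τ) b ((τ none).getD b) then 2 else 0 := by
  have h1 : nb (cyc (swap none (some b) * optionCongr α)) = nb (cyc α) := by
    rw [nb_cyc_option, removeNone_swap_mul_optionCongr]; simp
  have h2 := nb_cyc_optionCongr_mul α⁻¹ τ
  have h3 := nb_cyc_option τ
  have h4 := nb_cyc_swap_mul_of_rel (by simp) h
  rw [← mul_assoc, swap_mul_self, one_mul] at h4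
  have h5 : nb (orb (swap none (some b) * optionCongr α) (swap none (some b) * τ)) =
      nb (merge (orb α (removeNone τ)) b ((τ none).getD b)) := by
    rw [nb_option_attached _ (orb_some_rel b α _), comap_orb_some]
  rw [defect, defect, inv_mul_of_swap, h1, h2, h5, Finite.card_option]
  rcases h6 : τ none with _ | w
  · rw [h6, if_pos rfl] at h3
    rw [Option.getD_none, merge_of_rel (Setoid.refl' _ _)]
    simp only [if_true, ne_eq, not_true_eq_false, false_and, if_false]
    omega
  · rw [h6, if_neg (by simp)] at h3
    simp only [Option.getD_some, reduceCtorEq, if_false, ne_eq, not_false_eq_true, true_and]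
    split_ifs with h7
    · rw [merge_of_rel h7]; omega
    · have := nb_merge h7
      omega

theorem nb_cyc_permCongr [Finite X] [Finite T] (e : X ≃ T) (π : Perm X) :
    nb (cyc (e.permCongr π)) = nb (cyc π) := by
  rw [cyc_permCongr, nb_comap_equiv]

theorem defect_permCongr [Finite X] [Finite T] (e : X ≃ T) (γ π : Perm X) :
    defect (e.permCongr γ) (e.permCongr π) = defect γ π := by
  have h : (e.permCongr π)⁻¹ * e.permCongr γ = e.permCongr (π⁻¹ * γ) := by
    rw [show (e.permCongr π)⁻¹ = e.permCongr π⁻¹ from rfl]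
    ext x; simp [Perm.mul_apply]
  rw [defect, defect, orb_permCongr, h, nb_comap_equiv, nb_cyc_permCongr, nb_cyc_permCongr,
    nb_cyc_permCongr, Nat.card_congr e]

/-- The genus is not negative: removing a point changes the defect by `0` or `-2`. -/
theorem defect_nonneg : ∀ (T : Type) [Fintype T] (γ π : Perm T), 0 ≤ defect γ π := by
  intro T _
  refine Fintype.induction_empty_option (P := fun T _ => ∀ γ π : Perm T, 0 ≤ defect γ π)
    ?_ ?_ ?_ T
  · intro X T _ e h γ π
    have := Fintype.ofEquiv T e.symm
    rw [← defect_permCongr e.symm]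
    exact h _ _
  · intro γ π
    have h : ∀ s : Setoid PEmpty.{1}, nb s = 0 := fun s => Nat.card_of_isEmpty
    simp [defect, h]
  · intro T _ ih γ π
    obtain ⟨⟨a, α⟩, rfl⟩ := Perm.decomposeOption.symm.surjective π
    rw [Perm.decomposeOption_symm_apply]
    rcases a with _ | b
    · rw [show swap none none = (1 : Perm (Option T)) from swap_self _, one_mul,
        defect_optionCongr]
      exact ih _ _
    · obtain ⟨τ, rfl⟩ : ∃ τ, γ = swap none (some b) * τ :=
        ⟨swap none (some b) * γ, by rw [← mul_assoc, swap_mul_self, one_mul]⟩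
      by_cases h : cyc (swap none (some b) * τ) none (some b)
      · rw [defect_swap_mul_of_rel α h]
        have := ih (removeNone τ) α
        split_ifs <;> omega
      · rw [defect_swap_mul_of_not α h]
        exact ih _ _

end Euler

section PlanarSums
open scoped Classical

variable {T X Y : Type} [Fintype T] [Fintype X] [Fintype Y]

/-! ### Sums over planar permutations -/

/-- The sum of `W (cycles of π)` over the permutations `π` that are planar with respect to `γ` and
generate together with `γ` a group with the orbits `U`. -/
noncomputable def planarSumOn (U : Setoid T) (γ : Perm T) (W : Setoid T → ℂ) : ℂ :=
  ∑ π : Perm T, if orb π γ = U ∧ IsPlanar γ π then W (cyc π) else 0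

/-- The sum of `W (cycles of π)` over the permutations `π` that are planar with respect to `γ` and
generate together with `γ` a transitive group. -/
noncomputable def planarSum (γ : Perm T) (W : Setoid T → ℂ) : ℂ := planarSumOn ⊤ γ W

/-- The value of `planarSumOn` does not depend on the chosen enumeration of the permutations. -/
theorem planarSumOn_eq [Fintype (Perm T)] (U : Setoid T) (γ : Perm T) (W : Setoid T → ℂ) :
    planarSumOn U γ W = ∑ π : Perm T, if orb π γ = U ∧ IsPlanar γ π then W (cyc π) else 0 := by
  rw [planarSumOn]
  congr!

theorem planarSumOn_permCongr (e : X ≃ T) (U : Setoid X) (γ : Perm X) (W : Setoid T → ℂ) :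
    planarSumOn (U.comap e.symm) (e.permCongr γ) W =
      planarSumOn U γ fun s => W (s.comap e.symm) := by
  refine (Fintype.sum_equiv e.permCongr _ _ fun π => ?_).symm
  have h1 : ∀ s t : Setoid X, s.comap e.symm = t.comap e.symm ↔ s = t := fun s t =>
    ⟨fun h => by rw [← comap_comap_symm e.symm s, h, comap_comap_symm], fun h => by rw [h]⟩
  simp only [isPlanar_iff_defect, defect_permCongr, orb_permCongr, cyc_permCongr, h1]

theorem planarSum_permCongr (e : X ≃ T) (γ : Perm X) (W : Setoid T → ℂ) :
    planarSum (e.permCongr γ) W = planarSum γ fun s => W (s.comap e.symm) := by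
  rw [planarSum, planarSum, ← planarSumOn_permCongr, comap_top]

theorem planarSum_permCongr_rooted (κ φ : ℕ → ℂ) (e : X ≃ T) (γ : Perm X) (x : X) :
    planarSum (e.permCongr γ) (rootedProd κ φ (e x)) = planarSum γ (rootedProd κ φ x) := by
  rw [planarSum_permCongr]
  simp [rootedProd_comap_equiv]

theorem planarSum_rooted_self (κ : ℕ → ℂ) (γ : Perm T) (t : T) :
    planarSum γ (rootedProd κ κ t) = planarSum γ (blockProd κ) := by
  simp [planarSum, planarSumOn, rootedProd_self]

theorem defect_sumCongr (γ π : Perm X) (γ' π' : Perm Y) :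
    defect (Perm.sumCongr γ γ') (Perm.sumCongr π π') = defect γ π + defect γ' π' := by
  have h : (Perm.sumCongr π π')⁻¹ * Perm.sumCongr γ γ' =
      Perm.sumCongr (π⁻¹ * γ) (π'⁻¹ * γ') := by
    rw [Perm.sumCongr_inv, Perm.sumCongr_mul]
  simp only [defect, h, orb_sumCongr, cyc_sumCongr, nb_sumSetoid, Nat.card_sum]
  push_cast
  ring

theorem exists_sumCongr_of_cyc_le {π : Perm (X ⊕ Y)} (h : cyc π ≤ sumSetoid ⊤ ⊤) :
    ∃ α β, Perm.sumCongr α β = π := by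
  obtain ⟨⟨α, β⟩, h⟩ := Perm.mem_sumCongrHom_range_of_perm_mapsTo_inl (σ := π) (by
    rintro _ ⟨x, rfl⟩
    have := h (cyc_apply_self π (.inl x))
    rcases hx : π (.inl x) with z | z
    · exact ⟨z, rfl⟩
    · rw [hx] at this; exact absurd this (sumSetoid_inr_inl _ _ _ _))
  exact ⟨α, β, h⟩

/-- Planarity is checked on each orbit, since the genus of each component is not negative. -/
theorem planarSumOn_sum (γ : Perm X) (γ' : Perm Y) (W : Setoid (X ⊕ Y) → ℂ)
    (W₁ : Setoid X → ℂ) (W₂ : Setoid Y → ℂ) (hW : ∀ s t, W (sumSetoid s t) = W₁ s * W₂ t) :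
    planarSumOn (sumSetoid ⊤ ⊤) (Perm.sumCongr γ γ') W = planarSum γ W₁ * planarSum γ' W₂ := by
  rw [planarSum, planarSum, planarSumOn_eq, planarSumOn, planarSumOn, Fintype.sum_mul_sum,
    ← Fintype.sum_prod_type' (f := fun (π : Perm X) (π' : Perm Y) => _ * _)]
  symm
  refine Fintype.sum_of_injective (fun p : Perm X × Perm Y => Perm.sumCongr p.1 p.2)
    (fun p q h => Perm.sumCongrHom_injective h) _ _ ?_ ?_
  · intro π hπ
    rw [if_neg]
    rintro ⟨h, -⟩
    obtain ⟨α, β, rfl⟩ := exists_sumCongr_of_cyc_le ((le_sup_left : cyc π ≤ orb π _).trans h.le)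
    exact hπ ⟨(α, β), rfl⟩
  · rintro ⟨α, β⟩
    have h1 := defect_nonneg X γ α
    have h2 := defect_nonneg Y γ' β
    simp only [orb_sumCongr, sumSetoid_inj, cyc_sumCongr, hW, isPlanar_iff_defect,
      defect_sumCongr, ite_mul, mul_ite, zero_mul, mul_zero, ← ite_and]
    congr 1
    apply propext
    constructor
    · rintro ⟨⟨h3, h4⟩, h5, h6⟩; exact ⟨⟨h5, h3⟩, by omega⟩
    · rintro ⟨⟨h3, h4⟩, h5⟩; exact ⟨⟨h4, by omega⟩, h3, by omega⟩

/-! ### Removing the root -/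

/-- The part of a planar sum in which the root `none` is mapped to `b`: the point `none` is removed
from its cycle, and `b` becomes the root. -/
noncomputable def branch [DecidableEq T] (κ ψ : ℕ → ℂ) (γ : Perm (Option T)) (b : T) : ℂ :=
  ∑ α : Perm T, if orb (swap none (some b) * optionCongr α) γ = ⊤ ∧
    IsPlanar γ (swap none (some b) * optionCongr α) then rootedProd κ ψ b (cyc α) else 0

/-- A planar sum according to the image of the root `none` under `π`: the root is fixed, or is
mapped to one of the other points `b`. Permutations of `Option T` are written as `(none a) α`. -/
theorem planarSum_option [DecidableEq T] (κ φ : ℕ → ℂ) (γ : Perm (Option T)) :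
    planarSum γ (rootedProd κ φ none) =
      φ 1 * (∑ α : Perm T, if orb (optionCongr α) γ = ⊤ ∧ IsPlanar (removeNone γ) α then
        blockProd κ (cyc α) else 0) + ∑ b, branch κ (fun k => φ (k + 1)) γ b := by
  rw [planarSum, planarSumOn_eq, ← Perm.decomposeOption.symm.sum_comp, Fintype.sum_prod_type,
    Fintype.sum_option, Finset.mul_sum]
  simp only [Perm.decomposeOption_symm_apply]
  congr 1
  · refine Fintype.sum_congr _ _ fun α => ?_
    rw [show swap none none = (1 : Perm (Option T)) from swap_self _, one_mul,
      isPlanar_iff_defect, defect_optionCongr, ← isPlanar_iff_defect, mul_ite, mul_zero,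
      rootedProd_option_isolated _ _ _ (apply_none_ne_some _ (by rfl) le_rfl),
      comap_cyc_option, removeNone_optionCongr]
  · refine Fintype.sum_congr _ _ fun b => Fintype.sum_congr _ _ fun α => ?_
    have h : cyc (swap none (some b) * optionCongr α) none (some b) := by
      refine Setoid.symm' _ ?_
      simpa using cyc_apply_self (swap none (some b) * optionCongr α) none
    rw [rootedProd_option_attached _ κ φ h, comap_cyc_option, removeNone_swap_mul_optionCongr]

/-- If `b` is not in the `γ`-cycle of the root, then these cycles are joined. -/
theorem branch_join [DecidableEq T] (κ ψ : ℕ → ℂ) (γ : Perm (Option T)) (b : T)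
    (h : ¬ cyc γ none (some b) ∨ γ none = some b) :
    branch κ ψ γ b = planarSum (removeNone (swap none (some b) * γ)) (rootedProd κ ψ b) := by
  obtain ⟨τ, rfl⟩ : ∃ τ, γ = swap none (some b) * τ :=
    ⟨swap none (some b) * γ, by rw [← mul_assoc, swap_mul_self, one_mul]⟩
  rw [← mul_assoc, swap_mul_self, one_mul, planarSum, planarSumOn_eq]
  refine Fintype.sum_congr _ _ fun α => ?_
  have h1 : merge (orb α (removeNone τ)) b ((τ none).getD b) = orb α (removeNone τ) ∧
      defect (swap none (some b) * τ) (swap none (some b) * optionCongr α) =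
        defect (removeNone τ) α := by
    rcases h with h | h
    · exact ⟨merge_of_rel ((le_sup_right : cyc (removeNone τ) ≤ orb α (removeNone τ))
        (removeNone_rel_of_not h)), defect_swap_mul_of_not α h⟩
    · have h0 : τ none = none := by
        rw [Perm.mul_apply, swap_apply_eq_iff, swap_apply_right] at h; exact h
      have hc : cyc (swap none (some b) * τ) none (some b) := Setoid.symm' _ (by
        have := cyc_apply_self (swap none (some b) * τ) none
        rwa [h] at this)
      refine ⟨by rw [h0]; exact merge_of_rel (Setoid.refl' _ _), ?_⟩
      rw [defect_swap_mul_of_rel α hc, if_neg (by simp [h0]), add_zero]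
  rw [isPlanar_iff_defect, h1.2, ← isPlanar_iff_defect,
    eq_top_iff_comap_some (orb_some_rel b α _), comap_orb_some, h1.1]

/-- If `b` is in the `γ`-cycle of the root, but is not its image, then this cycle is split, and
planarity forces the two parts into different orbits. -/
theorem branch_split [DecidableEq T] (κ ψ : ℕ → ℂ) (γ : Perm (Option T)) (b b' : T) (hb : b' ≠ b)
    (h : cyc γ none (some b)) (hb' : γ none = some b') :
    branch κ ψ γ b = ∑ α : Perm T,
      if (¬ orb α (removeNone (swap none (some b) * γ)) b b' ∧
        merge (orb α (removeNone (swap none (some b) * γ))) b b' = ⊤) ∧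
        IsPlanar (removeNone (swap none (some b) * γ)) α then
      rootedProd κ ψ b (cyc α) else 0 := by
  obtain ⟨τ, rfl⟩ : ∃ τ, γ = swap none (some b) * τ :=
    ⟨swap none (some b) * γ, by rw [← mul_assoc, swap_mul_self, one_mul]⟩
  rw [← mul_assoc, swap_mul_self, one_mul]
  refine Fintype.sum_congr _ _ fun α => ?_
  have h0 : τ none = some b' := by
    rw [Perm.mul_apply, swap_apply_eq_iff, swap_apply_of_ne_of_ne (by simp) (by simpa)] at hb'
    exact hb'
  have h1 := defect_nonneg T (removeNone τ) α
  have h2 := defect_swap_mul_of_rel α h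
  rw [h0] at h2
  simp only [ne_eq, reduceCtorEq, not_false_eq_true, Option.getD_some, true_and] at h2
  rw [isPlanar_iff_defect, h2, isPlanar_iff_defect,
    eq_top_iff_comap_some (orb_some_rel b α _), comap_orb_some, h0, Option.getD_some]
  congr 1
  apply propext
  by_cases h3 : orb α (removeNone τ) b b'
  · simp only [h3, if_true, not_true_eq_false, false_and, iff_false]
    rintro ⟨-, h4⟩; omega
  · simp only [h3, if_false, add_zero, not_false_eq_true, true_and]

/-! ### Planar sums for permutations with one or two cycles -/

/-- The sum over noncrossing partitions of a cycle of length `n` in which the block of the root has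
the weight `φ` of its size, and every other block the weight `κ` of its size; `0` for `n = 0`. -/
noncomputable def discSum (κ φ : ℕ → ℂ) (n : ℕ) : ℂ :=
  if h : 0 < n then planarSum (finRotate n) (rootedProd κ φ ⟨0, h⟩) else 0

/-- The sum over annular noncrossing permutations for cycles of lengths `m` and `n`, with the root
on the cycle of length `m`; `0` for `m = 0`. -/
noncomputable def annularSum (κ φ : ℕ → ℂ) (m n : ℕ) : ℂ :=
  if h : 0 < m then
    planarSum (Perm.sumCongr (finRotate m) (finRotate n)) (rootedProd κ φ (.inl ⟨0, h⟩))
  else 0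

theorem cyc_finRotate (n : ℕ) : cyc (finRotate n) = ⊤ := by
  rcases n with _ | n
  · exact Setoid.ext fun x => x.elim0
  have key : ∀ (i : ℕ) (hi : i < n + 1), cyc (finRotate (n + 1)) ⟨i, hi⟩ 0 := by
    intro i
    induction i with
    | zero => intro _; exact Setoid.refl' _ _
    | succ i ih =>
      intro hi
      refine Setoid.trans' _ ?_ (ih (by omega))
      have := cyc_apply_self (finRotate (n + 1)) ⟨i, by omega⟩
      rwa [finRotate_of_lt (by omega)] at this
  exact top_le_iff.1 fun x y _ => Setoid.trans' _ (key x x.2) (Setoid.symm' _ (key y y.2))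

/-- A cyclic permutation is conjugate to a rotation, with a given point as the origin. -/
theorem exists_finRotate_equiv {γ : Perm T} (h : cyc γ = ⊤) (t : T) {n : ℕ}
    (hn : Nat.card T = n) (h0 : 0 < n) :
    ∃ e : Fin n ≃ T, e ⟨0, h0⟩ = t ∧ e.permCongr (finRotate n) = γ := by
  have hon : γ.IsCycleOn ((Finset.univ : Finset T) : Set T) := by
    refine ⟨by simp, fun x _ y _ => ?_⟩
    exact (show cyc γ x y by rw [h]; trivial)
  have hcard : (Finset.univ : Finset T).card = n := by
    rw [Finset.card_univ, ← Nat.card_eq_fintype_card, hn]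
  have hb : Function.Bijective fun i : Fin n => (γ ^ (i : ℕ)) t := by
    rw [Fintype.bijective_iff_surjective_and_card]
    refine ⟨fun y => ?_, by rw [Fintype.card_fin, ← hn, Nat.card_eq_fintype_card]⟩
    obtain ⟨k, hk, hky⟩ := hon.exists_pow_eq (Finset.mem_univ t) (Finset.mem_univ y)
    exact ⟨⟨k, hcard ▸ hk⟩, hky⟩
  refine ⟨Equiv.ofBijective _ hb, rfl, ?_⟩
  set e := Equiv.ofBijective _ hb
  ext x
  obtain ⟨i, rfl⟩ := e.surjective x
  rw [permCongr_apply, symm_apply_apply]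
  obtain ⟨k, rfl⟩ : ∃ k, n = k + 1 := ⟨n - 1, by omega⟩
  show (γ ^ ((finRotate (k + 1) i : Fin (k + 1)) : ℕ)) t = γ ((γ ^ (i : ℕ)) t)
  rw [← Perm.mul_apply, ← pow_succ']
  rcases eq_or_ne i (Fin.last k) with rfl | hi
  · have := hon.pow_card_apply (Finset.mem_univ t)
    rw [hcard] at this
    rw [finRotate_last, Fin.val_last, this]; rfl
  · rw [coe_finRotate_of_ne_last hi]

theorem planarSum_of_cyc_eq_top (κ φ : ℕ → ℂ) {γ : Perm T} (h : cyc γ = ⊤) (t : T) :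
    planarSum γ (rootedProd κ φ t) = discSum κ φ (Nat.card T) := by
  have h0 : 0 < Nat.card T := Finite.card_pos_iff.2 ⟨t⟩
  obtain ⟨e, rfl, rfl⟩ := exists_finRotate_equiv h t rfl h0
  rw [planarSum_permCongr_rooted, discSum, dif_pos h0]

theorem cyc_subtypePerm {T : Type} (γ : Perm T) (p : T → Prop) (hp : ∀ x, p (γ x) ↔ p x) :
    cyc (γ.subtypePerm hp) = (cyc γ).comap Subtype.val := by
  ext x y
  exact Perm.sameCycle_subtypePerm

theorem permCongr_sumCompl {T : Type} (γ : Perm T) (p : T → Prop) (hp : ∀ x, p (γ x) ↔ p x) :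
    (Equiv.sumCompl p).permCongr (Perm.sumCongr (γ.subtypePerm hp)
      (γ.subtypePerm (p := fun x => ¬ p x) fun x => not_congr (hp x))) = γ := by
  ext x
  obtain ⟨x | x, rfl⟩ := (Equiv.sumCompl p).surjective x
  · rw [permCongr_apply, symm_apply_apply]; rfl
  · rw [permCongr_apply, symm_apply_apply]; rfl

theorem comap_sumCompl {T : Type} (p : T → Prop) :
    (Setoid.ker p).comap (Equiv.sumCompl p) = sumSetoid ⊤ ⊤ := by
  ext x y
  rcases x with ⟨x, hx⟩ | ⟨x, hx⟩ <;> rcases y with ⟨y, hy⟩ | ⟨y, hy⟩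
  · exact iff_of_true (by simp [hx, hy])
      (by simp)
  · exact iff_of_false (by simp [hx, hy])
      (by simp)
  · exact iff_of_false (by simp [hx, hy])
      (by simp)
  · exact iff_of_true (by simp [hx, hy])
      (by simp)

/-- A planar sum with two prescribed orbits factorizes. -/
theorem planarSumOn_ker (κ ψ : ℕ → ℂ) (γ : Perm T) (p : T → Prop) [Fintype {x // p x}]
    [Fintype {x // ¬ p x}] (hp : ∀ x, p (γ x) ↔ p x)
    (t : T) (ht : p t) :
    planarSumOn (Setoid.ker p) γ (rootedProd κ ψ t) =
      planarSum (γ.subtypePerm hp) (rootedProd κ ψ ⟨t, ht⟩) *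
      planarSum (γ.subtypePerm (p := fun x => ¬ p x) fun x => not_congr (hp x))
        (blockProd κ) := by
  conv_lhs => rw [← permCongr_sumCompl γ p hp, ← comap_comap_symm (Equiv.sumCompl p) (Setoid.ker p),
    planarSumOn_permCongr, comap_sumCompl]
  refine planarSumOn_sum _ _ _ _ _ fun s s' => ?_
  rw [rootedProd_comap_equiv, ← rootedProd_sum]
  congr 1
  exact (Equiv.symm_apply_eq _).2 rfl

/-- A permutation with the cycles `p` and `¬ p` is conjugate to a pair of rotations, with a given
point of `p` as the origin of the first one. The second cycle may be empty. -/
theorem exists_finRotate_sum_equiv {γ : Perm T} (p : T → Prop) (h : cyc γ = Setoid.ker p) (t : T)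
    (ht : p t) (h0 : 0 < Nat.card {x // p x}) :
    ∃ e : Fin (Nat.card {x // p x}) ⊕ Fin (Nat.card {x // ¬ p x}) ≃ T,
      e (.inl ⟨0, h0⟩) = t ∧ e.permCongr (Perm.sumCongr (finRotate _) (finRotate _)) = γ := by
  have hp : ∀ x, p (γ x) ↔ p x := fun x => by
    have := cyc_apply_self γ x
    rw [h] at this
    exact iff_of_eq this
  have h1 : cyc (γ.subtypePerm hp) = ⊤ := by
    rw [cyc_subtypePerm, h]
    exact top_le_iff.1 fun x y _ => propext ⟨fun _ => y.2, fun _ => x.2⟩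
  have h2 : cyc (γ.subtypePerm (p := fun x => ¬ p x) fun x => not_congr (hp x)) = ⊤ := by
    rw [cyc_subtypePerm, h]
    exact top_le_iff.1 fun x y _ => propext ⟨fun h => absurd h x.2, fun h => absurd h y.2⟩
  obtain ⟨e, he, he'⟩ := exists_finRotate_equiv h1 ⟨t, ht⟩ rfl h0
  obtain ⟨e₂, he₂⟩ : ∃ e₂ : Fin (Nat.card {x // ¬ p x}) ≃ {x // ¬ p x},
      e₂.permCongr (finRotate _) =
        γ.subtypePerm (p := fun x => ¬ p x) fun x => not_congr (hp x) := by
    rcases isEmpty_or_nonempty {x // ¬ p x} with hE | ⟨⟨y⟩⟩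
    · exact ⟨(Finite.equivFin _).symm, Subsingleton.elim _ _⟩
    · obtain ⟨e₂, -, he₂⟩ := exists_finRotate_equiv h2 y rfl (Finite.card_pos_iff.2 ⟨y⟩)
      exact ⟨e₂, he₂⟩
  have h3 : (e.sumCongr e₂).permCongr (Perm.sumCongr (finRotate _) (finRotate _)) =
      Perm.sumCongr (γ.subtypePerm hp)
        (γ.subtypePerm (p := fun x => ¬ p x) fun x => not_congr (hp x)) := by
    rw [← he', ← he₂]
    ext x
    rcases x with x | x <;> rfl
  refine ⟨(e.sumCongr e₂).trans (Equiv.sumCompl p), by simp [he], ?_⟩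
  exact (congrArg _ h3).trans (permCongr_sumCompl γ p hp)

theorem planarSum_of_cyc_eq_ker (κ φ : ℕ → ℂ) {γ : Perm T} (p : T → Prop)
    (h : cyc γ = Setoid.ker p) (t : T) (ht : p t) :
    planarSum γ (rootedProd κ φ t) =
      annularSum κ φ (Nat.card {x // p x}) (Nat.card {x // ¬ p x}) := by
  have h0 : 0 < Nat.card {x // p x} := Finite.card_pos_iff.2 ⟨t, ht⟩
  obtain ⟨e, rfl, rfl⟩ := exists_finRotate_sum_equiv p h t ht h0
  rw [planarSum_permCongr_rooted, annularSum, dif_pos h0]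

end PlanarSums

section Recursion
open scoped Classical

/-! ### Splitting a cycle -/

section Split

theorem merge_eq_top_iff {T : Type*} {s : Setoid T} {x y : T} :
    merge s x y = ⊤ ↔ ∀ z, s z x ∨ s z y := by
  constructor
  · intro h z
    have hz : merge s x y z x := by rw [h]; trivial
    change (if s z y then Quotient.mk s x else Quotient.mk s z) =
      (if s x y then Quotient.mk s x else Quotient.mk s x) at hz
    rw [ite_self] at hz
    split_ifs at hz with h1
    · exact .inr h1
    · exact .inl (Quotient.exact hz)
  · intro h
    have h1 : ∀ z, merge s x y z x := fun z => by
      rcases h z with h | h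
      · exact le_merge s x y h
      · exact Setoid.trans' _ (le_merge s x y h) (Setoid.symm' _ (merge_rel s x y))
    exact top_le_iff.1 fun z w _ => Setoid.trans' _ (h1 z) (Setoid.symm' _ (h1 w))

/-- A partition with the two blocks `p` and `¬ p`. -/
theorem eq_ker_of_two_blocks {T : Type*} {U : Setoid T} {x y : T} {p : T → Prop} (h : ¬ U x y)
    (h1 : ∀ z, p z → U z x) (h2 : ∀ z, ¬ p z → U z y) : U = Setoid.ker p := by
  ext z w
  rw [Setoid.ker_def]
  by_cases hz : p z <;> by_cases hw : p w
  · exact iff_of_true (U.trans' (h1 z hz) (U.symm' (h1 w hw))) (by simp [hz, hw])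
  · refine iff_of_false (fun hzw => h ?_) (by simp [hz, hw])
    exact U.trans' (U.symm' (h1 z hz)) (U.trans' hzw (h2 w hw))
  · refine iff_of_false (fun hzw => h ?_) (by simp [hz, hw])
    exact U.trans' (U.symm' (h1 w hw)) (U.trans' (U.symm' hzw) (h2 z hz))
  · exact iff_of_true (U.trans' (h2 z hz) (U.symm' (h2 w hw))) (by simp [hz, hw])

theorem two_blocks_of_eq_ker {T : Type*} {U : Setoid T} {x y : T} {p : T → Prop} (hx : p x)
    (hy : ¬ p y) (h : U = Setoid.ker p) : ¬ U x y ∧ merge U x y = ⊤ := by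
  subst h
  refine ⟨by simp [hx, hy], merge_eq_top_iff.2 fun z => ?_⟩
  by_cases hz : p z
  · exact .inl (by simp [hx, hz])
  · exact .inr (by simp [hy, hz])

variable {T : Type} {γ : Perm T} {c : T → Fin 3} (hc : cyc γ = Setoid.ker c)
include hc

theorem class_apply (x : T) : c (γ x) = c x := by
  have := cyc_apply_self γ x
  rwa [hc] at this

theorem planarSum_subtype_disc (κ φ : ℕ → ℂ) (p : T → Prop) [Fintype {x // p x}]
    (hp : ∀ x, p (γ x) ↔ p x) (t : T) (ht : p t) {i : Fin 3} (h : ∀ x, p x ↔ c x = i) :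
    planarSum (γ.subtypePerm hp) (rootedProd κ φ ⟨t, ht⟩) =
      discSum κ φ (Nat.card {x // c x = i}) := by
  rw [planarSum_of_cyc_eq_top]
  · rw [Nat.card_congr (Equiv.subtypeEquivRight h)]
  · rw [cyc_subtypePerm, hc]
    refine top_le_iff.1 fun x y _ => ?_
    exact ((h _).1 x.2).trans ((h _).1 y.2).symm

theorem planarSum_subtype_annular (κ φ : ℕ → ℂ) (p : T → Prop) [Fintype {x // p x}]
    (hp : ∀ x, p (γ x) ↔ p x) (t : T) (ht : p t) {i j : Fin 3} (hi : c t = i) (hij : i ≠ j)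
    (h : ∀ x, p x ↔ c x = i ∨ c x = j) :
    planarSum (γ.subtypePerm hp) (rootedProd κ φ ⟨t, ht⟩) =
      annularSum κ φ (Nat.card {x // c x = i}) (Nat.card {x // c x = j}) := by
  rw [planarSum_of_cyc_eq_ker κ φ (fun x : {x // p x} => c x = i) _ _ hi]
  · congr 1
    · refine Nat.card_congr ((Equiv.subtypeSubtypeEquivSubtypeInter p fun x => c x = i).trans
        (Equiv.subtypeEquivRight fun x => ?_))
      rw [h]; tauto
    · refine Nat.card_congr ((Equiv.subtypeSubtypeEquivSubtypeInter p fun x => ¬ c x = i).trans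
        (Equiv.subtypeEquivRight fun x => ?_))
      rw [h]
      constructor
      · rintro ⟨h1 | h1, h2⟩
        · exact absurd h1 h2
        · exact h1
      · intro h1; exact ⟨.inr h1, by rw [h1]; exact hij.symm⟩
  · rw [cyc_subtypePerm, hc]
    ext x y
    show c x = c y ↔ (c x = i) = (c y = i)
    rcases (h _).1 x.2 with h1 | h1 <;> rcases (h _).1 y.2 with h2 | h2 <;>
      simp [h1, h2, hij, hij.symm]

variable [Fintype T] {b b' : T} (hb : c b = 0) (hb' : c b' = 1)
include hb hb'

/-- The sum of `branch_split` when `γ` has the two cycles `c = 0` and `c = 1`: planarity decouples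
them. -/
theorem split_sum_disc [DecidableEq T] (κ ψ : ℕ → ℂ) (h2 : ∀ x, c x ≠ 2) :
    (∑ α : Perm T, if (¬ orb α γ b b' ∧ merge (orb α γ) b b' = ⊤) ∧ IsPlanar γ α then
      rootedProd κ ψ b (cyc α) else 0) =
      discSum κ ψ (Nat.card {x // c x = 0}) * discSum κ κ (Nat.card {x // c x = 1}) := by
  have h01 : ∀ x, ¬ c x = 0 ↔ c x = 1 := fun x => by have := h2 x; omega
  have hp : ∀ x, c (γ x) = 0 ↔ c x = 0 := fun x => by rw [class_apply hc]
  have e1 := planarSum_subtype_disc hc κ ψ (fun x => c x = 0) hp b hb (fun x => Iff.rfl)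
  have e2 := planarSum_subtype_disc hc κ κ (fun x => ¬ c x = 0) (fun x => not_congr (hp x)) b'
    (by rw [hb']; decide) h01
  rw [planarSum_rooted_self] at e2
  rw [← e1, ← e2, ← planarSumOn_ker κ ψ γ (fun x => c x = 0) hp b hb, planarSumOn_eq]
  refine Fintype.sum_congr _ _ fun α => ?_
  have : (¬ orb α γ b b' ∧ merge (orb α γ) b b' = ⊤) ↔
      orb α γ = Setoid.ker fun x => c x = 0 := by
    constructor
    · rintro ⟨h, -⟩
      have hle : cyc γ ≤ orb α γ := le_sup_right
      rw [hc] at hle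
      refine eq_ker_of_two_blocks h (fun z hz => hle ?_) fun z hz => hle ?_
      · exact hz.trans hb.symm
      · exact ((h01 z).1 hz).trans hb'.symm
    · exact two_blocks_of_eq_ker hb (by rw [hb']; decide)
  simp only [this]

/-- The sum of `branch_split` when `γ` has the three cycles `c = 0`, `c = 1` and `c = 2`: the third
cycle lies either in the orbit of `b'` or in the orbit of `b`. -/
theorem split_sum_annular [DecidableEq T] (κ ψ : ℕ → ℂ) (h2 : ∃ x, c x = 2) :
    (∑ α : Perm T, if (¬ orb α γ b b' ∧ merge (orb α γ) b b' = ⊤) ∧ IsPlanar γ α then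
      rootedProd κ ψ b (cyc α) else 0) =
      discSum κ ψ (Nat.card {x // c x = 0}) *
        annularSum κ κ (Nat.card {x // c x = 1}) (Nat.card {x // c x = 2}) +
      annularSum κ ψ (Nat.card {x // c x = 0}) (Nat.card {x // c x = 2}) *
        discSum κ κ (Nat.card {x // c x = 1}) := by
  obtain ⟨z, hz⟩ := h2
  have hp : ∀ i x, c (γ x) = i ↔ c x = i := fun i x => by rw [class_apply hc]
  have e1 := planarSum_subtype_disc hc κ ψ (fun x => c x = 0) (hp 0) b hb (fun x => Iff.rfl)
  have e2 := planarSum_subtype_annular hc κ κ (fun x => ¬ c x = 0)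
    (fun x => not_congr (hp 0 x)) b' (by rw [hb']; decide) hb' (j := 2) (by decide)
    (fun x => by omega)
  have e3 := planarSum_subtype_annular hc κ ψ (fun x => ¬ c x = 1)
    (fun x => not_congr (hp 1 x)) b (by rw [hb]; decide) hb (j := 2) (by decide)
    (fun x => by omega)
  have e4 := planarSum_subtype_disc hc κ κ (fun x => ¬ ¬ c x = 1)
    (fun x => not_congr (not_congr (hp 1 x))) b' (by rw [hb']; decide)
    (fun x => not_not)
  rw [planarSum_rooted_self] at e2 e4
  rw [← e1, ← e2, ← e3, ← e4, ← planarSumOn_ker κ ψ γ (fun x => c x = 0) (hp 0) b hb,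
    ← planarSumOn_ker κ ψ γ (fun x => ¬ c x = 1) (fun x => not_congr (hp 1 x)) b
      (by rw [hb]; decide), planarSumOn_eq, planarSumOn_eq, ← Finset.sum_add_distrib]
  refine Fintype.sum_congr _ _ fun α => ?_
  have h3 : (¬ orb α γ b b' ∧ merge (orb α γ) b b' = ⊤) ↔
      (orb α γ = Setoid.ker fun x => c x = 0) ∨ orb α γ = Setoid.ker fun x => ¬ c x = 1 := by
    constructor
    · rintro ⟨h, ht⟩
      have hle : cyc γ ≤ orb α γ := le_sup_right
      rw [hc] at hle
      have r0 : ∀ x, c x = 0 → orb α γ x b := fun x hx => hle (hx.trans hb.symm)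
      have r1 : ∀ x, c x = 1 → orb α γ x b' := fun x hx => hle (hx.trans hb'.symm)
      have r2 : ∀ x, c x = 2 → orb α γ x z := fun x hx => hle (hx.trans hz.symm)
      rcases merge_eq_top_iff.1 ht z with hzb | hzb
      · refine .inr (eq_ker_of_two_blocks h (fun x hx => ?_) fun x hx => r1 x (not_not.1 hx))
        rcases (show c x = 0 ∨ c x = 2 by omega) with h0 | h0
        · exact r0 x h0
        · exact Setoid.trans' _ (r2 x h0) hzb
      · refine .inl (eq_ker_of_two_blocks h r0 fun x hx => ?_)
        rcases (show c x = 1 ∨ c x = 2 by omega) with h0 | h0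
        · exact r1 x h0
        · exact Setoid.trans' _ (r2 x h0) hzb
    · rintro (h | h)
      · exact two_blocks_of_eq_ker hb (by rw [hb']; decide) h
      · exact two_blocks_of_eq_ker (p := fun x => ¬ c x = 1) (by rw [hb]; decide)
          (by rw [hb']; decide) h
  have h4 : ¬ ((orb α γ = Setoid.ker fun x => c x = 0) ∧
      orb α γ = Setoid.ker fun x => ¬ c x = 1) := by
    rintro ⟨h, h'⟩
    have : Setoid.ker (fun x => ¬ c x = 1) z b := by simp [hz, hb]
    rw [← h', h] at this
    simp [hz, hb] at this
  simp only [h3]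
  by_cases hA : orb α γ = Setoid.ker fun x => c x = 0
  · have hB : ¬ orb α γ = Setoid.ker fun x => ¬ c x = 1 := fun hB => h4 ⟨hA, hB⟩
    simp only [hA] at hB ⊢
    simp [hB]
  · simp [hA]

end Split

/-! ### The permutation with a rooted cycle and a second cycle -/

/-- The points of a rooted cycle of length `m + 1` and of a cycle of length `n`, with the root
`none`. -/
def rootedEquiv (m n : ℕ) : Fin (m + 1) ⊕ Fin n ≃ Option (Fin m ⊕ Fin n) where
  toFun := Sum.elim (Fin.cases none fun i => some (.inl i)) fun j => some (.inr j)
  invFun o := o.elim (.inl 0) (Sum.elim (fun i => .inl i.succ) .inr)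
  left_inv := by
    rintro (i | j)
    · refine Fin.cases ?_ (fun i => ?_) i <;> simp
    · rfl
  right_inv := by
    rintro (_ | i | j) <;> rfl

/-- The permutation `none → 0 → ⋯ → m - 1 → none` on the first part, and a rotation on the
second. -/
def rootedPerm (m n : ℕ) : Perm (Option (Fin m ⊕ Fin n)) :=
  (rootedEquiv m n).permCongr (Perm.sumCongr (finRotate (m + 1)) (finRotate n))

variable {m n : ℕ}

theorem rootedPerm_none (h : 0 < m) : rootedPerm m n none = some (.inl ⟨0, h⟩) := by
  obtain ⟨m, rfl⟩ : ∃ k, m = k + 1 := ⟨m - 1, by omega⟩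
  show rootedEquiv _ n (.inl (finRotate (m + 2) ⟨0, by omega⟩)) = _
  rw [finRotate_of_lt (by omega)]
  rfl

theorem rootedPerm_none_zero : rootedPerm 0 n none = none := by
  show rootedEquiv 0 n (.inl (finRotate 1 0)) = _
  rw [Subsingleton.elim (finRotate 1 0) 0]
  rfl

theorem rootedPerm_inl (i : Fin m) (h : (i : ℕ) + 1 < m) :
    rootedPerm m n (some (.inl i)) = some (.inl ⟨i + 1, h⟩) := by
  show rootedEquiv m n (.inl (finRotate (m + 1) ⟨i + 1, by omega⟩)) = _
  rw [finRotate_of_lt (by omega)]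
  rfl

theorem rootedPerm_inl_last (i : Fin m) (h : (i : ℕ) + 1 = m) :
    rootedPerm m n (some (.inl i)) = none := by
  show rootedEquiv m n (.inl (finRotate (m + 1) ⟨i + 1, by omega⟩)) = _
  rw [show (⟨i + 1, by omega⟩ : Fin (m + 1)) = Fin.last m from Fin.ext h, finRotate_last]
  rfl

theorem rootedPerm_inr (j : Fin n) :
    rootedPerm m n (some (.inr j)) = some (.inr (finRotate n j)) := rfl

theorem cyc_rootedPerm :
    cyc (rootedPerm m n) = (sumSetoid ⊤ ⊤).comap (rootedEquiv m n).symm := by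
  rw [rootedPerm, cyc_permCongr, cyc_sumCongr, cyc_finRotate, cyc_finRotate]

theorem cyc_rootedPerm_inl (i : Fin m) : cyc (rootedPerm m n) none (some (.inl i)) := by
  rw [cyc_rootedPerm]
  exact Sum.LiftRel.inl trivial

theorem not_cyc_rootedPerm_inr (j : Fin n) : ¬ cyc (rootedPerm m n) none (some (.inr j)) := by
  rw [cyc_rootedPerm]
  exact sumSetoid_inl_inr _ _ _ _

theorem cyc_rootedPerm_inr_inr (i j : Fin n) :
    cyc (rootedPerm m n) (some (.inr i)) (some (.inr j)) := by
  rw [cyc_rootedPerm]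
  exact Sum.LiftRel.inr trivial

/-- The cycles into which the rooted cycle is split by the point `k`, and the second cycle. -/
def splitClass (m n k : ℕ) : Fin m ⊕ Fin n → Fin 3 :=
  Sum.elim (fun i => if (i : ℕ) < k then 1 else 0) fun _ => 2

/-- Composing with `(none k)` and deleting the root splits the rooted cycle into `{k, …, m - 1}` and
`{0, …, k - 1}`. -/
theorem cyc_split (k : Fin m) :
    cyc (removeNone (swap none (some (.inl k)) * rootedPerm m n)) =
      Setoid.ker (splitClass m n k) := by
  set τ := swap none (some (.inl k)) * rootedPerm m n with hτ
  have hinr : ∀ j, τ (some (.inr j)) = some (.inr (finRotate n j)) := fun j => by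
    rw [hτ, Perm.mul_apply, rootedPerm_inr, swap_apply_of_ne_of_ne] <;> simp
  have hinl : ∀ (i : Fin m) (h : (i : ℕ) + 1 < m), (i : ℕ) + 1 ≠ k →
      τ (some (.inl i)) = some (.inl ⟨i + 1, h⟩) := fun i h hk => by
    rw [hτ, Perm.mul_apply, rootedPerm_inl i h, swap_apply_of_ne_of_ne (by simp)]
    intro h
    simp only [Option.some.injEq, Sum.inl.injEq] at h
    exact hk (congrArg Fin.val h)
  apply le_antisymm
  · have key : cyc τ ≤ Setoid.ker fun o => o.elim 1 (splitClass m n k) := by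
      refine cyc_le ?_
      show ∀ o, (τ o).elim 1 (splitClass m n k) = o.elim 1 (splitClass m n k)
      rintro (_ | i | j)
      · rw [hτ, Perm.mul_apply, rootedPerm_none k.pos]
        rcases Nat.eq_zero_or_pos k with h | h
        · rw [show (⟨0, by omega⟩ : Fin m) = k from Fin.ext h.symm, swap_apply_right]
        · rw [swap_apply_of_ne_of_ne (by simp)]
          · simp [splitClass, -Fin.val_fin_lt, -Fin.val_fin_le, h]
          · intro h'
            simp only [Option.some.injEq, Sum.inl.injEq] at h'
            exact h.ne (congrArg Fin.val h')
      · rcases Nat.lt_or_ge ((i : ℕ) + 1) m with h | h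
        · by_cases hk : (i : ℕ) + 1 = k
          · rw [hτ, Perm.mul_apply, rootedPerm_inl i h,
              show (⟨i + 1, h⟩ : Fin m) = k from Fin.ext hk, swap_apply_right]
            have : (i : ℕ) < k := by omega
            simp [splitClass, -Fin.val_fin_lt, -Fin.val_fin_le, this]
          · rw [hinl i h hk]
            have : (i : ℕ) + 1 < k ↔ (i : ℕ) < k := by omega
            simp [splitClass, -Fin.val_fin_lt, -Fin.val_fin_le, this]
        · rw [hτ, Perm.mul_apply, rootedPerm_inl_last i (by omega), swap_apply_left]
          have : ¬ (i : ℕ) < k := by omega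
          simp [splitClass, -Fin.val_fin_lt, -Fin.val_fin_le, this]
      · rw [hinr]; rfl
    intro x y hxy
    exact key ((cyc_option_rel τ x y).2 hxy)
  · -- each class is a path under `τ`
    have step : ∀ (i : ℕ) (h : i + 1 < m), i + 1 ≠ k →
        cyc τ (some (.inl ⟨i + 1, h⟩)) (some (.inl ⟨i, by omega⟩)) := fun i h hk => by
      have := cyc_apply_self τ (some (.inl ⟨i, by omega⟩))
      rwa [hinl _ h hk] at this
    have low : ∀ (i : ℕ) (h : i < m), i < k →
        cyc τ (some (.inl ⟨i, h⟩)) (some (.inl ⟨0, by omega⟩)) := by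
      intro i
      induction i with
      | zero => exact fun _ _ => Setoid.refl' _ _
      | succ i ih =>
        intro h hk
        exact Setoid.trans' _ (step i h (by omega)) (ih (by omega) (by omega))
    have high : ∀ (i : ℕ) (h : k + i < m),
        cyc τ (some (.inl ⟨k + i, h⟩)) (some (.inl k)) := by
      intro i
      induction i with
      | zero => exact fun _ => Setoid.refl' _ _
      | succ i ih =>
        intro h
        exact Setoid.trans' _ (step (k + i) h (by omega)) (ih (by omega))
    have right : ∀ j j', cyc τ (some (.inr j)) (some (.inr j')) := by
      have : (⊤ : Setoid (Fin n)) ≤ (cyc τ).comap fun j => some (.inr j) := by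
        rw [← cyc_finRotate]
        refine cyc_le fun j => ?_
        have := cyc_apply_self τ (some (.inr j))
        rwa [hinr] at this
      exact fun j j' => this trivial
    intro x y hxy
    rw [← cyc_option_rel]
    change splitClass m n k x = splitClass m n k y at hxy
    rcases x with i | i <;> rcases y with j | j
    · by_cases hi : (i : ℕ) < k <;> by_cases hj : (j : ℕ) < k
      · exact Setoid.trans' _ (low i i.2 hi) (Setoid.symm' _ (low j j.2 hj))
      · simp [splitClass, -Fin.val_fin_lt, -Fin.val_fin_le, hi, hj] at hxy
      · simp [splitClass, -Fin.val_fin_lt, -Fin.val_fin_le, hi, hj] at hxy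
      · have h1 := high (i - k) (by omega)
        have h2 := high (j - k) (by omega)
        simp only [show (k : ℕ) + (i - k) = i by omega, show (k : ℕ) + (j - k) = j by omega]
          at h1 h2
        exact Setoid.trans' _ h1 (Setoid.symm' _ h2)
    · simp only [splitClass, Sum.elim_inl, Sum.elim_inr] at hxy
      split_ifs at hxy <;> exact absurd hxy (by decide)
    · simp only [splitClass, Sum.elim_inl, Sum.elim_inr] at hxy
      split_ifs at hxy <;> exact absurd hxy (by decide)
    · exact right i j

/-- Composing with `(none j)`, for `j` in the second cycle, and deleting the root joins the two
cycles to one. -/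
theorem cyc_join (j : Fin n) :
    cyc (removeNone (swap none (some (.inr j)) * rootedPerm m n)) = ⊤ := by
  set τ := swap none (some (.inr j)) * rootedPerm m n with hτ
  have h1 := cyc_swap_mul_of_not (not_cyc_rootedPerm_inr (m := m) j)
  have h2 : cyc (rootedPerm m n) ≤ cyc τ := by
    rw [← merge_of_rel h1, merge_cyc_swap_mul]
    exact le_merge _ _ _
  have h3 : ∀ x, cyc τ (some x) (some (.inr j)) := by
    rintro (i | i)
    · exact Setoid.trans' _ (Setoid.symm' _ (h2 (cyc_rootedPerm_inl i))) h1
    · exact h2 (cyc_rootedPerm_inr_inr i j)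
  refine top_le_iff.1 fun x y _ => ?_
  rw [← cyc_option_rel]
  exact Setoid.trans' _ (h3 x) (Setoid.symm' _ (h3 y))

theorem card_splitClass_zero {k : ℕ} (h : k ≤ m) :
    Nat.card {x // splitClass m n k x = 0} = m - k := by
  have : Nat.card {x // splitClass m n k x = 0} = Nat.card (Fin (m - k)) := by
    refine (Nat.card_congr (Equiv.ofBijective
      (fun i => ⟨.inl ⟨k + i, by omega⟩, by simp [splitClass]⟩) ⟨?_, ?_⟩)).symm
    · intro i j hij
      simp only [Subtype.mk.injEq, Sum.inl.injEq, Fin.mk.injEq] at hij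
      exact Fin.ext (by omega)
    · rintro ⟨i | i, hi⟩
      · have : ¬ (i : ℕ) < k := fun h => by
          simp [splitClass, -Fin.val_fin_lt, -Fin.val_fin_le, h] at hi
        refine ⟨⟨i - k, by omega⟩, Subtype.ext (congrArg Sum.inl (Fin.ext ?_))⟩
        simp only; omega
      · exact absurd hi (by simp [splitClass])
  rw [this, Nat.card_fin]

theorem card_splitClass_one {k : ℕ} (h : k ≤ m) :
    Nat.card {x // splitClass m n k x = 1} = k := by
  have : Nat.card {x // splitClass m n k x = 1} = Nat.card (Fin k) := by
    refine (Nat.card_congr (Equiv.ofBijective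
      (fun i => ⟨.inl ⟨i, by omega⟩, by simp [splitClass]⟩) ⟨?_, ?_⟩)).symm
    · intro i j hij
      simp only [Subtype.mk.injEq, Sum.inl.injEq, Fin.mk.injEq] at hij
      exact Fin.ext (by omega)
    · rintro ⟨i | i, hi⟩
      · have : (i : ℕ) < k := by
          by_contra h; simp [splitClass, -Fin.val_fin_lt, -Fin.val_fin_le, h] at hi
        exact ⟨⟨i, this⟩, rfl⟩
      · exact absurd hi (by simp [splitClass])
  rw [this, Nat.card_fin]

theorem card_splitClass_two {k : ℕ} :
    Nat.card {x // splitClass m n k x = 2} = n := by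
  have : Nat.card {x // splitClass m n k x = 2} = Nat.card (Fin n) := by
    refine (Nat.card_congr (Equiv.ofBijective
      (fun i => ⟨.inr i, by simp [splitClass]⟩) ⟨?_, ?_⟩)).symm
    · intro i j hij
      exact Sum.inr_injective (congrArg Subtype.val hij)
    · rintro ⟨i | i, hi⟩
      · simp only [splitClass, Sum.elim_inl] at hi
        split_ifs at hi <;> exact absurd hi (by decide)
      · exact ⟨i, rfl⟩
  rw [this, Nat.card_fin]

/-! ### The recursions -/

/-- The sum over all noncrossing partitions of a cycle of length `n`, with `1` for `n = 0`. -/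
noncomputable def moment (κ : ℕ → ℂ) (n : ℕ) : ℂ := if n = 0 then 1 else discSum κ κ n

/-- The term of `planarSum_option` with a fixed root: the root may be deleted, as another point
of its cycle is left. -/
theorem planarSum_remove_fixed (κ : ℕ → ℂ) (h : 0 < m) :
    (∑ α : Perm (Fin m ⊕ Fin n), if orb (optionCongr α) (rootedPerm m n) = ⊤ ∧
      IsPlanar (removeNone (rootedPerm m n)) α then blockProd κ (cyc α) else 0) =
      planarSum (removeNone (rootedPerm m n)) (blockProd κ) := by
  rw [planarSum, planarSumOn_eq]
  refine Fintype.sum_congr _ _ fun α => ?_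
  have h1 : orb (optionCongr α) (rootedPerm m n) none (some (.inl ⟨0, h⟩)) := by
    have := orb_right (optionCongr α) (rootedPerm m n) none
    rw [rootedPerm_none h] at this
    exact Setoid.symm' _ this
  rw [eq_top_iff_comap_some h1, comap_orb_none]

theorem branch_inl_zero (κ ψ : ℕ → ℂ) (h : 0 < m) :
    branch κ ψ (rootedPerm m n) (.inl ⟨0, h⟩) =
      planarSum (removeNone (swap none (some (.inl ⟨0, h⟩)) * rootedPerm m n))
        (rootedProd κ ψ (.inl ⟨0, h⟩)) :=
  branch_join κ ψ _ _ (.inr (rootedPerm_none h))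

/-- The recursion for noncrossing partitions: the root is a singleton, or the next point of its
block cuts off a cycle of length `k`, and becomes the root of the other `m - k` points. -/
theorem discSum_succ (κ φ : ℕ → ℂ) (m : ℕ) :
    discSum κ φ (m + 1) = φ 1 * moment κ m +
      ∑ k : Fin m, moment κ k * discSum κ (fun i => φ (i + 1)) (m - k) := by
  have htop : cyc (rootedPerm m 0) = ⊤ := by
    have : ∀ o, cyc (rootedPerm m 0) none o := by
      rintro (_ | i | j)
      · exact Setoid.refl' _ _
      · exact cyc_rootedPerm_inl i
      · exact j.elim0
    exact top_le_iff.1 fun x y _ => Setoid.trans' _ (Setoid.symm' _ (this x)) (this y)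
  have h := planarSum_of_cyc_eq_top κ φ htop none
  rw [show Nat.card (Option (Fin m ⊕ Fin 0)) = m + 1 by simp] at h
  rw [← h, planarSum_option, Fintype.sum_sum_type, Fintype.sum_empty (ι := Fin 0), add_zero]
  congr 1
  · congr 1
    rcases Nat.eq_zero_or_pos m with rfl | hm
    · have h1 : ∀ α : Perm (Fin 0 ⊕ Fin 0), IsPlanar (removeNone (rootedPerm 0 0)) α := fun α => by
        have h : ∀ s : Setoid (Fin 0 ⊕ Fin 0), nb s = 0 := fun s => Nat.card_of_isEmpty
        simp [IsPlanar, h]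
      have h2 : ∀ α : Perm (Fin 0 ⊕ Fin 0), orb (optionCongr α) (rootedPerm 0 0) = ⊤ := fun α =>
        top_le_iff.1 fun x y _ => by
          rw [Subsingleton.elim x y]
      simp [h1, h2, moment, blockProd]
    · rw [planarSum_remove_fixed κ hm, ← planarSum_rooted_self κ _ (.inl ⟨0, hm⟩),
        planarSum_of_cyc_eq_top, moment, if_neg hm.ne']
      · simp
      · rw [← comap_cyc_option, htop, comap_top]
  · refine Fintype.sum_congr _ _ fun k => ?_
    have hm := k.pos
    rcases Nat.eq_zero_or_pos (k : ℕ) with hk | hk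
    · obtain rfl : k = ⟨0, hm⟩ := Fin.ext hk
      rw [branch_inl_zero, planarSum_of_cyc_eq_top]
      · simp [moment]
      · rw [cyc_split]
        refine top_le_iff.1 fun x y _ => ?_
        rcases x with x | x
        · rcases y with y | y
          · simp [splitClass]
          · exact y.elim0
        · exact x.elim0
    · rw [branch_split _ _ _ _ (.inl ⟨0, by omega⟩) _ (cyc_rootedPerm_inl k)
        (rootedPerm_none (by omega)), split_sum_disc (cyc_split k), card_splitClass_zero k.2.le,
        card_splitClass_one k.2.le, moment, if_neg hk.ne', mul_comm]
      · simp [splitClass]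
      · simp [splitClass, -Fin.val_fin_lt, -Fin.val_fin_le, hk]
      · rintro (i | i)
        · simp only [splitClass, Sum.elim_inl]; split_ifs <;> decide
        · exact i.elim0
      · intro h
        exact hk.ne (congrArg Fin.val (Sum.inl_injective h))

/-- The recursion for annular noncrossing permutations. The next point of the block of the root can
lie on the same cycle; it then cuts off `k` points, and the second cycle is attached to one of the
two parts. Or it is one of the `n` points of the second cycle; the two cycles then become one of
length `m + n`, and the rest is planar in a disc. -/
theorem annularSum_succ (κ φ : ℕ → ℂ) (m : ℕ) {n : ℕ} (hn : 0 < n) :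
    annularSum κ φ (m + 1) n = φ 1 * annularSum κ κ m n +
      ∑ k : Fin m, (moment κ k * annularSum κ (fun i => φ (i + 1)) (m - k) n +
        annularSum κ κ k n * discSum κ (fun i => φ (i + 1)) (m - k)) +
      n * discSum κ (fun i => φ (i + 1)) (m + n) := by
  have h : annularSum κ φ (m + 1) n = planarSum (rootedPerm m n) (rootedProd κ φ none) := by
    rw [annularSum, dif_pos (by omega), rootedPerm,
      ← planarSum_permCongr_rooted κ φ (rootedEquiv m n)]
    rfl
  rw [h, planarSum_option, Fintype.sum_sum_type, ← add_assoc]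
  congr 1
  · congr 1
    · congr 1
      rcases Nat.eq_zero_or_pos m with rfl | hm
      · rw [annularSum, dif_neg (by omega)]
        refine Finset.sum_eq_zero fun α _ => if_neg ?_
        rintro ⟨h, -⟩
        refine orb_option_isolated α rootedPerm_none_zero (.inr ⟨0, hn⟩) ?_
        rw [h]; trivial
      · rw [planarSum_remove_fixed κ hm, ← planarSum_rooted_self κ _ (.inl ⟨0, hm⟩),
          planarSum_of_cyc_eq_ker κ κ (fun x => splitClass m n 0 x = 0) _ _ (by simp [splitClass])]
        · have e : ∀ x : Fin m ⊕ Fin n, ¬ splitClass m n 0 x = 0 ↔ splitClass m n 0 x = 2 := by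
            rintro (x | x) <;> simp [splitClass]
          rw [card_splitClass_zero (by omega), Nat.card_congr (Equiv.subtypeEquivRight e),
            card_splitClass_two, Nat.sub_zero]
        · rw [← comap_cyc_option]
          ext x y
          rw [Setoid.comap_rel, Setoid.ker_def]
          rcases x with x | x <;> rcases y with y | y
          · exact iff_of_true (Setoid.trans' _ (Setoid.symm' _ (cyc_rootedPerm_inl x))
              (cyc_rootedPerm_inl y)) (by simp [splitClass])
          · refine iff_of_false (fun h => not_cyc_rootedPerm_inr (m := m) y ?_)
              (by simp [splitClass])
            exact Setoid.trans' _ (cyc_rootedPerm_inl x) h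
          · refine iff_of_false (fun h => not_cyc_rootedPerm_inr (m := m) x ?_)
              (by simp [splitClass])
            exact Setoid.trans' _ (cyc_rootedPerm_inl y) (Setoid.symm' _ h)
          · exact iff_of_true (cyc_rootedPerm_inr_inr x y) (by simp [splitClass])
    · refine Fintype.sum_congr _ _ fun k => ?_
      have hm := k.pos
      rcases Nat.eq_zero_or_pos (k : ℕ) with hk | hk
      · obtain rfl : k = ⟨0, hm⟩ := Fin.ext hk
        have e : ∀ x : Fin m ⊕ Fin n, ¬ splitClass m n 0 x = 0 ↔ splitClass m n 0 x = 2 := by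
          rintro (x | x) <;> simp [splitClass]
        rw [branch_inl_zero, planarSum_of_cyc_eq_ker _ _ (fun x => splitClass m n 0 x = 0) _ _
          (by simp [splitClass]), card_splitClass_zero (by omega),
          Nat.card_congr (Equiv.subtypeEquivRight e), card_splitClass_two]
        · simp [moment, annularSum]
        · rw [cyc_split]
          ext x y
          rw [Setoid.ker_def, Setoid.ker_def]
          rcases x with x | x <;> rcases y with y | y <;> simp [splitClass]
      · rw [branch_split _ _ _ _ (.inl ⟨0, by omega⟩) _ (cyc_rootedPerm_inl k)
          (rootedPerm_none (by omega)), split_sum_annular (cyc_split k),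
          card_splitClass_zero k.2.le, card_splitClass_one k.2.le, card_splitClass_two, moment,
          if_neg hk.ne']
        · ring
        · simp [splitClass]
        · simp [splitClass, -Fin.val_fin_lt, -Fin.val_fin_le, hk]
        · exact ⟨.inr ⟨0, hn⟩, rfl⟩
        · intro h
          exact hk.ne (congrArg Fin.val (Sum.inl_injective h))
  · have : ∀ j : Fin n, branch κ (fun i => φ (i + 1)) (rootedPerm m n) (.inr j) =
        discSum κ (fun i => φ (i + 1)) (m + n) := fun j => by
      rw [branch_join _ _ _ _ (.inl (not_cyc_rootedPerm_inr j)),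
        planarSum_of_cyc_eq_top _ _ (cyc_join j)]
      simp
    simp [this]

end Recursion

section MultiplicativeFunctions
open scoped Classical

variable {T X Y : Type}

/-! ### Values of multiplicative functions -/

theorem merge_iff {s : Setoid T} {x y u v : T} :
    merge s x y u v ↔ s u v ∨ (s u x ∨ s u y) ∧ (s v x ∨ s v y) := by
  constructor
  · intro h
    change (if s u y then Quotient.mk s x else Quotient.mk s u) =
      (if s v y then Quotient.mk s x else Quotient.mk s v) at h
    split_ifs at h with h1 h2 h2
    · exact .inl (s.trans' h1 (s.symm' h2))
    · exact .inr ⟨.inr h1, .inl (s.symm' (Quotient.exact h))⟩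
    · exact .inr ⟨.inl (Quotient.exact h), .inr h2⟩
    · exact .inl (Quotient.exact h)
  · rintro (h | ⟨h1, h2⟩)
    · exact le_merge s x y h
    · have key : ∀ w, s w x ∨ s w y → merge s x y w x := by
        rintro w (h | h)
        · exact le_merge s x y h
        · exact Setoid.trans' _ (le_merge s x y h) (Setoid.symm' _ (merge_rel s x y))
      exact Setoid.trans' _ (key u h1) (Setoid.symm' _ (key v h2))

theorem nb_le_of_le [Finite T] {s t : Setoid T} (h : s ≤ t) : nb t ≤ nb s :=
  Nat.card_le_card_of_surjective (Quotient.map id h) (Quotient.ind fun x => ⟨Quotient.mk s x, rfl⟩)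

theorem eq_of_le_of_nb_le [Finite T] {s t : Setoid T} (h : s ≤ t) (hn : nb s ≤ nb t) : s = t := by
  have := Fintype.ofFinite (Quotient s)
  have := Fintype.ofFinite (Quotient t)
  have hb : Function.Bijective (Quotient.map id h : Quotient s → Quotient t) := by
    rw [Fintype.bijective_iff_surjective_and_card]
    refine ⟨Quotient.ind fun x => ⟨Quotient.mk s x, rfl⟩, ?_⟩
    rw [← Nat.card_eq_fintype_card, ← Nat.card_eq_fintype_card]
    exact le_antisymm hn (nb_le_of_le h)
  refine le_antisymm h fun x y hxy => ?_
  exact Quotient.exact (hb.1 (show Quotient.map id h (Quotient.mk s x) =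
    Quotient.map id h (Quotient.mk s y) from Quotient.sound hxy))

theorem nb_top [Nonempty T] : nb (⊤ : Setoid T) = 1 := by
  exact Nat.card_eq_one_iff_unique.2
    ⟨⟨Quotient.ind₂ fun _ _ => Quotient.sound trivial⟩, ⟨Quotient.mk _ (Classical.arbitrary T)⟩⟩

/-- The product over the blocks, except those of `x` and `y`, of the weights of the sizes. -/
noncomputable def pairProd [Fintype T] (κ : ℕ → ℂ) (x y : T) (s : Setoid T) : ℂ :=
  ∏ c : Quotient s, if c = Quotient.mk s x ∨ c = Quotient.mk s y then 1 else κ (size s c)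

theorem pairProd_comap_equiv [Fintype X] [Fintype T] (κ : ℕ → ℂ) (e : X ≃ T) (x y : X)
    (s : Setoid T) : pairProd κ x y (s.comap e) = pairProd κ (e x) (e y) s := by
  refine Fintype.prod_equiv (quotientComapEquiv e s) _ _ fun c => ?_
  rw [size_comap_equiv]
  have : ∀ t, quotientComapEquiv e s c = Quotient.mk s (e t) ↔ c = Quotient.mk _ t := fun t => by
    rw [← (quotientComapEquiv e s).injective.eq_iff]; rfl
  simp only [this]

theorem pairProd_sum [Fintype X] [Fintype Y] (κ : ℕ → ℂ) (x : X) (y : Y) (s : Setoid X)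
    (t : Setoid Y) : pairProd κ (.inl x) (.inr y) (sumSetoid s t) =
      rootedProd κ 1 x s * rootedProd κ 1 y t := by
  have hx : Quotient.mk (sumSetoid s t) (.inl x) =
      quotientSumEquiv s t (.inl (Quotient.mk s x)) := rfl
  have hy : Quotient.mk (sumSetoid s t) (.inr y) =
      quotientSumEquiv s t (.inr (Quotient.mk t y)) := rfl
  rw [pairProd, ← (quotientSumEquiv s t).prod_comp, Fintype.prod_sum_type, rootedProd, rootedProd]
  simp only [hx, hy, (quotientSumEquiv s t).injective.eq_iff, Sum.inl.injEq, Sum.inr.injEq,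
    reduceCtorEq, or_false, false_or, size_sum_inl, size_sum_inr]
  congr 1 <;> refine Fintype.prod_congr _ _ fun c => ?_ <;> split_ifs <;> rfl

/-- The factor of the root, split off; the weight `1` leaves the product of the other blocks. -/
theorem rootedProd_eq_mul [Fintype T] (κ φ : ℕ → ℂ) (x : T) (s : Setoid T) :
    rootedProd κ φ x s = φ (size s (Quotient.mk s x)) * rootedProd κ 1 x s := by
  rw [rootedProd, rootedProd, Fintype.prod_eq_mul_prod_compl (Quotient.mk s x),
    Fintype.prod_eq_mul_prod_compl (Quotient.mk s x), if_pos rfl, if_pos rfl, Pi.one_apply, one_mul]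
  congr 1
  refine Finset.prod_congr rfl fun c hc => ?_
  have : c ≠ Quotient.mk s x := by simpa using hc
  rw [if_neg this, if_neg this]

namespace PSFunction.IsMultiplicative

variable {f : PSFunction} (hf : f.IsMultiplicative)
include hf

/-- Any numbering of `B` may be used to evaluate a multiplicative function. -/
theorem onSet_eq {B : Type} [Finite B] (π : Perm B) {N : ℕ} (e : B ≃ Fin N) :
    f.onSet π = f N (PartitionedPerm.top (e.permCongr π)) := by
  obtain rfl : N = Nat.card B := by rw [Nat.card_congr e, Nat.card_fin]
  refine hf.conj _ _ _ (isConj_iff.2 ⟨(Finite.equivFin B).symm.trans e, ?_⟩)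
  ext x
  simp [Perm.mul_apply, Perm.inv_def]

theorem onSet_of_cyc_eq_top {B : Type} [Finite B] {π : Perm B} (h : cyc π = ⊤) (t : B) :
    f.onSet π = firstOrder f (Nat.card B) := by
  have := Fintype.ofFinite B
  obtain ⟨e, -, he⟩ := exists_finRotate_equiv h t rfl (Finite.card_pos_iff.2 ⟨t⟩)
  rw [hf.onSet_eq π e.symm, ← he, firstOrder, gammaOne]
  congr 2
  ext x; simp

theorem onSet_of_cyc_eq_ker {B : Type} [Finite B] {π : Perm B} (p : B → Prop)
    (h : cyc π = Setoid.ker p) (t : B) (ht : p t) :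
    f.onSet π = secondOrder f (Nat.card {x // p x}) (Nat.card {x // ¬ p x}) := by
  have := Fintype.ofFinite B
  obtain ⟨e, -, he⟩ := exists_finRotate_sum_equiv p h t ht (Finite.card_pos_iff.2 ⟨t, ht⟩)
  rw [hf.onSet_eq π (e.symm.trans finSumFinEquiv), ← he, secondOrder, gammaTwo]
  congr 2
  ext x; simp

/-- The value at `(0_π, π)`. -/
theorem apply_cycles {N : ℕ} (p : PartitionedPerm N) (hp : p.part = cyc p.perm) :
    f N p = blockProd (firstOrder f) (cyc p.perm) := by
  rw [hf.prod, ← hp, blockProd]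
  refine Fintype.prod_congr _ _ fun c => ?_
  induction c using Quotient.inductionOn with | _ x =>
  refine hf.onSet_of_cyc_eq_top ?_ ⟨x, rfl⟩
  rw [PartitionedPerm.restrict, cyc_subtypePerm, ← hp]
  exact top_le_iff.1 fun u v _ => Quotient.exact (s := p.part) (u.2.trans v.2.symm)

/-- The value at `(V, π)`, where `V` joins the cycles of `x` and `y`. -/
theorem apply_merge {N : ℕ} (p : PartitionedPerm N) (x y : Fin N) (hxy : ¬ cyc p.perm x y)
    (hp : p.part = merge (cyc p.perm) x y) :
    f N p = secondOrder f (size _ (Quotient.mk (cyc p.perm) x))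
      (size _ (Quotient.mk (cyc p.perm) y)) * pairProd (firstOrder f) x y (cyc p.perm) := by
  set s := cyc p.perm with hs
  have hle : s ≤ p.part := hp ▸ le_merge s x y
  have hrel : ∀ u v, p.part u v ↔ s u v ∨ (s u x ∨ s u y) ∧ (s v x ∨ s v y) := fun u v => by
    rw [hp]; exact merge_iff
  rw [hf.prod, Fintype.prod_eq_mul_prod_compl (Quotient.mk p.part x)]
  congr 1
  · rw [hf.onSet_of_cyc_eq_ker (fun u => s u.1 x) _ ⟨x, rfl⟩ (s.refl' x)]
    · rw [size_mk, size_mk]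
      congr 1
      · refine Nat.card_congr ((Equiv.subtypeSubtypeEquivSubtypeInter
          (fun u => Quotient.mk p.part u = Quotient.mk p.part x) fun u => s u x).trans
          (Equiv.subtypeEquivRight fun u => ?_))
        refine ⟨fun h => h.2, fun h => ⟨Quotient.sound (hle h), h⟩⟩
      · refine Nat.card_congr ((Equiv.subtypeSubtypeEquivSubtypeInter
          (fun u => Quotient.mk p.part u = Quotient.mk p.part x) fun u => ¬ s u x).trans
          (Equiv.subtypeEquivRight fun u => ?_))
        constructor
        · rintro ⟨h1, h2⟩
          rcases (hrel _ _).1 (Quotient.exact h1) with h | ⟨h | h, -⟩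
          · exact absurd h h2
          · exact absurd h h2
          · exact h
        · intro h
          refine ⟨Quotient.sound ((hrel _ _).2 (.inr ⟨.inr h, .inl (s.refl' x)⟩)), fun h2 => ?_⟩
          exact hxy (s.trans' (s.symm' h2) h)
    · rw [PartitionedPerm.restrict, cyc_subtypePerm, ← hs]
      ext ⟨u, hu⟩ ⟨v, hv⟩
      show s u v ↔ (s u x) = (s v x)
      have key : ∀ w, Quotient.mk p.part w = Quotient.mk p.part x → s w x ∨ s w y := fun w hw => by
        rcases (hrel _ _).1 (Quotient.exact hw) with h | ⟨h, -⟩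
        · exact .inl h
        · exact h
      rw [eq_iff_iff]
      constructor
      · exact fun h => ⟨s.trans' (s.symm' h), s.trans' h⟩
      · intro h
        rcases key u hu with h1 | h1
        · exact s.trans' h1 (s.symm' (h.1 h1))
        · rcases key v hv with h2 | h2
          · exact s.trans' (h.2 h2) (s.symm' h2)
          · exact s.trans' h1 (s.symm' h2)
  · rw [pairProd]
    have h1 : (∏ c : Quotient s, if c = Quotient.mk s x ∨ c = Quotient.mk s y then (1 : ℂ) else
        firstOrder f (size s c)) = ∏ c ∈ Finset.univ.filter
          (fun c : Quotient s => ¬ (c = Quotient.mk s x ∨ c = Quotient.mk s y)),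
            firstOrder f (size s c) := by
      rw [Finset.prod_filter]
      refine Fintype.prod_congr _ _ fun c => ?_
      split_ifs <;> simp_all
    rw [h1]
    symm
    refine Finset.prod_bij (fun c _ => Quotient.map id hle c) ?_ ?_ ?_ ?_
    · intro c hc
      induction c using Quotient.inductionOn with | _ u =>
      simp only [Finset.mem_filter, Finset.mem_univ, true_and, not_or] at hc
      simp only [Finset.mem_compl, Finset.mem_singleton]
      intro h
      rcases (hrel _ _).1 (Quotient.exact h) with h | ⟨h | h, -⟩
      · exact hc.1 (Quotient.sound h)
      · exact hc.1 (Quotient.sound h)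
      · exact hc.2 (Quotient.sound h)
    · intro c hc d hd
      induction c using Quotient.inductionOn with | _ u =>
      induction d using Quotient.inductionOn with | _ v =>
      simp only [Finset.mem_filter, Finset.mem_univ, true_and, not_or] at hc
      intro h
      rcases (hrel _ _).1 (Quotient.exact h) with h | ⟨h | h, -⟩
      · exact Quotient.sound h
      · exact absurd (Quotient.sound h) hc.1
      · exact absurd (Quotient.sound h) hc.2
    · intro d hd
      induction d using Quotient.inductionOn with | _ u =>
      refine ⟨Quotient.mk s u, ?_, rfl⟩
      simp only [Finset.mem_compl, Finset.mem_singleton] at hd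
      simp only [Finset.mem_filter, Finset.mem_univ, true_and, not_or]
      constructor
      · exact fun h => hd (Quotient.sound (hle (Quotient.exact h)))
      · exact fun h => hd (Quotient.sound
          ((hrel _ _).2 (.inr ⟨.inr (Quotient.exact h), .inl (s.refl' x)⟩)))
    · intro c hc
      induction c using Quotient.inductionOn with | _ u =>
      simp only [Finset.mem_filter, Finset.mem_univ, true_and, not_or] at hc
      have hiff : ∀ v, p.part v u ↔ s v u := fun v => by
        rw [hrel]
        constructor
        · rintro (h | ⟨-, h | h⟩)
          · exact h
          · exact absurd (Quotient.sound h) hc.1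
          · exact absurd (Quotient.sound h) hc.2
        · exact .inl
      show _ = f.onSet (p.restrict (Quotient.mk p.part u))
      rw [hf.onSet_of_cyc_eq_top _ ⟨u, rfl⟩]
      · refine congrArg _ (Nat.card_congr (Equiv.subtypeEquivRight fun v => ?_))
        rw [Quotient.eq, Quotient.eq]
        exact (hiff v).symm
      · rw [PartitionedPerm.restrict, cyc_subtypePerm, ← hs]
        refine top_le_iff.1 fun v w _ => ?_
        exact s.trans' ((hiff _).1 (Quotient.exact v.2)) (s.symm' ((hiff _).1 (Quotient.exact w.2)))

end PSFunction.IsMultiplicative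

end MultiplicativeFunctions

section Convolution
open scoped Classical

/-! ### The convolution with the Zeta-function -/

/-- The condition for `(V, π) · (0_σ, σ) = (1, γ)` with `σ = π⁻¹ γ`: the join is `1`, and the
lengths add up. The equation of the lengths is written in terms of numbers of blocks. -/
def Factors {N : ℕ} (γ : Perm (Fin N)) (p : PartitionedPerm N) : Prop :=
  p.part ⊔ cyc γ = ⊤ ∧
    N + nb (cyc p.perm) + 2 = 2 * nb p.part + nb (cyc (p.perm⁻¹ * γ)) + nb (cyc γ)

theorem length_eq {N : ℕ} (p : PartitionedPerm N) :
    p.length = N - 2 * nb p.part + nb (cyc p.perm) := by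
  show 2 * ((N : ℤ) - nb p.part) - ((N : ℤ) - nb (cyc p.perm)) = _
  ring

theorem sup_cyc_inv_mul {T : Type} [Finite T] {V : Setoid T} {π : Perm T} (h : cyc π ≤ V)
    (γ : Perm T) : V ⊔ cyc (π⁻¹ * γ) = V ⊔ cyc γ := by
  rw [cyc_le_iff] at h
  apply le_antisymm
  · refine sup_le le_sup_left (cyc_le fun x => ?_)
    have h1 : (V ⊔ cyc γ) (γ x) x := (le_sup_right : cyc γ ≤ V ⊔ cyc γ) (cyc_apply_self γ x)
    have h2 := (le_sup_left : V ≤ V ⊔ cyc γ) (h (π⁻¹ (γ x)))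
    rw [show π (π⁻¹ (γ x)) = γ x by simp] at h2
    exact Setoid.trans' _ (Setoid.symm' _ h2) h1
  · refine sup_le le_sup_left (cyc_le fun x => ?_)
    have h1 : (V ⊔ cyc (π⁻¹ * γ)) (π⁻¹ (γ x)) x :=
      (le_sup_right : cyc (π⁻¹ * γ) ≤ _) (cyc_apply_self (π⁻¹ * γ) x)
    have h2 := (le_sup_left : V ≤ V ⊔ cyc (π⁻¹ * γ)) (h (π⁻¹ (γ x)))
    rw [show π (π⁻¹ (γ x)) = γ x by simp] at h2
    exact Setoid.trans' _ h2 h1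

/-- In a factorization of `(1, γ)` that counts for `f * ζ`, the second factor is determined by the
first. -/
theorem convolution_zeta_top (f : PSFunction) {N : ℕ} (hN : 0 < N) (γ : Perm (Fin N)) :
    convolution f zeta N (PartitionedPerm.top γ) =
      ∑ p : PartitionedPerm N, if Factors γ p then f N p else 0 := by
  have : Nonempty (Fin N) := ⟨⟨0, hN⟩⟩
  rw [convolution, Fintype.sum_prod_type]
  refine Fintype.sum_congr _ _ fun p => ?_
  have hprod : ∀ q : PartitionedPerm N,
      p.product q = (PartitionedPerm.top γ : WithZero (PartitionedPerm N)) ↔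
        p.length + q.length = (p.join q).length ∧ p.join q = PartitionedPerm.top γ := by
    intro q
    rw [PartitionedPerm.product]
    split_ifs with h
    · rw [WithZero.coe_inj]; simp [h]
    · simp [h]
  rw [Fintype.sum_eq_single (⟨cyc (p.perm⁻¹ * γ), p.perm⁻¹ * γ, le_rfl⟩ : PartitionedPerm N)]
  · have hz : zeta N ⟨cyc (p.perm⁻¹ * γ), p.perm⁻¹ * γ, le_rfl⟩ = 1 := if_pos rfl
    rw [hz, mul_one]
    congr 1
    rw [hprod, length_eq, length_eq, length_eq, Factors]
    apply propext
    have hj : p.join ⟨cyc (p.perm⁻¹ * γ), p.perm⁻¹ * γ, le_rfl⟩ = PartitionedPerm.top γ ↔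
        p.part ⊔ cyc γ = ⊤ := by
      rw [PartitionedPerm.ext_iff]
      show p.part ⊔ cyc (p.perm⁻¹ * γ) = ⊤ ∧ p.perm * (p.perm⁻¹ * γ) = γ ↔ _
      rw [sup_cyc_inv_mul p.cycle_le, mul_inv_cancel_left]
      simp
    rw [hj]
    constructor
    · rintro ⟨h1, h2⟩
      refine ⟨h2, ?_⟩
      rw [hj.2 h2] at h1
      have h3 : nb (PartitionedPerm.top γ).part = 1 := nb_top
      have h4 : (PartitionedPerm.top γ).perm = γ := rfl
      rw [h3, h4] at h1
      simp only at h1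
      omega
    · rintro ⟨h1, h2⟩
      refine ⟨?_, h1⟩
      rw [hj.2 h1]
      have h3 : nb (PartitionedPerm.top γ).part = 1 := nb_top
      have h4 : (PartitionedPerm.top γ).perm = γ := rfl
      rw [h3, h4]
      simp only
      omega
  · intro q hq
    split_ifs with h
    · rw [hprod] at h
      have hperm : p.perm * q.perm = γ := congrArg PartitionedPerm.perm h.2
      have hq' : q.perm = p.perm⁻¹ * γ := by rw [← hperm, inv_mul_cancel_left]
      rw [zeta, if_neg, mul_zero]
      intro hz
      refine hq (PartitionedPerm.ext ?_ hq')
      rw [hz, hq']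
      rfl
    · rfl

theorem factors_cycles_iff {N : ℕ} (hN : 0 < N) (γ : Perm (Fin N)) (p : PartitionedPerm N)
    (hp : p.part = cyc p.perm) :
    Factors γ p ↔ orb p.perm γ = ⊤ ∧ IsPlanar γ p.perm := by
  have : Nonempty (Fin N) := ⟨⟨0, hN⟩⟩
  rw [Factors, IsPlanar, hp, orb, Nat.card_fin]
  refine and_congr_right fun h => ?_
  rw [h, nb_top]
  omega

/-- The part of the convolution with `V = 0_π`. -/
theorem sum_cycles {f : PSFunction} (hf : f.IsMultiplicative) {N : ℕ} (hN : 0 < N)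
    (γ : Perm (Fin N)) :
    (∑ p : PartitionedPerm N, if p.part = cyc p.perm ∧ Factors γ p then f N p else 0) =
      planarSum γ (blockProd (firstOrder f)) := by
  rw [planarSum, planarSumOn_eq]
  symm
  refine Fintype.sum_of_injective (fun π => (⟨cyc π, π, le_rfl⟩ : PartitionedPerm N))
    (fun π π' h => congrArg PartitionedPerm.perm h) _ _ ?_ ?_
  · intro p hp
    rw [if_neg]
    rintro ⟨h, -⟩
    exact hp ⟨p.perm, PartitionedPerm.ext h.symm rfl⟩
  · intro π
    have h := factors_cycles_iff hN γ ⟨cyc π, π, le_rfl⟩ rfl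
    simp only [h, true_and]
    congr 1
    exact (hf.apply_cycles ⟨cyc π, π, le_rfl⟩ rfl).symm

/-- For a cyclic `γ`, the genus inequality forces `V = 0_π`, so only noncrossing partitions
contribute. -/
theorem firstOrder_convolution_zeta {f : PSFunction} (hf : f.IsMultiplicative) {n : ℕ}
    (hn : 0 < n) :
    firstOrder (convolution f zeta) n = discSum (firstOrder f) (firstOrder f) n := by
  rw [firstOrder, convolution_zeta_top f hn, discSum, dif_pos hn, planarSum_rooted_self]
  rw [show finRotate n = gammaOne n from rfl, ← sum_cycles hf hn]
  refine Fintype.sum_congr _ _ fun p => ?_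
  have : Nonempty (Fin n) := ⟨⟨0, hn⟩⟩
  congr 1
  apply propext
  refine ⟨fun h => ⟨?_, h⟩, fun h => h.2⟩
  have hc : cyc (gammaOne n) = ⊤ := cyc_finRotate n
  have ho : orb p.perm (gammaOne n) = ⊤ := top_le_iff.1 (hc ▸ le_sup_right)
  have h1 := defect_nonneg _ (gammaOne n) p.perm
  rw [defect, ho, nb_top, Nat.card_fin] at h1
  have h2 := h.2
  exact (eq_of_le_of_nb_le p.cycle_le (show nb (cyc p.perm) ≤ nb p.part by omega)).symm

/-! ### Two blocks joined by the partition -/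

section Joined

variable {N : ℕ} {γ : Perm (Fin N)} {q : Fin N → Prop} (hγ : cyc γ = Setoid.ker q)
include hγ

theorem nb_ker_le : nb (cyc γ) ≤ 2 := by
  rw [hγ]
  have h := Nat.card_le_card_of_injective (β := Prop) (Quotient.lift q fun _ _ h => h)
    (by rintro ⟨x⟩ ⟨y⟩ h; exact Quotient.sound (s := Setoid.ker q) h)
  rwa [show Nat.card Prop = 2 by simp] at h

/-- A factorization with `V ≠ 0_π` has `V` joining one cycle in each of the two cycles of `γ`. -/
theorem factors_join_iff (p : PartitionedPerm N) (hx : ∃ x, q x) (hy : ∃ y, ¬ q y) :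
    (p.part ≠ cyc p.perm ∧ Factors γ p) ↔ (orb p.perm γ = cyc γ ∧ IsPlanar γ p.perm) ∧
      ∃ x y, q x ∧ ¬ q y ∧ p.part = merge (cyc p.perm) x y := by
  have hne : Nonempty (Fin N) := ⟨hx.choose⟩
  have h2 := nb_ker_le hγ
  have h1 := defect_nonneg _ γ p.perm
  rw [defect, Nat.card_fin] at h1
  have ho : nb (orb p.perm γ) ≤ nb (cyc γ) := nb_le_of_le le_sup_right
  constructor
  · rintro ⟨hne, hj, hF⟩
    have h3 : nb p.part < nb (cyc p.perm) := by
      by_contra h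
      exact hne (eq_of_le_of_nb_le p.cycle_le (not_lt.1 h)).symm
    have ho' : orb p.perm γ = cyc γ :=
      (eq_of_le_of_nb_le (t := orb p.perm γ) le_sup_right (by omega)).symm
    have hpl : IsPlanar γ p.perm := by
      rw [IsPlanar, Nat.card_fin]; omega
    refine ⟨⟨ho', hpl⟩, ?_⟩
    have hπ : cyc p.perm ≤ Setoid.ker q := by rw [← hγ, ← ho']; exact le_sup_left
    obtain ⟨x, y, hxy, hqx, hqy⟩ : ∃ x y, p.part x y ∧ q x ∧ ¬ q y := by
      by_contra! hcon
      have hle : p.part ⊔ cyc γ ≤ Setoid.ker q := by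
        refine sup_le (fun u v huv => ?_) hγ.le
        exact propext ⟨hcon u v huv, hcon v u (p.part.symm' huv)⟩
      rw [hj] at hle
      obtain ⟨x, hx⟩ := hx
      obtain ⟨y, hy⟩ := hy
      have : q x = q y := hle trivial
      exact hy (this ▸ hx)
    refine ⟨x, y, hqx, hqy, (eq_of_le_of_nb_le (s := merge (cyc p.perm) x y)
      (merge_le_iff.2 ⟨p.cycle_le, hxy⟩) ?_).symm⟩
    have hnot : ¬ cyc p.perm x y := fun h => by
      have : q x = q y := hπ h
      exact hqy (this ▸ hqx)
    have := nb_merge hnot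
    rw [IsPlanar, Nat.card_fin] at hpl
    omega
  · rintro ⟨⟨ho', hpl⟩, x, y, hqx, hqy, hp⟩
    have hπ : cyc p.perm ≤ Setoid.ker q := by rw [← hγ, ← ho']; exact le_sup_left
    have hnot : ∀ u v, q u → ¬ q v → ¬ cyc p.perm u v := fun u v hu hv h => by
      have : q u = q v := hπ h
      exact hv (this ▸ hu)
    have h3 := nb_merge (hnot x y hqx hqy)
    rw [← hp] at h3
    have h4 : nb (cyc γ) = 2 := by
      have h5 : nb (cyc γ) = nb (merge (cyc γ) x y) + 1 := nb_merge (by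
        rw [hγ]; intro h
        have : q x = q y := h
        exact hqy (this ▸ hqx))
      have h6 : 0 < nb (merge (cyc γ) x y) := Finite.card_pos_iff.2 ⟨Quotient.mk _ x⟩
      omega
    refine ⟨fun h => by rw [h] at h3; omega, ?_, ?_⟩
    · have hxy : (p.part ⊔ cyc γ) x y :=
        (le_sup_left : p.part ≤ _) (by rw [hp]; exact merge_rel _ _ _)
      have hall : ∀ u, (p.part ⊔ cyc γ) u x := fun u => by
        by_cases hu : q u
        · exact (le_sup_right : cyc γ ≤ p.part ⊔ cyc γ)
            (by rw [hγ]; exact propext (iff_of_true hu hqx))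
        · refine Setoid.trans' _ ((le_sup_right : cyc γ ≤ p.part ⊔ cyc γ) (y := y) ?_)
            (Setoid.symm' _ hxy)
          rw [hγ]; exact propext (iff_of_false hu hqy)
      exact top_le_iff.1 fun u v _ => Setoid.trans' _ (hall u) (Setoid.symm' _ (hall v))
    · rw [IsPlanar, Nat.card_fin, ho'] at hpl
      omega

/-- The pairs of points joined by `V` fill the product of the two cycles that are joined. -/
theorem sum_pairs {π : Perm (Fin N)} (ho : orb π γ = cyc γ) (V : Setoid (Fin N))
    (hV : ∃ x y, q x ∧ ¬ q y ∧ V = merge (cyc π) x y) :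
    (∑ x : {x // q x}, ∑ y : {y // ¬ q y}, if V = merge (cyc π) x y then
      ((size _ (Quotient.mk (cyc π) x) : ℂ) * size _ (Quotient.mk (cyc π) y))⁻¹ else 0) = 1 := by
  obtain ⟨x₀, y₀, hx₀, hy₀, rfl⟩ := hV
  have hπ : cyc π ≤ Setoid.ker q := by rw [← hγ, ← ho]; exact le_sup_left
  have hq : ∀ {u v}, cyc π u v → (q u ↔ q v) := fun h => iff_of_eq (hπ h)
  have key : ∀ (x : {x // q x}) (y : {y // ¬ q y}), merge (cyc π) x₀ y₀ = merge (cyc π) x y ↔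
      cyc π x x₀ ∧ cyc π y y₀ := by
    intro x y
    constructor
    · intro h
      have h1 : merge (cyc π) x₀ y₀ x y := by rw [h]; exact merge_rel _ _ _
      rcases merge_iff.1 h1 with h2 | ⟨h2, h3⟩
      · exact absurd ((hq h2).1 x.2) y.2
      · refine ⟨h2.resolve_right fun h => hy₀ ((hq h).1 x.2),
          h3.resolve_left fun h => y.2 ((hq h).2 hx₀)⟩
    · rintro ⟨h1, h2⟩
      apply le_antisymm
      · refine merge_le_iff.2 ⟨le_merge _ _ _, ?_⟩
        exact Setoid.trans' _ (le_merge _ _ _ (Setoid.symm' _ h1))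
          (Setoid.trans' _ (merge_rel _ _ _) (le_merge _ _ _ h2))
      · refine merge_le_iff.2 ⟨le_merge _ _ _, ?_⟩
        exact Setoid.trans' _ (le_merge _ _ _ h1)
          (Setoid.trans' _ (merge_rel _ _ _) (le_merge _ _ _ (Setoid.symm' _ h2)))
  have hpos : ∀ z, ((size _ (Quotient.mk (cyc π) z) : ℕ) : ℂ) ≠ 0 := fun z => by
    rw [Nat.cast_ne_zero, size_mk]
    exact (Finite.card_pos_iff.2 ⟨⟨z, Setoid.refl' _ z⟩⟩).ne'
  have hsum : ∀ (r : Fin N → Prop) [Fintype {x // r x}] (z : Fin N) (hz : r z)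
      (hr : ∀ u, cyc π u z → r u),
      (∑ x : {x // r x}, if cyc π x z then
        ((size _ (Quotient.mk (cyc π) (x : Fin N)) : ℕ) : ℂ)⁻¹ else 0) = 1 := by
    intro r _ z hz hr
    have h1 : ∀ x : {x // r x}, (if cyc π x z then
        ((size _ (Quotient.mk (cyc π) (x : Fin N)) : ℕ) : ℂ)⁻¹ else 0) =
        if cyc π x z then ((size _ (Quotient.mk (cyc π) z) : ℕ) : ℂ)⁻¹ else 0 := fun x => by
      split_ifs with h
      · rw [Quotient.sound h]
      · rfl
    rw [Fintype.sum_congr _ _ h1, ← Finset.sum_filter, Finset.sum_const, nsmul_eq_mul]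
    have h2 : (Finset.univ.filter fun x : {x // r x} => cyc π x z).card =
        size _ (Quotient.mk (cyc π) z) := by
      rw [size_mk, ← Fintype.card_subtype, ← Nat.card_eq_fintype_card]
      refine Nat.card_congr ((Equiv.subtypeSubtypeEquivSubtypeInter r fun u => cyc π u z).trans
        (Equiv.subtypeEquivRight fun u => ⟨fun h => h.2, fun h => ⟨hr u h, h⟩⟩))
    rw [h2, mul_inv_cancel₀ (hpos z)]
  have h1 := hsum q x₀ hx₀ fun u h => (hq h).2 hx₀
  have h2 := hsum (fun y => ¬ q y) y₀ hy₀ fun u h => (not_congr (hq h)).2 hy₀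
  have h3 := congrArg₂ (· * ·) h1 h2
  simp only [Fintype.sum_mul_sum, mul_one] at h3
  rw [← h3]
  refine Fintype.sum_congr _ _ fun x => Fintype.sum_congr _ _ fun y => ?_
  simp only [key, mul_inv, ite_and, ite_mul, mul_ite, zero_mul, mul_zero]
  split_ifs <;> rfl

/-- The part of the convolution with `V ≠ 0_π`, as a sum over pairs of points in the two cycles
that are joined, each pair of cycles being counted with multiplicity one. -/
theorem sum_join {f : PSFunction} (hf : f.IsMultiplicative) (hx : ∃ x, q x) (hy : ∃ y, ¬ q y) :
    (∑ p : PartitionedPerm N, if p.part ≠ cyc p.perm ∧ Factors γ p then f N p else 0) =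
      ∑ x : {x // q x}, ∑ y : {y // ¬ q y}, planarSumOn (cyc γ) γ fun s =>
        secondOrder f (size s (Quotient.mk s x)) (size s (Quotient.mk s y)) *
          ((size s (Quotient.mk s x) : ℂ) * size s (Quotient.mk s y))⁻¹ *
          pairProd (firstOrder f) (x : Fin N) (y : Fin N) s := by
  have h1 : ∀ p : PartitionedPerm N, (if p.part ≠ cyc p.perm ∧ Factors γ p then f N p else 0) =
      ∑ x : {x // q x}, ∑ y : {y // ¬ q y},
        if (orb p.perm γ = cyc γ ∧ IsPlanar γ p.perm) ∧ p.part = merge (cyc p.perm) x y then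
          f N p * ((size _ (Quotient.mk (cyc p.perm) x) : ℂ) *
            size _ (Quotient.mk (cyc p.perm) y))⁻¹ else 0 := by
    intro p
    rw [if_congr (factors_join_iff hγ p hx hy) rfl rfl]
    split_ifs with h
    · obtain ⟨h2, h3⟩ := h
      simp only [h2, and_self, true_and]
      conv_lhs => rw [← mul_one (f N p), ← sum_pairs hγ h2.1 p.part h3, Finset.mul_sum]
      refine Fintype.sum_congr _ _ fun x => ?_
      rw [Finset.mul_sum]
      refine Fintype.sum_congr _ _ fun y => ?_
      rw [mul_ite, mul_zero]
    · symm
      refine Finset.sum_eq_zero fun x _ => Finset.sum_eq_zero fun y _ => if_neg fun h4 => h ?_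
      exact ⟨h4.1, x, y, x.2, y.2, h4.2⟩
  rw [Fintype.sum_congr _ _ h1, Finset.sum_comm]
  refine Fintype.sum_congr _ _ fun x => ?_
  rw [Finset.sum_comm]
  refine Fintype.sum_congr _ _ fun y => ?_
  rw [planarSumOn_eq]
  symm
  refine Fintype.sum_of_injective
    (fun π => (⟨merge (cyc π) x y, π, le_merge _ _ _⟩ : PartitionedPerm N))
    (fun π π' h => congrArg PartitionedPerm.perm h) _ _ ?_ ?_
  · intro p hp
    rw [if_neg]
    rintro ⟨-, h⟩
    exact hp ⟨p.perm, PartitionedPerm.ext h.symm rfl⟩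
  · intro π
    simp only [and_true]
    split_ifs with h
    · rw [hf.apply_merge ⟨merge (cyc π) x y, π, le_merge _ _ _⟩ x y _ rfl]
      · ring
      · intro hxy
        have h2 : cyc γ x y := by rw [← h.1]; exact (le_sup_left : cyc π ≤ orb π γ) hxy
        rw [hγ] at h2
        have : q x = q y := h2
        exact y.2 (this ▸ x.2)
    · rfl

end Joined

/-! ### The convolution at a permutation with two cycles -/

/-- The weight that selects blocks of size `a`: `1` at `a`, and `0` elsewhere. -/
def delta (a k : ℕ) : ℂ := if k = a then 1 else 0

theorem size_comap_equiv_mk {X T : Type} (e : X ≃ T) (s : Setoid T) (x : X) :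
    size (s.comap e) (Quotient.mk _ x) = size s (Quotient.mk s (e x)) :=
  (size_comap_equiv e s _).symm

theorem size_le {T : Type} [Finite T] (s : Setoid T) (c : Quotient s) : size s c ≤ Nat.card T :=
  Finite.card_subtype_le _

/-- The sum over pairs of noncrossing partitions in which the blocks of `i` and `j` have a joint
weight, sorted by the sizes `a` and `b` of these blocks. -/
theorem planarSumOn_pair (κ : ℕ → ℂ) (κ₂ : ℕ → ℕ → ℂ) {m n : ℕ} (i : Fin m) (j : Fin n) :
    planarSumOn (sumSetoid ⊤ ⊤) (Perm.sumCongr (finRotate m) (finRotate n)) (fun s =>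
      κ₂ (size s (Quotient.mk s (.inl i))) (size s (Quotient.mk s (.inr j))) *
          ((size s (Quotient.mk s (.inl i)) : ℂ) * size s (Quotient.mk s (.inr j)))⁻¹ *
          pairProd κ (.inl i) (.inr j) s) =
      ∑ a ∈ Finset.range (m + n + 1), ∑ b ∈ Finset.range (m + n + 1),
        κ₂ a b * ((a : ℂ) * b)⁻¹ * (discSum κ (delta a) m * discSum κ (delta b) n) := by
  have h1 : ∀ a b, discSum κ (delta a) m * discSum κ (delta b) n =
      planarSumOn (sumSetoid ⊤ ⊤) (Perm.sumCongr (finRotate m) (finRotate n)) fun s =>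
        delta a (size s (Quotient.mk s (.inl i))) * delta b (size s (Quotient.mk s (.inr j))) *
          pairProd κ (.inl i) (.inr j) s := by
    intro a b
    rw [planarSumOn_sum _ _ _ (rootedProd κ (delta a) i) (rootedProd κ (delta b) j),
      planarSum_of_cyc_eq_top κ _ (cyc_finRotate m), planarSum_of_cyc_eq_top κ _ (cyc_finRotate n),
      Nat.card_fin, Nat.card_fin]
    intro s t
    have hi : size (sumSetoid s t) (Quotient.mk _ (.inl i)) = size s (Quotient.mk s i) :=
      size_sum_inl s t (Quotient.mk s i)
    have hj : size (sumSetoid s t) (Quotient.mk _ (.inr j)) = size t (Quotient.mk t j) :=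
      size_sum_inr s t (Quotient.mk t j)
    rw [hi, hj, pairProd_sum, rootedProd_eq_mul κ (delta a), rootedProd_eq_mul κ (delta b)]
    ring
  simp only [h1, planarSumOn_eq, Finset.mul_sum]
  rw [Finset.sum_congr rfl fun a _ => Finset.sum_comm, Finset.sum_comm]
  refine Fintype.sum_congr _ _ fun π => ?_
  split_ifs with h
  · set s := cyc π
    set u := size s (Quotient.mk s (.inl i)) with hu
    set v := size s (Quotient.mk s (.inr j)) with hv
    have hu' : u ∈ Finset.range (m + n + 1) := by
      have := size_le s (Quotient.mk s (.inl i))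
      rw [Nat.card_sum, Nat.card_fin, Nat.card_fin] at this
      rw [Finset.mem_range]; omega
    have hv' : v ∈ Finset.range (m + n + 1) := by
      have := size_le s (Quotient.mk s (.inr j))
      rw [Nat.card_sum, Nat.card_fin, Nat.card_fin] at this
      rw [Finset.mem_range]; omega
    rw [Finset.sum_eq_single_of_mem u hu', Finset.sum_eq_single_of_mem v hv']
    · simp only [delta, if_true]; ring
    · intro b _ hb
      simp [delta, hb.symm]
    · intro a _ ha
      refine Finset.sum_eq_zero fun b _ => ?_
      simp [delta, ha.symm]
  · simp

theorem cyc_gammaTwo (m n : ℕ) :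
    cyc (gammaTwo m n) = (sumSetoid ⊤ ⊤).comap (finSumFinEquiv (m := m) (n := n)).symm := by
  rw [gammaTwo, cyc_permCongr, cyc_sumCongr, cyc_finRotate, cyc_finRotate]

theorem cyc_gammaTwo_eq_ker (m n : ℕ) :
    cyc (gammaTwo m n) =
      Setoid.ker fun z => ((finSumFinEquiv (m := m) (n := n)).symm z).isLeft = true := by
  rw [cyc_gammaTwo]
  ext u v
  rw [Setoid.comap_rel, Setoid.ker_def]
  rcases finSumFinEquiv.symm u with x | x <;> rcases finSumFinEquiv.symm v with y | y
  · exact iff_of_true (Sum.LiftRel.inl trivial) rfl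
  · exact iff_of_false (sumSetoid_inl_inr _ _ _ _) (by simp)
  · exact iff_of_false (sumSetoid_inr_inl _ _ _ _) (by simp)
  · exact iff_of_true (Sum.LiftRel.inr trivial) rfl

/-- The enumerations are implicit arguments, so that the lemma applies to the instances that occur
in the sums. -/
theorem sum_sum_eq_natCard_mul {α β : Type} {_ : Fintype α} {_ : Fintype β} (F : α → β → ℂ) (S : ℂ)
    (h : ∀ x y, F x y = S) : ∑ x, ∑ y, F x y = Nat.card α * (Nat.card β * S) := by
  simp [h]

theorem card_isLeft (m n : ℕ) :
    Nat.card {z : Fin (m + n) // (finSumFinEquiv.symm z).isLeft = true} = m := by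
  refine (Nat.card_congr (Equiv.ofBijective
    (fun i : Fin m => ⟨finSumFinEquiv (.inl i), by rw [Equiv.symm_apply_apply]; rfl⟩)
    ⟨fun i i' h => ?_, ?_⟩)).symm.trans (Nat.card_fin m)
  · exact Sum.inl_injective (finSumFinEquiv.injective (congrArg Subtype.val h))
  · rintro ⟨z, hz⟩
    obtain ⟨i | i, rfl⟩ := finSumFinEquiv.surjective z
    · exact ⟨i, rfl⟩
    · rw [Equiv.symm_apply_apply] at hz
      exact absurd hz (by simp)

theorem card_not_isLeft (m n : ℕ) :
    Nat.card {z : Fin (m + n) // ¬ (finSumFinEquiv.symm z).isLeft = true} = n := by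
  refine (Nat.card_congr (Equiv.ofBijective
    (fun i : Fin n => ⟨finSumFinEquiv (.inr i), by rw [Equiv.symm_apply_apply]; simp⟩)
    ⟨fun i i' h => ?_, ?_⟩)).symm.trans (Nat.card_fin n)
  · exact Sum.inr_injective (finSumFinEquiv.injective (congrArg Subtype.val h))
  · rintro ⟨z, hz⟩
    obtain ⟨i | i, rfl⟩ := finSumFinEquiv.surjective z
    · rw [Equiv.symm_apply_apply] at hz
      exact absurd rfl hz
    · exact ⟨i, rfl⟩

/-- The values of the convolution at `(1, γ_{m,n})`. The second summand comes from the partitions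
`V` that join a cycle of length `a` in one of the cycles of `γ_{m,n}` to one of length `b` in the
other. The factor `m n / (a b)` accounts for the choice of a point in each of these cycles. -/
theorem secondOrder_convolution_zeta {f : PSFunction} (hf : f.IsMultiplicative) {m n : ℕ}
    (hm : 0 < m) (hn : 0 < n) :
    secondOrder (convolution f zeta) m n = annularSum (firstOrder f) (firstOrder f) m n +
      m * (n * ∑ a ∈ Finset.range (m + n + 1), ∑ b ∈ Finset.range (m + n + 1),
        secondOrder f a b * ((a : ℂ) * b)⁻¹ *
          (discSum (firstOrder f) (delta a) m * discSum (firstOrder f) (delta b) n)) := by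
  rw [secondOrder, convolution_zeta_top f (by omega)]
  have hsplit : ∀ p : PartitionedPerm (m + n), (if Factors (gammaTwo m n) p then f _ p else 0) =
      (if p.part = cyc p.perm ∧ Factors (gammaTwo m n) p then f _ p else 0) +
        if p.part ≠ cyc p.perm ∧ Factors (gammaTwo m n) p then f _ p else 0 := fun p => by
    by_cases h1 : p.part = cyc p.perm <;> by_cases h2 : Factors (gammaTwo m n) p <;> simp [h1, h2]
  rw [Fintype.sum_congr _ _ hsplit, Finset.sum_add_distrib, sum_cycles hf (by omega),
    sum_join (cyc_gammaTwo_eq_ker m n) hf]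
  · congr 1
    · rw [gammaTwo, ← planarSum_rooted_self _ _ (finSumFinEquiv (.inl ⟨0, hm⟩)),
        planarSum_permCongr_rooted, annularSum, dif_pos hm]
    · have hval : ∀ (x y : Fin (m + n)), (finSumFinEquiv.symm x).isLeft = true →
          ¬ (finSumFinEquiv.symm y).isLeft = true →
          (planarSumOn (cyc (gammaTwo m n)) (gammaTwo m n) fun s =>
            secondOrder f (size s (Quotient.mk s x)) (size s (Quotient.mk s y)) *
              ((size s (Quotient.mk s x) : ℂ) * size s (Quotient.mk s y))⁻¹ *
              pairProd (firstOrder f) x y s) =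
          ∑ a ∈ Finset.range (m + n + 1), ∑ b ∈ Finset.range (m + n + 1),
            secondOrder f a b * ((a : ℂ) * b)⁻¹ *
              (discSum (firstOrder f) (delta a) m * discSum (firstOrder f) (delta b) n) := by
        intro x y hx hy
        rw [cyc_gammaTwo, gammaTwo, planarSumOn_permCongr]
        simp only [size_comap_equiv_mk, pairProd_comap_equiv]
        generalize finSumFinEquiv.symm x = u at hx ⊢
        generalize finSumFinEquiv.symm y = v at hy ⊢
        rcases u with i | i
        · rcases v with j | j
          · exact absurd rfl hy
          · exact planarSumOn_pair _ _ i j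
        · exact absurd hx (by simp)
      generalize (∑ a ∈ Finset.range (m + n + 1), ∑ b ∈ Finset.range (m + n + 1),
        secondOrder f a b * ((a : ℂ) * b)⁻¹ * (discSum (firstOrder f) (delta a) m *
          discSum (firstOrder f) (delta b) n)) = S at hval ⊢
      refine (sum_sum_eq_natCard_mul _ S fun x y => ?_).trans ?_
      · exact hval x.val y.val x.property y.property
      · rw [card_isLeft, card_not_isLeft]
  · exact ⟨finSumFinEquiv (.inl ⟨0, hm⟩), by rw [Equiv.symm_apply_apply]; rfl⟩
  · exact ⟨finSumFinEquiv (.inr ⟨0, hn⟩), by rw [Equiv.symm_apply_apply]; simp⟩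

end Convolution

section PowerSeriesLemmas
open MvPowerSeries

/-! ### Substitution in power series -/

/-- A family of series that reproduces itself up to a factor without constant term vanishes: its
members are divisible by all powers of the factor. -/
theorem eq_zero_of_eq_mul {ι σ : Type*} {a : MvPowerSeries σ ℂ} (ha : constantCoeff a = 0)
    (N : ι → MvPowerSeries σ ℂ) (s : ι → ι) (h : ∀ i, N i = a * N (s i)) (i : ι) : N i = 0 := by
  have hk : ∀ k i, a ^ k ∣ N i := by
    intro k
    induction k with
    | zero => intro i; simp
    | succ k ih =>
      intro i
      rw [h i, pow_succ']
      exact mul_dvd_mul_left a (ih _)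
  ext d
  obtain ⟨G, hG⟩ := hk (d.degree + 1) i
  rw [map_zero]
  refine coeff_of_lt_order ?_
  rw [hG]
  refine lt_of_lt_of_le ?_ (le_trans (le_order_pow_of_constantCoeff_eq_zero (d.degree + 1) ha)
    (le_trans le_self_add (le_order_mul)))
  exact_mod_cast Nat.lt_succ_self _

/-- `inVar` as an algebra homomorphism. -/
noncomputable def inVarHom (i : Fin 2) : PowerSeries ℂ →ₐ[ℂ] Series₂ :=
  PowerSeries.substAlgHom (PowerSeries.HasSubst.X i)

theorem inVar_eq (i : Fin 2) (F : PowerSeries ℂ) : inVar i F = inVarHom i F := by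
  rw [inVar, inVarHom, PowerSeries.coe_substAlgHom]

theorem hasSubst_inVar_xM (M : PowerSeries ℂ) :
    HasSubst fun i : Fin 2 => inVar i (xM M) := by
  refine hasSubst_of_constantCoeff_zero fun i => ?_
  rw [inVar]
  exact PowerSeries.constantCoeff_subst_eq_zero (constantCoeff_X i) _ (by simp [xM])

/-- `substXM` as an algebra homomorphism. -/
noncomputable def substXMHom (M : PowerSeries ℂ) : Series₂ →ₐ[ℂ] Series₂ :=
  substAlgHom (hasSubst_inVar_xM M)

theorem substXM_eq (M : PowerSeries ℂ) (F : Series₂) : substXM M F = substXMHom M F := by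
  rw [substXM, substXMHom, coe_substAlgHom]

theorem inVar_X (i : Fin 2) : inVar i PowerSeries.X = X i :=
  PowerSeries.subst_X (PowerSeries.HasSubst.X i)

theorem inVar_C (i : Fin 2) (c : ℂ) : inVar i (PowerSeries.C c) = C c :=
  PowerSeries.subst_C c

theorem inVar_xM (i : Fin 2) (M : PowerSeries ℂ) : inVar i (xM M) = X i * inVar i M := by
  rw [xM, inVar_eq, map_mul, ← inVar_eq, ← inVar_eq, inVar_X]

theorem hasSubst_xM (M : PowerSeries ℂ) : PowerSeries.HasSubst (xM M) :=
  PowerSeries.HasSubst.of_constantCoeff_zero' (by simp [xM])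

/-- The constant coefficient split off: `F(x) = x F⁺(x) + F(0)`. -/
theorem inVar_eq_X_mul_add (i : Fin 2) (F : PowerSeries ℂ) :
    inVar i F = X i * inVar i (PowerSeries.mk fun p => PowerSeries.coeff (p + 1) F) +
      C (PowerSeries.constantCoeff F) := by
  conv_lhs => rw [PowerSeries.eq_X_mul_shift_add_const F, inVar_eq, map_add, map_mul, ← inVar_eq,
    ← inVar_eq, ← inVar_eq, inVar_X, inVar_C]

theorem constantCoeff_inVar (i : Fin 2) (F : PowerSeries ℂ) :
    constantCoeff (inVar i F) = PowerSeries.constantCoeff F := by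
  rw [inVar_eq_X_mul_add]
  simp

theorem inVar_subst (i : Fin 2) (F G : PowerSeries ℂ) (hG : PowerSeries.HasSubst G) :
    inVar i (F.subst G) = F.subst (inVar i G) :=
  PowerSeries.subst_comp_subst_apply hG (PowerSeries.HasSubst.X i) F

theorem substXM_inVar (M : PowerSeries ℂ) (i : Fin 2) (F : PowerSeries ℂ) :
    substXM M (inVar i F) = inVar i (F.subst (xM M)) := by
  rw [inVar_subst _ _ _ (hasSubst_xM M), substXM, inVar, PowerSeries.subst, PowerSeries.subst,
    subst_comp_subst_apply (PowerSeries.HasSubst.X i).const (hasSubst_inVar_xM M)]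
  congr 1
  funext _
  exact subst_X (hasSubst_inVar_xM M) i

theorem substXM_X (M : PowerSeries ℂ) (i : Fin 2) : substXM M (X i) = inVar i (xM M) :=
  subst_X (hasSubst_inVar_xM M) i

/-- The chain rule for the substitution of `a` in a power series in one variable. -/
theorem pderiv_subst {a : Series₂} (ha : constantCoeff a = 0) (j : Fin 2) (F : PowerSeries ℂ) :
    pderiv ℂ j (F.subst a) = (PowerSeries.derivative ℂ F).subst a * pderiv ℂ j a := by
  have hs : PowerSeries.HasSubst a := PowerSeries.HasSubst.of_constantCoeff_zero ha
  refine sub_eq_zero.1 (eq_zero_of_eq_mul ha (fun F : PowerSeries ℂ =>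
    pderiv ℂ j (F.subst a) - (PowerSeries.derivative ℂ F).subst a * pderiv ℂ j a)
    (fun F => PowerSeries.mk fun p => PowerSeries.coeff (p + 1) F) (fun F => ?_) F)
  generalize hG : (PowerSeries.mk fun p => PowerSeries.coeff (p + 1) F) = G
  have hF : F = PowerSeries.X * G + PowerSeries.C (PowerSeries.constantCoeff F) := by
    rw [← hG]; exact PowerSeries.eq_X_mul_shift_add_const F
  have h1 : F.subst a = a * G.subst a + C (PowerSeries.constantCoeff F) := by
    conv_lhs => rw [hF]
    rw [PowerSeries.subst_add hs, PowerSeries.subst_mul hs, PowerSeries.subst_X hs,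
      PowerSeries.subst_C]
  have h2 : (PowerSeries.derivative ℂ F).subst a =
      a * (PowerSeries.derivative ℂ G).subst a + G.subst a := by
    conv_lhs => rw [hF]
    rw [map_add, PowerSeries.derivative_C, add_zero, Derivation.leibniz, PowerSeries.derivative_X,
      smul_eq_mul, smul_eq_mul, mul_one, PowerSeries.subst_add hs, PowerSeries.subst_mul hs,
      PowerSeries.subst_X hs]
  rw [h1, h2, map_add, pderiv_C, Derivation.leibniz, smul_eq_mul, smul_eq_mul]
  ring

theorem pderiv_inVar_self (i : Fin 2) (F : PowerSeries ℂ) :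
    pderiv ℂ i (inVar i F) = inVar i (PowerSeries.derivative ℂ F) := by
  rw [inVar, pderiv_subst (constantCoeff_X i), pderiv_X_self, mul_one]
  rfl

theorem pderiv_inVar_of_ne {i j : Fin 2} (h : i ≠ j) (F : PowerSeries ℂ) :
    pderiv ℂ j (inVar i F) = 0 := by
  rw [inVar, pderiv_subst (constantCoeff_X i), pderiv_X_of_ne h, mul_zero]

/-! ### Coefficients of series in two variables -/

/-- The exponent of the monomial `xᵐ yⁿ`. -/
noncomputable def expo (m n : ℕ) : Fin 2 →₀ ℕ := Finsupp.single 0 m + Finsupp.single 1 n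

@[simp] theorem expo_zero (m n : ℕ) : expo m n 0 = m := by simp [expo]

@[simp] theorem expo_one (m n : ℕ) : expo m n 1 = n := by simp [expo]

theorem exists_expo (d : Fin 2 →₀ ℕ) : d = expo (d 0) (d 1) := by
  ext i; fin_cases i <;> simp

/-- The coefficient of `xᵐ yⁿ`. -/
noncomputable def co (m n : ℕ) : Series₂ →ₗ[ℂ] ℂ := coeff (expo m n)

theorem ext_co {F G : Series₂} (h : ∀ m n, co m n F = co m n G) : F = G := by
  ext d; rw [exists_expo d]; exact h _ _

theorem expo_eq_iff {m n m' n' : ℕ} : expo m n = expo m' n' ↔ m = m' ∧ n = n' := by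
  refine ⟨fun h => ⟨?_, ?_⟩, by rintro ⟨rfl, rfl⟩; rfl⟩
  · simpa using DFunLike.congr_fun h 0
  · simpa using DFunLike.congr_fun h 1

theorem co_apply (F : Series₂) (m n : ℕ) : co m n F = F (expo m n) := rfl

theorem co_zero_X_mul (F : Series₂) (n : ℕ) : co 0 n (X 0 * F) = 0 := by
  have : ¬ Finsupp.single (0 : Fin 2) 1 ≤ expo 0 n := fun h => by simpa using h 0
  rw [co, X, coeff_monomial_mul, if_neg this]

theorem co_succ_X_mul (F : Series₂) (m n : ℕ) : co (m + 1) n (X 0 * F) = co m n F := by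
  have : expo (m + 1) n = Finsupp.single 0 1 + expo m n := by
    ext i; fin_cases i <;> simp [expo, add_comm]
  rw [co, this, X, coeff_add_monomial_mul, one_mul]; rfl

theorem co_zero_Y_mul (F : Series₂) (m : ℕ) : co m 0 (X 1 * F) = 0 := by
  have : ¬ Finsupp.single (1 : Fin 2) 1 ≤ expo m 0 := fun h => by simpa using h 1
  rw [co, X, coeff_monomial_mul, if_neg this]

theorem co_succ_Y_mul (F : Series₂) (m n : ℕ) : co m (n + 1) (X 1 * F) = co m n F := by
  have : expo m (n + 1) = Finsupp.single 1 1 + expo m n := by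
    ext i; fin_cases i <;> simp [expo, add_comm]
  rw [co, this, X, coeff_add_monomial_mul, one_mul]; rfl

theorem co_C_mul (c : ℂ) (F : Series₂) (m n : ℕ) : co m n (C c * F) = c * co m n F :=
  coeff_C_mul _ _ _

/-- The operator `x ∂/∂x` multiplies the coefficient of `xᵐ yⁿ` by `m`. -/
theorem co_X_mul_pderiv (F : Series₂) (m n : ℕ) : co m n (X 0 * pderiv ℂ 0 F) = m * co m n F := by
  rcases m with _ | m
  · simp [co_zero_X_mul]
  · have : expo m n + Finsupp.single 0 1 = expo (m + 1) n := by
      ext i; fin_cases i <;> simp [expo]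
    rw [co_succ_X_mul, co, coeff_pderiv, this, expo_zero, mul_comm, Nat.cast_succ]
    rfl

/-- The operator `y ∂/∂y` multiplies the coefficient of `xᵐ yⁿ` by `n`. -/
theorem co_Y_mul_pderiv (F : Series₂) (m n : ℕ) : co m n (X 1 * pderiv ℂ 1 F) = n * co m n F := by
  rcases n with _ | n
  · simp [co_zero_Y_mul]
  · have : expo m n + Finsupp.single 1 1 = expo m (n + 1) := by
      ext i; fin_cases i <;> simp [expo]
    rw [co_succ_Y_mul, co, coeff_pderiv, this, expo_one, mul_comm, Nat.cast_succ]
    rfl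

theorem co_inVar_zero_mul (G : PowerSeries ℂ) (F : Series₂) (m n : ℕ) :
    co m n (inVar 0 G * F) =
      ∑ k ∈ Finset.range (m + 1), PowerSeries.coeff k G * co (m - k) n F := by
  induction m generalizing G with
  | zero =>
    rw [inVar_eq_X_mul_add, add_mul, mul_assoc, map_add, co_zero_X_mul, co_C_mul]
    simp
  | succ m ih =>
    rw [inVar_eq_X_mul_add, add_mul, mul_assoc, map_add, co_succ_X_mul, co_C_mul, ih,
      Finset.sum_range_succ' _ (m + 1)]
    simp only [PowerSeries.coeff_mk, Nat.add_sub_add_right, Nat.sub_zero,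
      PowerSeries.coeff_zero_eq_constantCoeff_apply]

theorem co_inVar_zero (G : PowerSeries ℂ) (m n : ℕ) :
    co m n (inVar 0 G) = if n = 0 then PowerSeries.coeff m G else 0 := by
  rw [co, inVar, PowerSeries.coeff_subst_single, expo_zero]
  refine if_congr ?_ rfl rfl
  rw [show Finsupp.single 0 m = expo m 0 by simp [expo], expo_eq_iff]
  simp

theorem co_inVar_one (G : PowerSeries ℂ) (m n : ℕ) :
    co m n (inVar 1 G) = if m = 0 then PowerSeries.coeff n G else 0 := by
  rw [co, inVar, PowerSeries.coeff_subst_single, expo_one]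
  refine if_congr ?_ rfl rfl
  rw [show Finsupp.single 1 n = expo 0 n by simp [expo], expo_eq_iff]
  simp

theorem co_inVar_mul_inVar (G G' : PowerSeries ℂ) (m n : ℕ) :
    co m n (inVar 0 G * inVar 1 G') = PowerSeries.coeff m G * PowerSeries.coeff n G' := by
  rw [co_inVar_zero_mul, Finset.sum_range_succ, Finset.sum_eq_zero, zero_add, co_inVar_one]
  · simp
  · intro k hk
    have := Finset.mem_range.1 hk
    rw [co_inVar_one, if_neg (by omega), mul_zero]

/-- The divided difference `(P(x) - P(y)) / (x - y)`. -/
noncomputable def divDiff (P : PowerSeries ℂ) : Series₂ :=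
  fun d => PowerSeries.coeff (d 0 + d 1 + 1) P

theorem co_divDiff (P : PowerSeries ℂ) (m n : ℕ) :
    co m n (divDiff P) = PowerSeries.coeff (m + n + 1) P := by
  rw [co_apply, divDiff, expo_zero, expo_one]

theorem sub_mul_divDiff (P : PowerSeries ℂ) :
    (X 0 - X 1) * divDiff P = inVar 0 P - inVar 1 P := by
  refine ext_co fun m n => ?_
  rw [sub_mul, map_sub, map_sub, co_inVar_zero, co_inVar_one]
  rcases m with _ | m <;> rcases n with _ | n <;>
    simp only [co_zero_X_mul, co_succ_X_mul, co_zero_Y_mul, co_succ_Y_mul, co_divDiff] <;>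
    simp [add_comm, add_left_comm]

/-- The chain rule for the substitution of `x M(x)` and `y M(y)`. -/
theorem pderiv_substXM (M : PowerSeries ℂ) (j : Fin 2) (F : Series₂) :
    pderiv ℂ j (substXM M F) =
      inVar j (PowerSeries.derivative ℂ (xM M)) * substXM M (pderiv ℂ j F) := by
  have ha : constantCoeff (inVar 0 (xM M)) = 0 := by rw [constantCoeff_inVar]; simp [xM]
  refine sub_eq_zero.1 (eq_zero_of_eq_mul ha (fun F : Series₂ => pderiv ℂ j (substXM M F) -
      inVar j (PowerSeries.derivative ℂ (xM M)) * substXM M (pderiv ℂ j F))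
    (fun F => fun d => F (d + Finsupp.single 0 1)) (fun F => ?_) F)
  obtain ⟨G, hG⟩ : ∃ G : Series₂, (fun d => F (d + Finsupp.single 0 1)) = G := ⟨_, rfl⟩
  rw [hG]
  let g : PowerSeries ℂ := PowerSeries.mk fun n => co 0 n F
  have hF : F = X 0 * G + inVar 1 g := by
    refine ext_co fun m n => ?_
    rw [map_add, co_inVar_one]
    rcases m with _ | m
    · rw [co_zero_X_mul, if_pos rfl, zero_add, PowerSeries.coeff_mk]
    · rw [co_succ_X_mul, if_neg (by omega), add_zero, ← hG]
      refine congrArg F ?_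
      ext i; fin_cases i <;> simp [expo]
  have h1 : substXM M F = inVar 0 (xM M) * substXM M G + inVar 1 (g.subst (xM M)) := by
    rw [hF, substXM_eq, map_add, map_mul, ← substXM_eq, ← substXM_eq, ← substXM_eq, substXM_X,
      substXM_inVar]
  have h2 : substXM M (pderiv ℂ j F) = inVar 0 (xM M) * substXM M (pderiv ℂ j G) +
      substXM M G * substXM M (pderiv ℂ j (X 0)) + substXM M (pderiv ℂ j (inVar 1 g)) := by
    conv_lhs => rw [hF]
    rw [map_add, Derivation.leibniz, smul_eq_mul, smul_eq_mul]
    simp only [substXM_eq, map_add, map_mul]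
    rw [← substXM_eq M (X 0), substXM_X]
  rw [h1, h2, map_add, Derivation.leibniz, smul_eq_mul, smul_eq_mul]
  fin_cases j
  · have e1 : pderiv ℂ (0 : Fin 2) (inVar 1 (g.subst (xM M))) = 0 :=
      pderiv_inVar_of_ne (by decide) _
    have e2 : pderiv ℂ (0 : Fin 2) (inVar 1 g) = 0 := pderiv_inVar_of_ne (by decide) _
    simp only [Fin.zero_eta, e1, e2, pderiv_inVar_self, pderiv_X_self, substXM_eq, map_zero,
      map_one]
    ring
  · have e1 : pderiv ℂ (1 : Fin 2) (inVar 0 (xM M)) = 0 := pderiv_inVar_of_ne (by decide) _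
    have e2 : pderiv ℂ (1 : Fin 2) (X 0 : Series₂) = 0 := pderiv_X_of_ne (by decide)
    simp only [Fin.mk_one, e1, e2, pderiv_inVar_self, substXM_inVar,
      PowerSeries.derivative_subst (hasSubst_xM M)]
    simp only [substXM_eq, inVar_eq, map_zero, map_mul]
    ring

end PowerSeriesLemmas

section GeneratingSeries
open MvPowerSeries

/-! ### Generating series of planar sums -/

/-- The series `1 + ∑ αₙ xⁿ` of the moments of `κ`. -/
noncomputable def momentSeries (κ : ℕ → ℂ) : PowerSeries ℂ := PowerSeries.mk (moment κ)

/-- The series `Φ(z) = ∑_{n ≥ 1} φₙ zⁿ`. -/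
noncomputable def weightSeries (φ : ℕ → ℂ) : PowerSeries ℂ :=
  PowerSeries.mk fun n => if n = 0 then 0 else φ n

/-- The generating series of `discSum κ φ`. -/
noncomputable def discSeries (κ φ : ℕ → ℂ) : PowerSeries ℂ := PowerSeries.mk (discSum κ φ)

/-- The generating series of `annularSum κ φ m n` over `m, n ≥ 1`. -/
noncomputable def annularSeries (κ φ : ℕ → ℂ) : Series₂ :=
  fun d => if d 1 = 0 then 0 else annularSum κ φ (d 0) (d 1)

theorem discSum_zero (κ φ : ℕ → ℂ) : discSum κ φ 0 = 0 := by
  rw [discSum, dif_neg (by omega)]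

theorem annularSum_zero (κ φ : ℕ → ℂ) (n : ℕ) : annularSum κ φ 0 n = 0 := by
  rw [annularSum, dif_neg (by omega)]

theorem co_annularSeries (κ φ : ℕ → ℂ) (m n : ℕ) :
    co m n (annularSeries κ φ) = if n = 0 then 0 else annularSum κ φ m n := by
  rw [co_apply, annularSeries, expo_zero, expo_one]

theorem weightSeries_eq (φ : ℕ → ℂ) :
    weightSeries φ = PowerSeries.X * (PowerSeries.C (φ 1) + weightSeries fun i => φ (i + 1)) := by
  ext (_ | n)
  · simp [weightSeries]
  · rw [PowerSeries.coeff_succ_X_mul, map_add, weightSeries, weightSeries, PowerSeries.coeff_mk,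
      PowerSeries.coeff_mk, PowerSeries.coeff_C]
    rcases n with _ | n <;> simp

/-- The recursion `discSum_succ` in terms of generating series. -/
theorem discSeries_eq_mul (κ φ : ℕ → ℂ) :
    discSeries κ φ = xM (momentSeries κ) *
      (PowerSeries.C (φ 1) + discSeries κ fun i => φ (i + 1)) := by
  ext (_ | m)
  · simp [discSeries, xM, discSum_zero]
  · rw [xM, mul_assoc, PowerSeries.coeff_succ_X_mul, mul_add, map_add, PowerSeries.coeff_mul_C,
      PowerSeries.coeff_mul, Finset.Nat.sum_antidiagonal_eq_sum_range_succ_mk,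
      Finset.sum_range_succ, discSeries, PowerSeries.coeff_mk, discSum_succ]
    simp [momentSeries, discSeries, discSum_zero, Finset.sum_range, mul_comm]

/-- The generating series of `discSum κ φ` is `Φ(x M(x))`. -/
theorem discSeries_eq_subst (κ φ : ℕ → ℂ) :
    discSeries κ φ = (weightSeries φ).subst (xM (momentSeries κ)) := by
  have hs := hasSubst_xM (momentSeries κ)
  refine sub_eq_zero.1 (eq_zero_of_eq_mul (a := xM (momentSeries κ))
    (show PowerSeries.constantCoeff (xM (momentSeries κ)) = 0 by simp [xM])
    (fun φ => discSeries κ φ - (weightSeries φ).subst (xM (momentSeries κ)))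
    (fun φ i => φ (i + 1)) (fun φ => ?_) φ)
  change _ = xM (momentSeries κ) * (_ : PowerSeries ℂ)
  rw [weightSeries_eq φ, discSeries_eq_mul κ φ, PowerSeries.subst_mul hs, PowerSeries.subst_add hs,
    PowerSeries.subst_X hs, PowerSeries.subst_C]
  change _ * (PowerSeries.C _ + _) - _ * (PowerSeries.C _ + _) = _
  ring

theorem momentSeries_eq_add (κ : ℕ → ℂ) : momentSeries κ = 1 + discSeries κ κ := by
  ext (_ | n)
  · simp [momentSeries, discSeries, discSum_zero, moment]
  · simp [momentSeries, discSeries, moment, PowerSeries.coeff_one]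

/-- The recursion `annularSum_succ` in terms of generating series. The last term is
`∑ n Dₘ₊ₙ xᵐ⁺¹ yⁿ`, where `D` is the generating series of the disc sums. -/
theorem annularSeries_eq (κ φ : ℕ → ℂ) :
    annularSeries κ φ = C (φ 1) * (X 0 * annularSeries κ κ) +
      inVar 0 (xM (momentSeries κ)) * annularSeries κ (fun i => φ (i + 1)) +
      X 0 * (inVar 0 (discSeries κ fun i => φ (i + 1)) * annularSeries κ κ) +
      X 0 * (X 1 * pderiv ℂ 1 (X 1 * divDiff (discSeries κ fun i => φ (i + 1)))) := by
  refine ext_co fun m n => ?_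
  rw [inVar_xM, mul_assoc (X 0), map_add, map_add, map_add, co_C_mul]
  rcases m with _ | m
  · simp [co_zero_X_mul, co_annularSeries, annularSum_zero]
  rw [co_succ_X_mul, co_succ_X_mul, co_succ_X_mul, co_succ_X_mul, co_inVar_zero_mul,
    co_inVar_zero_mul, co_Y_mul_pderiv]
  simp only [co_annularSeries]
  rcases n with _ | n
  · simp
  rw [co_succ_Y_mul, co_divDiff, annularSum_succ κ φ m (Nat.succ_pos n), Finset.sum_range_succ,
    Finset.sum_range_succ' (fun k => PowerSeries.coeff k (discSeries _ _) * _)]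
  simp only [Nat.succ_ne_zero, if_false, discSeries, momentSeries, PowerSeries.coeff_mk,
    Nat.sub_self, annularSum_zero, discSum_zero, mul_zero, zero_mul, add_zero,
    Finset.sum_add_distrib, Finset.sum_range]
  have hrev : ∑ k : Fin m, annularSum κ κ k n.succ * discSum κ (fun i => φ (i + 1)) (m - k) =
      ∑ k : Fin m, discSum κ (fun i => φ (i + 1)) (k + 1) *
        annularSum κ κ (m - (k + 1)) n.succ := by
    rw [← Equiv.sum_comp Fin.revPerm]
    refine Finset.sum_congr rfl fun k _ => ?_
    rw [Fin.revPerm_apply, Fin.val_rev, show m - (m - ((k : ℕ) + 1)) = k + 1 by omega, mul_comm]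
  rw [hrev, ← add_assoc]
  rfl

/-- Solution of the recursion for annular sums with an arbitrary weight `Φ` at the root. With
`u = x M(x)` and `v = y M(y)`, the annular series for the weights `κ` and `Φ`, denoted `F` and
`F_Φ`, satisfy `F_Φ = x Φ'(u) F + x y ∂/∂y (y / (x - y) · (Φ'(u) - (Φ(u) - Φ(v)) / (u - v)))`.
This is stated with the denominators cleared: the fraction in the derivative is `y A / B`, and
`dA` and `dB` are the derivatives of `A` and `B` with respect to `y`. Both sides satisfy the same
recursion in `Φ`, so that their difference is divisible by all powers of `u`. -/
theorem annularSeries_solution (κ φ : ℕ → ℂ) :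
    let x : Series₂ := X 0
    let y : Series₂ := X 1
    let u := inVar 0 (xM (momentSeries κ))
    let v := inVar 1 (xM (momentSeries κ))
    let dv := inVar 1 (PowerSeries.derivative ℂ (xM (momentSeries κ)))
    let e := inVar 0 ((PowerSeries.derivative ℂ (weightSeries φ)).subst (xM (momentSeries κ)))
    let A := e * (u - v) - (inVar 0 (discSeries κ φ) - inVar 1 (discSeries κ φ))
    let dA := inVar 1 (PowerSeries.derivative ℂ (discSeries κ φ)) - e * dv
    let B := (x - y) * (u - v)
    let dB := -(u - v) - (x - y) * dv
    B ^ 2 * annularSeries κ φ - B ^ 2 * (x * (e * annularSeries κ κ)) -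
      x * y * ((A + y * dA) * B - y * A * dB) = 0 := by
  intro x y u v dv
  have hu : constantCoeff u = 0 := by rw [constantCoeff_inVar]; simp [xM]
  have hs := hasSubst_xM (momentSeries κ)
  refine eq_zero_of_eq_mul hu (fun φ : ℕ → ℂ =>
    let e := inVar 0 ((PowerSeries.derivative ℂ (weightSeries φ)).subst (xM (momentSeries κ)))
    let A := e * (u - v) - (inVar 0 (discSeries κ φ) - inVar 1 (discSeries κ φ))
    let dA := inVar 1 (PowerSeries.derivative ℂ (discSeries κ φ)) - e * dv
    let B := (x - y) * (u - v)
    let dB := -(u - v) - (x - y) * dv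
    B ^ 2 * annularSeries κ φ - B ^ 2 * (x * (e * annularSeries κ κ)) -
      x * y * ((A + y * dA) * B - y * A * dB)) (fun φ i => φ (i + 1)) (fun φ => ?_) φ
  have hF := annularSeries_eq κ φ
  generalize hψ : (fun i => φ (i + 1)) = ψ at hF ⊢
  have hD := discSeries_eq_mul κ φ
  have hW := weightSeries_eq φ
  rw [hψ] at hD hW
  have he : inVar 0 ((PowerSeries.derivative ℂ (weightSeries φ)).subst (xM (momentSeries κ))) =
      C (φ 1) + inVar 0 (discSeries κ ψ) + u *
        inVar 0 ((PowerSeries.derivative ℂ (weightSeries ψ)).subst (xM (momentSeries κ))) := by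
    rw [hW, Derivation.leibniz, map_add, PowerSeries.derivative_C, PowerSeries.derivative_X,
      smul_eq_mul, smul_eq_mul, mul_one, zero_add, PowerSeries.subst_add hs,
      PowerSeries.subst_mul hs, PowerSeries.subst_add hs, PowerSeries.subst_X hs,
      PowerSeries.subst_C, ← discSeries_eq_subst, inVar_eq, map_add, map_mul, map_add,
      ← inVar_eq, ← inVar_eq, ← inVar_eq, ← inVar_eq, ← inVar_C 0]
    exact add_comm _ _
  have ha : ∀ i, inVar i (discSeries κ φ) =
      inVar i (xM (momentSeries κ)) * (C (φ 1) + inVar i (discSeries κ ψ)) := fun i => by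
    rw [hD, inVar_eq, map_mul, map_add, ← inVar_eq, ← inVar_eq, ← inVar_eq, inVar_C]
  have hb : inVar 1 (PowerSeries.derivative ℂ (discSeries κ φ)) =
      dv * (C (φ 1) + inVar 1 (discSeries κ ψ)) +
        v * inVar 1 (PowerSeries.derivative ℂ (discSeries κ ψ)) := by
    rw [← pderiv_inVar_self, ha, Derivation.leibniz, map_add, pderiv_C, pderiv_inVar_self,
      pderiv_inVar_self, smul_eq_mul, smul_eq_mul]
    ring
  have hE := sub_mul_divDiff (discSeries κ ψ)
  have hEy := congrArg (pderiv ℂ (1 : Fin 2)) hE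
  rw [Derivation.leibniz, map_sub, map_sub, pderiv_X_of_ne (by decide), pderiv_X_self,
    pderiv_inVar_of_ne (by decide), pderiv_inVar_self, smul_eq_mul, smul_eq_mul] at hEy
  rw [Derivation.leibniz, pderiv_X_self, smul_eq_mul, smul_eq_mul] at hF
  simp only [he, ha, hb]
  linear_combination ((x - y) * (u - v)) ^ 2 * hF + (u - v) ^ 2 * x * y * x * hE +
    (u - v) ^ 2 * x * y * y * (x - y) * hEy

theorem constantCoeff_momentSeries (κ : ℕ → ℂ) :
    PowerSeries.constantCoeff (momentSeries κ) = 1 := by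
  rw [momentSeries_eq_add]
  simp [discSeries, discSum_zero]

theorem inVar_ne_zero {M : PowerSeries ℂ} (hM : PowerSeries.constantCoeff M = 1) (i : Fin 2) :
    inVar i M ≠ 0 := fun h => by
  have := constantCoeff_inVar i M
  rw [h, hM, map_zero] at this
  exact zero_ne_one this

theorem derivative_xM (M : PowerSeries ℂ) :
    PowerSeries.derivative ℂ (xM M) = M + PowerSeries.X * PowerSeries.derivative ℂ M := by
  rw [xM, Derivation.leibniz, PowerSeries.derivative_X, smul_eq_mul, smul_eq_mul, mul_one,
    add_comm]

/-- The annular series is `x y (X' Y' / (X - Y)² - 1 / (x - y)²)` with `X = x M(x)` and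
`Y = y M(y)`; here the denominators are cleared. -/
theorem mul_annularSeries_self (κ : ℕ → ℂ) :
    ((X 0 - X 1) * (inVar 0 (xM (momentSeries κ)) - inVar 1 (xM (momentSeries κ)))) ^ 2 *
        annularSeries κ κ =
      X 0 * X 1 * (inVar 0 (PowerSeries.derivative ℂ (xM (momentSeries κ))) *
          inVar 1 (PowerSeries.derivative ℂ (xM (momentSeries κ))) * (X 0 - X 1) ^ 2 -
        (inVar 0 (xM (momentSeries κ)) - inVar 1 (xM (momentSeries κ))) ^ 2) := by
  have hsol := annularSeries_solution κ κ
  have hs := hasSubst_xM (momentSeries κ)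
  have hD : discSeries κ κ = momentSeries κ - 1 := by rw [momentSeries_eq_add]; ring
  have he : inVar 0 ((PowerSeries.derivative ℂ (weightSeries κ)).subst (xM (momentSeries κ))) *
      inVar 0 (PowerSeries.derivative ℂ (xM (momentSeries κ))) =
        inVar 0 (PowerSeries.derivative ℂ (momentSeries κ)) := by
    rw [inVar_eq, inVar_eq, ← map_mul, ← PowerSeries.derivative_subst hs, ← discSeries_eq_subst, hD,
      map_sub, PowerSeries.derivative_one, sub_zero, ← inVar_eq]
  have h0 := inVar_ne_zero (constantCoeff_momentSeries κ) 0
  have hX : ∀ i, inVar i (PowerSeries.derivative ℂ (xM (momentSeries κ))) =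
      inVar i (momentSeries κ) + X i * inVar i (PowerSeries.derivative ℂ (momentSeries κ)) :=
    fun i => by
      rw [derivative_xM, inVar_eq, map_add, map_mul, ← inVar_eq, ← inVar_eq, ← inVar_eq, inVar_X]
  have hDi : ∀ i, inVar i (discSeries κ κ) = inVar i (momentSeries κ) - 1 := fun i => by
    rw [hD, inVar_eq, map_sub, map_one, ← inVar_eq]
  have hDd : PowerSeries.derivative ℂ (discSeries κ κ) =
      PowerSeries.derivative ℂ (momentSeries κ) := by
    rw [hD, map_sub, PowerSeries.derivative_one, sub_zero]
  simp only [hDi, hDd, hX, inVar_xM] at hsol he ⊢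
  generalize annularSeries κ κ = F at *
  generalize inVar 0 ((PowerSeries.derivative ℂ (weightSeries κ)).subst (xM (momentSeries κ))) = e
    at *
  generalize inVar 0 (momentSeries κ) = m at *
  generalize inVar 1 (momentSeries κ) = n at *
  generalize inVar 0 (PowerSeries.derivative ℂ (momentSeries κ)) = m' at *
  generalize inVar 1 (PowerSeries.derivative ℂ (momentSeries κ)) = n' at *
  generalize (X 0 : Series₂) = x at *
  generalize (X 1 : Series₂) = y at *
  refine mul_left_cancel₀ h0 ?_
  -- Multiply the solution by `(x M(x))'` and use `C'(x M(x)) (x M(x))' = M'(x)`.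
  linear_combination (m + x * m') * hsol - (-((x - y) * (x * m - y * n)) ^ 2 * x * F -
    x * y * (((x * m - y * n) - y * (n + y * n')) * ((x - y) * (x * m - y * n)) -
      y * (x * m - y * n) * (-(x * m - y * n) - (x - y) * (n + y * n')))) * he

end GeneratingSeries

section FunctionalEquations
open MvPowerSeries

/-! ### Functional equations of the convolution -/

theorem series₁_eq_one_add (κ : ℕ → ℂ) : series₁ κ = 1 + weightSeries κ := by
  ext (_ | n) <;> simp [series₁, weightSeries, PowerSeries.coeff_one]

theorem series₁_firstOrder_convolution_zeta {f : PSFunction} (hf : f.IsMultiplicative) :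
    series₁ (firstOrder (convolution f zeta)) = momentSeries (firstOrder f) := by
  ext n
  rw [series₁, momentSeries, PowerSeries.coeff_mk, PowerSeries.coeff_mk, moment]
  split_ifs with h
  · rfl
  · exact firstOrder_convolution_zeta hf (Nat.pos_of_ne_zero h)

/-- The relation `C(x M(x)) = M(x)`. -/
theorem series₁_subst (κ : ℕ → ℂ) :
    (series₁ κ).subst (xM (momentSeries κ)) = momentSeries κ := by
  have hs := hasSubst_xM (momentSeries κ)
  rw [series₁_eq_one_add, PowerSeries.subst_add hs, ← discSeries_eq_subst, ← map_one PowerSeries.C,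
    PowerSeries.subst_C, map_one]
  exact (momentSeries_eq_add κ).symm

/-- The noncrossing partitions whose root lies in a block of size `a` are counted by the powers of
`x M(x)`. -/
theorem discSum_delta (κ : ℕ → ℂ) {a : ℕ} (ha : 0 < a) (n : ℕ) :
    discSum κ (delta a) n = PowerSeries.coeff n (xM (momentSeries κ) ^ a) := by
  have hW : weightSeries (delta a) = PowerSeries.X ^ a := by
    ext k
    rw [weightSeries, PowerSeries.coeff_mk, PowerSeries.coeff_X_pow, delta]
    split_ifs <;> first | rfl | omega
  have hs := hasSubst_xM (momentSeries κ)
  have h := congrArg (PowerSeries.coeff n) (discSeries_eq_subst κ (delta a))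
  rwa [hW, PowerSeries.subst_pow hs, PowerSeries.subst_X hs, discSeries, PowerSeries.coeff_mk] at h

theorem coeff_xM_pow_of_lt (M : PowerSeries ℂ) {a n : ℕ} (h : n < a) :
    PowerSeries.coeff n (xM M ^ a) = 0 := by
  rw [xM, mul_pow, PowerSeries.coeff_X_pow_mul', if_neg (by omega)]

/-- The coefficients of `F(x M(x), y M(y))` as finite sums: `(x M(x))ᵃ` is divisible by `xᵃ`. -/
theorem co_substXM (M : PowerSeries ℂ) (F : Series₂) {m n N : ℕ} (hm : m < N) (hn : n < N) :
    co m n (substXM M F) = ∑ a ∈ Finset.range N, ∑ b ∈ Finset.range N,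
      co a b F * (PowerSeries.coeff m (xM M ^ a) * PowerSeries.coeff n (xM M ^ b)) := by
  have hprod : ∀ a b, co m n ((expo a b).prod fun s k => inVar s (xM M) ^ k) =
      PowerSeries.coeff m (xM M ^ a) * PowerSeries.coeff n (xM M ^ b) := by
    intro a b
    rw [Finsupp.prod_fintype _ _ fun _ => pow_zero _, Fin.prod_univ_two, expo_zero, expo_one,
      inVar_eq, inVar_eq, ← map_pow, ← map_pow, ← inVar_eq, ← inVar_eq, co_inVar_mul_inVar]
  have hinj : Function.Injective fun p : ℕ × ℕ => expo p.1 p.2 :=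
    fun p q h => Prod.ext (expo_eq_iff.1 h).1 (expo_eq_iff.1 h).2
  rw [co, substXM, coeff_subst (hasSubst_inVar_xM M),
    finsum_eq_sum_of_support_subset (s := (Finset.range N ×ˢ Finset.range N).image
      fun p : ℕ × ℕ => expo p.1 p.2), Finset.sum_image hinj.injOn, Finset.sum_product]
  · exact Finset.sum_congr rfl fun a _ => Finset.sum_congr rfl fun b _ =>
      congrArg (co a b F * ·) (hprod a b)
  · intro d hd
    rw [Function.mem_support, exists_expo d] at hd
    have h : co m n ((expo (d 0) (d 1)).prod fun s k => inVar s (xM M) ^ k) ≠ 0 :=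
      right_ne_zero_of_smul hd
    rw [hprod] at h
    refine Finset.mem_coe.2 (Finset.mem_image.2 ⟨(d 0, d 1), ?_, (exists_expo d).symm⟩)
    rw [Finset.mem_product, Finset.mem_range, Finset.mem_range]
    constructor
    · by_contra hlt
      exact left_ne_zero_of_mul h (coeff_xM_pow_of_lt M (show m < d 0 by omega))
    · by_contra hlt
      exact right_ne_zero_of_mul h (coeff_xM_pow_of_lt M (show n < d 1 by omega))

theorem inVar_xM_mul_inv {M : PowerSeries ℂ} (hM : PowerSeries.constantCoeff M = 1) (i : Fin 2) :
    inVar i (xM M) * (inVar i M)⁻¹ = X i := by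
  rw [inVar_xM, mul_assoc, MvPowerSeries.mul_inv_cancel _ (by rw [constantCoeff_inVar, hM]; simp),
    mul_one]

/-- The substitution of `x M(x)` and `y M(y)` intertwines `xy ∂²/∂x∂y` up to `derivFactor`. -/
theorem substXM_mul_derivFactor {M : PowerSeries ℂ} (hM : PowerSeries.constantCoeff M = 1)
    (G : Series₂) :
    substXM M (X 0 * X 1 * pderiv ℂ 0 (pderiv ℂ 1 G)) * derivFactor M =
      X 0 * pderiv ℂ 0 (X 1 * pderiv ℂ 1 (substXM M G)) := by
  rw [Derivation.leibniz, pderiv_X_of_ne (by decide), smul_zero, add_zero, smul_eq_mul,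
    pderiv_substXM, Derivation.leibniz, pderiv_inVar_of_ne (by decide), smul_zero, add_zero,
    smul_eq_mul, pderiv_substXM, derivFactor, substXM_eq, map_mul, map_mul, ← substXM_eq,
    ← substXM_eq, ← substXM_eq, substXM_X, substXM_X]
  have h0 := inVar_xM_mul_inv hM 0
  have h1 := inVar_xM_mul_inv hM 1
  rw [← h0, ← h1]
  ring

/-- The second order moment series. In the sum over the joined cycles, of lengths `a` and `b`, the
factor `m n / (a b)` is produced by `xy ∂²/∂x∂y`, applied to the series with the coefficients
`κ_{a,b} / (a b)`. -/
theorem series₂_secondOrder_convolution_zeta {f : PSFunction} (hf : f.IsMultiplicative) :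
    series₂ (secondOrder (convolution f zeta)) =
      substXM (momentSeries (firstOrder f)) (series₂ (secondOrder f)) *
        derivFactor (momentSeries (firstOrder f)) +
      annularSeries (firstOrder f) (firstOrder f) := by
  set κ := firstOrder f
  -- The inverse makes the coefficients with `a = 0` or `b = 0` vanish.
  let G : Series₂ := fun d => secondOrder f (d 0) (d 1) * ((d 0 : ℂ) * d 1)⁻¹
  have hco : ∀ a b, co a b G = secondOrder f a b * ((a : ℂ) * b)⁻¹ := fun a b => by
    rw [co_apply]
    change secondOrder f (expo a b 0) (expo a b 1) * (((expo a b 0 : ℕ) : ℂ) * (expo a b 1 : ℕ))⁻¹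
      = _
    rw [expo_zero, expo_one]
  have hG : series₂ (secondOrder f) = X 0 * X 1 * pderiv ℂ 0 (pderiv ℂ 1 G) := by
    have : (X 0 * X 1 * pderiv ℂ 0 (pderiv ℂ 1 G) : Series₂) =
        X 0 * pderiv ℂ 0 (X 1 * pderiv ℂ 1 G) := by
      rw [Derivation.leibniz, pderiv_X_of_ne (by decide), smul_zero, add_zero, smul_eq_mul,
        mul_assoc]
    rw [this]
    refine ext_co fun a b => ?_
    rw [co_X_mul_pderiv, co_Y_mul_pderiv, hco, co_apply, series₂, expo_zero, expo_one]
    split_ifs with h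
    · have ha : (a : ℂ) ≠ 0 := Nat.cast_ne_zero.2 (by omega)
      have hb : (b : ℂ) ≠ 0 := Nat.cast_ne_zero.2 (by omega)
      field_simp
    · have : a = 0 ∨ b = 0 := by omega
      rcases this with rfl | rfl <;> simp
  rw [hG, substXM_mul_derivFactor (constantCoeff_momentSeries κ)]
  refine ext_co fun m n => ?_
  rw [map_add, co_X_mul_pderiv, co_Y_mul_pderiv, co_annularSeries, co_apply, series₂, expo_zero,
    expo_one]
  split_ifs with h hn hn
  · omega
  · rw [secondOrder_convolution_zeta hf h.1 h.2, add_comm,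
      co_substXM _ _ (show m < m + n + 1 by omega) (show n < m + n + 1 by omega)]
    congr 3
    refine Finset.sum_congr rfl fun a _ => Finset.sum_congr rfl fun b _ => ?_
    rw [hco]
    rcases Nat.eq_zero_or_pos a with rfl | ha
    · simp
    rcases Nat.eq_zero_or_pos b with rfl | hb
    · simp
    rw [discSum_delta κ ha, discSum_delta κ hb]
  · simp [hn]
  · have : m = 0 := by omega
    simp [this, annularSum_zero]

/-! ### The logarithmic term -/

/-- The defining equation of the logarithm, differentiated. -/
theorem mul_pderiv_logSeries₂ {K : Series₂} (hK : constantCoeff K = 1) (j : Fin 2) :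
    K * pderiv ℂ j (logSeries₂ K) = pderiv ℂ j K := by
  have h0 : constantCoeff (K - 1) = 0 := by rw [map_sub, hK, map_one, sub_self]
  have hs : PowerSeries.HasSubst (K - 1) := PowerSeries.HasSubst.of_constantCoeff_zero h0
  have h1 : (1 + PowerSeries.X : PowerSeries ℂ) * PowerSeries.derivative ℂ (PowerSeries.log ℂ) =
      PowerSeries.C 1 := by
    rw [PowerSeries.deriv_log]
    ext (_ | n)
    · simp [add_mul]
    · simp [add_mul, PowerSeries.coeff_succ_X_mul, pow_succ, PowerSeries.coeff_one]
  have h2 := congrArg (PowerSeries.subst (K - 1)) h1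
  rw [PowerSeries.subst_mul hs, PowerSeries.subst_add hs, PowerSeries.subst_X hs,
    ← map_one PowerSeries.C, PowerSeries.subst_C, map_one, add_sub_cancel] at h2
  rw [logSeries₂, pderiv_subst h0, ← mul_assoc, h2, one_mul, map_sub, pderiv_one, sub_zero]

theorem sq_mul_pderiv_pderiv_logSeries₂ {K : Series₂} (hK : constantCoeff K = 1) :
    K ^ 2 * pderiv ℂ 0 (pderiv ℂ 1 (logSeries₂ K)) =
      K * pderiv ℂ 0 (pderiv ℂ 1 K) - pderiv ℂ 0 K * pderiv ℂ 1 K := by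
  have h1 := mul_pderiv_logSeries₂ hK 1
  have h0 := mul_pderiv_logSeries₂ hK 0
  have h2 := congrArg (pderiv ℂ (0 : Fin 2)) h1
  rw [Derivation.leibniz, smul_eq_mul, smul_eq_mul] at h2
  linear_combination K * h2 - pderiv ℂ 0 K * h1

/-- The series `(x C(y) - y C(x)) / (x - y)`. -/
noncomputable def kernelSeries (C : PowerSeries ℂ) : Series₂ := inVar 0 C - X 0 * divDiff C

theorem sub_mul_kernelSeries (C : PowerSeries ℂ) :
    (X 0 - X 1) * kernelSeries C = X 0 * inVar 1 C - X 1 * inVar 0 C := by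
  rw [kernelSeries]
  linear_combination -X 0 * sub_mul_divDiff C

theorem constantCoeff_kernelSeries {C : PowerSeries ℂ} (hC : PowerSeries.constantCoeff C = 1) :
    constantCoeff (kernelSeries C) = 1 := by
  rw [kernelSeries, map_sub, constantCoeff_inVar, hC, map_mul, constantCoeff_X, zero_mul, sub_zero]

theorem constantCoeff_substXM (M : PowerSeries ℂ) {F : Series₂} (hF : constantCoeff F = 1) :
    constantCoeff (substXM M F) = 1 := by
  have h : substXM M F = substXM M (F - 1) + 1 := by
    rw [substXM_eq, substXM_eq, map_sub, map_one, sub_add_cancel]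
  have h0 : constantCoeff (substXM M (F - 1)) = 0 :=
    constantCoeff_subst_eq_zero (hasSubst_inVar_xM M)
      (fun i => by rw [constantCoeff_inVar]; simp [xM]) (by simp [hF])
  rw [h, map_add, h0, map_one, zero_add]

theorem X_sub_X_ne_zero : (X 0 - X 1 : Series₂) ≠ 0 := fun h => by
  have := congrArg (pderiv ℂ (0 : Fin 2)) h
  rw [map_sub, pderiv_X_self, pderiv_X_of_ne (by decide), map_zero, sub_zero] at this
  exact one_ne_zero this

/-- `(X - Y) K(X, Y) = M(x) M(y) (x - y)` for `K = (x C(y) - y C(x)) / (x - y)`, since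
`C(x M(x)) = M(x)`. -/
theorem mul_inVar_xM_sub {κ : ℕ → ℂ} :
    (inVar 0 (xM (momentSeries κ)) - inVar 1 (xM (momentSeries κ))) *
      substXM (momentSeries κ) (kernelSeries (series₁ κ)) =
    inVar 0 (momentSeries κ) * inVar 1 (momentSeries κ) * (X 0 - X 1) := by
  have h := congrArg (substXM (momentSeries κ)) (sub_mul_kernelSeries (series₁ κ))
  simp only [substXM_eq, map_mul, map_sub] at h
  simp only [← substXM_eq, substXM_X, substXM_inVar, series₁_subst] at h
  rw [h, inVar_xM, inVar_xM]
  ring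

theorem inVar_xM_sub_ne_zero (κ : ℕ → ℂ) :
    inVar 0 (xM (momentSeries κ)) - inVar 1 (xM (momentSeries κ)) ≠ 0 := by
  have hM := constantCoeff_momentSeries κ
  have h : inVar 0 (momentSeries κ) * inVar 1 (momentSeries κ) * (X 0 - X 1) ≠ 0 :=
    mul_ne_zero (mul_ne_zero (inVar_ne_zero hM 0) (inVar_ne_zero hM 1)) X_sub_X_ne_zero
  rw [← mul_inVar_xM_sub] at h
  exact left_ne_zero_of_mul h

/-- The logarithmic term of `H` is the annular series. The derivatives of `log K` at `(X, Y)` are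
computed from those of `(x - y) K = x C(y) - y C(x)` and from `C'(X) X' = M'(x)`. -/
theorem substXM_log_mul_derivFactor (κ : ℕ → ℂ) :
    substXM (momentSeries κ) (X 0 * X 1 *
        pderiv ℂ 0 (pderiv ℂ 1 (logSeries₂ (kernelSeries (series₁ κ))))) *
      derivFactor (momentSeries κ) = -annularSeries κ κ := by
  have hM := constantCoeff_momentSeries κ
  have hC : PowerSeries.constantCoeff (series₁ κ) = 1 := by simp [series₁]
  have hK := constantCoeff_kernelSeries hC
  have hs := hasSubst_xM (momentSeries κ)
  have hk0 : substXM (momentSeries κ) (kernelSeries (series₁ κ)) ≠ 0 := fun h => by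
    have := constantCoeff_substXM (momentSeries κ) hK
    rw [h, map_zero] at this
    exact zero_ne_one this
  have hz0 := inVar_xM_sub_ne_zero κ
  have hk := mul_inVar_xM_sub (κ := κ)
  have hF := mul_annularSeries_self κ
  have hl := congrArg (substXM (momentSeries κ)) (sq_mul_pderiv_pderiv_logSeries₂ hK)
  have hI0 := inVar_xM_mul_inv hM 0
  have hI1 := inVar_xM_mul_inv hM 1
  -- The first and the mixed derivatives of `(x - y) K = x C(y) - y C(x)`.
  have hx := congrArg (pderiv ℂ (0 : Fin 2)) (sub_mul_kernelSeries (series₁ κ))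
  have hy := congrArg (pderiv ℂ (1 : Fin 2)) (sub_mul_kernelSeries (series₁ κ))
  simp only [Derivation.leibniz, map_sub, smul_eq_mul, pderiv_X_self,
    pderiv_X_of_ne (show (1 : Fin 2) ≠ 0 by decide),
    pderiv_X_of_ne (show (0 : Fin 2) ≠ 1 by decide),
    pderiv_inVar_self, pderiv_inVar_of_ne (show (1 : Fin 2) ≠ 0 by decide),
    pderiv_inVar_of_ne (show (0 : Fin 2) ≠ 1 by decide)] at hx hy
  have hxy := congrArg (pderiv ℂ (0 : Fin 2)) hy
  simp only [Derivation.leibniz, map_sub, map_add, smul_eq_mul, pderiv_X_self, map_zero, pderiv_one,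
    pderiv_X_of_ne (show (1 : Fin 2) ≠ 0 by decide), pderiv_inVar_self,
    pderiv_inVar_of_ne (show (1 : Fin 2) ≠ 0 by decide)] at hxy
  replace hx := congrArg (substXM (momentSeries κ)) hx
  replace hy := congrArg (substXM (momentSeries κ)) hy
  replace hxy := congrArg (substXM (momentSeries κ)) hxy
  simp only [substXM_eq, map_mul, map_sub, map_add, map_zero, map_one, map_pow] at hx hy hxy hl ⊢
  simp only [← substXM_eq, substXM_X, substXM_inVar, series₁_subst] at hx hy hxy hl ⊢
  have hc : ∀ i, inVar i ((PowerSeries.derivative ℂ (series₁ κ)).subst (xM (momentSeries κ))) *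
      inVar i (PowerSeries.derivative ℂ (xM (momentSeries κ))) =
        inVar i (PowerSeries.derivative ℂ (momentSeries κ)) := fun i => by
    rw [inVar_eq, inVar_eq, ← map_mul, ← PowerSeries.derivative_subst hs, series₁_subst, inVar_eq]
  have hc0 := hc 0
  have hc1 := hc 1
  have hX : ∀ i, inVar i (PowerSeries.derivative ℂ (xM (momentSeries κ))) =
      inVar i (momentSeries κ) + X i * inVar i (PowerSeries.derivative ℂ (momentSeries κ)) :=
    fun i => by
      rw [derivative_xM, inVar_eq, map_add, map_mul, ← inVar_eq, ← inVar_eq, ← inVar_eq, inVar_X]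
  have hxy0 := X_sub_X_ne_zero
  rw [derivFactor]
  clear hc hK hC hs
  simp only [hX, inVar_xM] at *
  generalize (inVar 0 (momentSeries κ))⁻¹ = mi at *
  generalize (inVar 1 (momentSeries κ))⁻¹ = ni at *
  generalize annularSeries κ κ = F at *
  generalize inVar 0 ((PowerSeries.derivative ℂ (series₁ κ)).subst (xM (momentSeries κ))) = c at *
  generalize inVar 1 ((PowerSeries.derivative ℂ (series₁ κ)).subst (xM (momentSeries κ))) = d at *
  generalize substXM (momentSeries κ) (pderiv ℂ 0 (pderiv ℂ 1
    (logSeries₂ (kernelSeries (series₁ κ))))) = l at *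
  generalize substXM (momentSeries κ) (pderiv ℂ 0 (pderiv ℂ 1 (kernelSeries (series₁ κ)))) = kxy
    at *
  generalize substXM (momentSeries κ) (pderiv ℂ 0 (kernelSeries (series₁ κ))) = kx at *
  generalize substXM (momentSeries κ) (pderiv ℂ 1 (kernelSeries (series₁ κ))) = ky at *
  generalize substXM (momentSeries κ) (kernelSeries (series₁ κ)) = k at *
  generalize inVar 0 (momentSeries κ) = m at *
  generalize inVar 1 (momentSeries κ) = n at *
  generalize inVar 0 (PowerSeries.derivative ℂ (momentSeries κ)) = m' at *
  generalize inVar 1 (PowerSeries.derivative ℂ (momentSeries κ)) = n' at *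
  generalize (X 0 : Series₂) = x at *
  generalize (X 1 : Series₂) = y at *
  obtain ⟨X', hX'⟩ : ∃ X', X' = m + x * m' := ⟨_, rfl⟩
  obtain ⟨Y', hY'⟩ : ∃ Y', Y' = n + y * n' := ⟨_, rfl⟩
  obtain ⟨z, hz⟩ : ∃ z, z = x * m - y * n := ⟨_, rfl⟩
  rw [← hX'] at hc0 hF ⊢
  rw [← hY'] at hc1 hF ⊢
  rw [← hz] at hz0 hk hF hx hy hxy
  -- `z² K_x(X, Y) X'`, `z² K_y(X, Y) Y'` and `z³ K_xy(X, Y) X' Y'`, for `z = X - Y`, are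
  -- polynomials in `x`, `y`, `M(x)`, `M(y)` and the derivatives of `M`.
  have h1 : z ^ 2 * kx * X' = (y * n * m - y * n * n) * X' - y * n * z * m' := by
    linear_combination z * X' * hx - X' * hk - y * n * z * hc0 + X' * n * hz
  have h2 : z ^ 2 * ky * Y' = (x * m * n - x * m * m) * Y' + x * m * z * n' := by
    linear_combination z * Y' * hy + Y' * hk + x * m * z * hc1 - Y' * m * hz
  have h3 : z ^ 3 * kxy * (X' * Y') = z ^ 2 * (n' * X' - m' * Y') - (z ^ 2 * ky * Y') * X' +
      (z ^ 2 * kx * X') * Y' := by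
    linear_combination z ^ 2 * X' * Y' * hxy + z ^ 2 * X' * hc1 - z ^ 2 * Y' * hc0
  have h4 : z ^ 4 * (k ^ 2 * l) * (X' * Y') = -(m * n) ^ 2 * (X' * Y' * (x - y) ^ 2 - z ^ 2) := by
    have : z ^ 4 * (k ^ 2 * l) * (X' * Y') =
        (z * k) * (z ^ 3 * kxy * (X' * Y')) - (z ^ 2 * kx * X') * (z ^ 2 * ky * Y') := by
      linear_combination z ^ 4 * X' * Y' * hl
    rw [this, hk, h3, h1, h2, hX', hY', hz]
    ring
  have h5 : x * m * (y * n) * l * (X' * mi * (Y' * ni)) = x * y * X' * Y' * l := by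
    linear_combination (y * n) * ni * X' * Y' * l * hI0 + x * X' * Y' * l * hI1
  rw [h5]
  refine mul_left_cancel₀
    (mul_ne_zero (pow_ne_zero 2 (mul_ne_zero hk0 hxy0)) (pow_ne_zero 4 hz0)) ?_
  linear_combination (x - y) ^ 2 * x * y * h4 + k ^ 2 * z ^ 2 * hF +
    x * y * (X' * Y' * (x - y) ^ 2 - z ^ 2) * (z * k + m * n * (x - y)) * hk

theorem toFrac_ne_zero {F : Series₂} (hF : F ≠ 0) : toFrac F ≠ 0 := fun h =>
  hF (IsFractionRing.injective Series₂ FracSeries₂ (h.trans (map_zero toFrac).symm))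

theorem toFrac_annularSeries (κ : ℕ → ℂ) :
    toFrac (annularSeries κ κ) = correctionTerm (momentSeries κ) := by
  have hF := congrArg toFrac (mul_annularSeries_self κ)
  have h1 := toFrac_ne_zero X_sub_X_ne_zero
  have h2 := toFrac_ne_zero (inVar_xM_sub_ne_zero κ)
  rw [correctionTerm]
  rw [map_mul, map_pow, map_mul, map_mul toFrac (X 0 * X 1), map_sub toFrac (_ * _), map_pow,
    map_mul toFrac _ (_ ^ 2), map_pow] at hF
  field_simp
  linear_combination hF

end FunctionalEquations

end SecondOrderRTransform

open SecondOrderRTransform in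
theorem mainTheorem1 (f h : PSFunction) (hf : f.IsMultiplicative) (hh : h.IsMultiplicative)
    (hconv : h = convolution f zeta)
    (C M : PowerSeries ℂ) (C₂ M₂ : Series₂)
    (hC : C = series₁ (firstOrder f)) (hC₂ : C₂ = series₂ (secondOrder f))
    (hM : M = series₁ (firstOrder h)) (hM₂ : M₂ = series₂ (secondOrder h)) :
    -- `C(x M(x)) = M(x)`
    C.subst (xM M) = M ∧
    -- `K = (x C(y) - y C(x)) / (x - y)` exists in `ℂ⟦x, y⟧`, has a logarithm, and
    -- `M(x, y) = H(x M(x), y M(y)) · …` with `H = C(x, y) - x y ∂²/∂x∂y log K`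
    (∃ K : Series₂,
      (MvPowerSeries.X 0 - MvPowerSeries.X 1) * K =
        MvPowerSeries.X 0 * inVar 1 C - MvPowerSeries.X 1 * inVar 0 C ∧
      MvPowerSeries.constantCoeff K = 1 ∧
      M₂ = substXM M (secondOrderH C₂ K) * derivFactor M) ∧
    -- the same relation with the correction term written out
    toFrac M₂ = toFrac (substXM M C₂ * derivFactor M) + correctionTerm M := by
  have hM' : M = momentSeries (firstOrder f) := by
    rw [hM, hconv, series₁_firstOrder_convolution_zeta hf]
  have hM₂' : M₂ = substXM M C₂ * derivFactor M + annularSeries (firstOrder f) (firstOrder f) := by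
    rw [hM₂, hconv, hM', hC₂, series₂_secondOrder_convolution_zeta hf]
  refine ⟨?_, ⟨kernelSeries C, sub_mul_kernelSeries C,
    constantCoeff_kernelSeries (by simp [hC, series₁]), ?_⟩, ?_⟩
  · rw [hC, hM', series₁_subst]
  · have h := substXM_log_mul_derivFactor (firstOrder f)
    rw [← hM', ← hC] at h
    rw [hM₂', secondOrderH, substXM_eq M (_ - _), map_sub, ← substXM_eq, ← substXM_eq, sub_mul, h,
      sub_neg_eq_add]
  · rw [hM₂', map_add, toFrac_annularSeries, ← hM']
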